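/- For a rational function $p=f/g\in\mathbb{C}(w)$ in lowest terms put $\deg_w(p)=\max\{\deg f,\deg g\}$, and for an $n\times n$ matrix $M$ over $\mathbb{C}(w)$ let $d_w(M)$ be the maximum of $\deg_w(M_{i,j})$ over all entries. Let $S=\mathbb{C}[w,w^{-1},(w-1)^{-1},(w-2)^{-1}]$. There is an algorithm (one and the same program for all inputs, which computes with elements of $\mathbb{C}$ by $+,-,\cdot,/$ and zero tests) that takes as input $n$, a matrix $M\in\mathrm{GL}_n(S)$, given by the coefficients of the numerators and denominators of its entries in lowest terms, and $d_w(M)$, and that finds matrices \[U_1\in\mathrm{GL}_n(\mathbb{C}[w^{-1},(w-2)^{-1}])\quad\text{and}\quad U_2\in\mathrm{GL}_n(\mathbb{C}[w,(w-1)^{-1}])\] such that $U_2MU_1\in\mathrm{GL}_n(\mathbb{C}[w,w^{-1}])$. The entries of $U_1$ and $U_2$ are returned as fractions of polynomials given by their coefficients. The number of steps of the algorithm, in particular the number of its field operations, and the number of coefficients returned per polynomial are bounded by a polynomial in $n$ and $d_w(M)$ that does not depend on $M$. -/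

import Mathlib

open scoped Polynomial

/-! ### Programs over a field, with a step count

A program is a finite piece of syntax that does not depend on the field or on the input. It acts on
finitely many named arrays of field elements (with any number of subscripts) and on registers that
hold natural numbers and serve as subscripts and loop counters. Field elements can only be combined
by `+`, `-`, `*`, `/` and tested for being zero. Every executed elementary command and every
evaluated test costs one step. -/

namespace FieldProgram

/-- Subscript expressions. There is no multiplication, so that unit cost per command is the usual
polynomially bounded convention. Subtraction is truncated. -/
inductive IdxExpr : Type
  | lit (m : ℕ)
  | reg (v : ℕ)
  | add (a b : IdxExpr)
  | sub (a b : IdxExpr)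

/-- A reference `name[sub₁, …, subₖ]` to an array cell that holds a field element. -/
structure Cell : Type where
  name : ℕ
  subs : List IdxExpr

/-- The four field operations. -/
inductive FieldOp : Type
  | add
  | sub
  | mul
  | div

/-- Tests: comparison of two subscript expressions, zero test of a field element, negation. -/
inductive Test : Type
  | lt (a b : IdxExpr)
  | isZero (x : Cell)
  | not (c : Test)

/-- Programs. The only field constants are integers. -/
inductive Cmd : Type
  | skip
  | setIdx (v : ℕ) (e : IdxExpr)
  | const (x : Cell) (z : ℤ)
  | move (x y : Cell)
  | arith (o : FieldOp) (x y z : Cell)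
  | seq (c₁ c₂ : Cmd)
  | ite (b : Test) (c₁ c₂ : Cmd)
  | loop (b : Test) (c : Cmd)

/-- A memory state: the natural-number registers and the cells of the field arrays
(addressed by the array name and the list of subscripts). -/
structure State (K : Type*) where
  idx : ℕ → ℕ
  val : ℕ × List ℕ → K

variable {K : Type*}

def IdxExpr.eval (s : State K) : IdxExpr → ℕ
  | .lit m => m
  | .reg v => s.idx v
  | .add a b => a.eval s + b.eval s
  | .sub a b => a.eval s - b.eval s

/-- The address that a reference denotes in a given state. -/
def Cell.addr (s : State K) (x : Cell) : ℕ × List ℕ :=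
  (x.name, x.subs.map (IdxExpr.eval s))

/-- The field element currently stored in a cell. -/
def Cell.get (s : State K) (x : Cell) : K :=
  s.val (x.addr s)

/-- The state after writing `a` into the cell `x`. -/
def Cell.set (s : State K) (x : Cell) (a : K) : State K :=
  { s with val := Function.update s.val (x.addr s) a }

def Test.Holds [Field K] (s : State K) : Test → Prop
  | .lt a b => a.eval s < b.eval s
  | .isZero x => x.get s = 0
  | .not c => ¬ c.Holds s

def FieldOp.eval [Field K] : FieldOp → K → K → K
  | .add, a, b => a + b
  | .sub, a, b => a - b
  | .mul, a, b => a * b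
  | .div, a, b => a / b

/-- `Exec c s t s'`: started in the state `s`, the program `c` halts after exactly `t` steps in the
state `s'`. A division by zero has no execution: the program gets stuck. `loop b c` is
"while `b` do `c`". -/
inductive Exec [Field K] : Cmd → State K → ℕ → State K → Prop
  | skip (s : State K) : Exec .skip s 1 s
  | setIdx (s : State K) (v : ℕ) (e : IdxExpr) :
      Exec (.setIdx v e) s 1 { s with idx := Function.update s.idx v (e.eval s) }
  | const (s : State K) (x : Cell) (z : ℤ) :
      Exec (.const x z) s 1 (x.set s (z : K))
  | move (s : State K) (x y : Cell) :
      Exec (.move x y) s 1 (x.set s (y.get s))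
  | arith (s : State K) (o : FieldOp) (x y z : Cell) (h : o = .div → z.get s ≠ 0) :
      Exec (.arith o x y z) s 1 (x.set s (o.eval (y.get s) (z.get s)))
  | seq {c₁ c₂ : Cmd} {s s₁ s₂ : State K} {t₁ t₂ : ℕ}
      (h₁ : Exec c₁ s t₁ s₁) (h₂ : Exec c₂ s₁ t₂ s₂) :
      Exec (.seq c₁ c₂) s (t₁ + t₂) s₂
  | iteTrue {b : Test} {c₁ c₂ : Cmd} {s s' : State K} {t : ℕ}
      (hb : b.Holds s) (h : Exec c₁ s t s') : Exec (.ite b c₁ c₂) s (t + 1) s'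
  | iteFalse {b : Test} {c₁ c₂ : Cmd} {s s' : State K} {t : ℕ}
      (hb : ¬ b.Holds s) (h : Exec c₂ s t s') : Exec (.ite b c₁ c₂) s (t + 1) s'
  | loopTrue {b : Test} {c : Cmd} {s s₁ s₂ : State K} {t₁ t₂ : ℕ}
      (hb : b.Holds s) (h₁ : Exec c s t₁ s₁) (h₂ : Exec (.loop b c) s₁ t₂ s₂) :
      Exec (.loop b c) s (t₁ + t₂ + 1) s₂
  | loopFalse {b : Test} {c : Cmd} {s : State K}
      (hb : ¬ b.Holds s) : Exec (.loop b c) s 1 s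

end FieldProgram

noncomputable section

namespace ClutchingReduction

/-- The degree of a rational function: the larger of the degrees of its numerator and its
denominator in lowest terms. -/
def ratDegree (f : RatFunc ℂ) : ℕ :=
  max f.num.natDegree f.denom.natDegree

/-- `d_w(M)`: the largest degree of an entry of `M`. -/
def matDegree {n : ℕ} (M : Matrix (Fin n) (Fin n) (RatFunc ℂ)) : ℕ :=
  Finset.univ.sup fun i => Finset.univ.sup fun j => ratDegree (M i j)

/-- The coordinate function `w`. -/
abbrev w : RatFunc ℂ := RatFunc.X

/-- `ℂ[w, w⁻¹, (w-1)⁻¹, (w-2)⁻¹]`. -/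
abbrev ringS : Subalgebra ℂ (RatFunc ℂ) :=
  Algebra.adjoin ℂ {w, w⁻¹, (w - 1)⁻¹, (w - 2)⁻¹}

/-- `ℂ[w⁻¹, (w-2)⁻¹]`. -/
abbrev ringOne : Subalgebra ℂ (RatFunc ℂ) :=
  Algebra.adjoin ℂ {w⁻¹, (w - 2)⁻¹}

/-- `ℂ[w, (w-1)⁻¹]`. -/
abbrev ringTwo : Subalgebra ℂ (RatFunc ℂ) :=
  Algebra.adjoin ℂ {w, (w - 1)⁻¹}

/-- `ℂ[w, w⁻¹]`. -/
abbrev ringLaurent : Subalgebra ℂ (RatFunc ℂ) :=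
  Algebra.adjoin ℂ {w, w⁻¹}

/-- An element of `GL_n(A)`, for a subring `A` of `ℂ(w)`, as a matrix over `ℂ(w)`. -/
def toRat {n : ℕ} {A : Subalgebra ℂ (RatFunc ℂ)} (M : GL (Fin n) A) :
    Matrix (Fin n) (Fin n) (RatFunc ℂ) :=
  (M : Matrix (Fin n) (Fin n) A).map fun a => (a : RatFunc ℂ)

open Classical in
/-- The initial state for the input `M`: register `0` holds `n`, register `1` holds `d_w(M)`,
the cells `0[i,j,k]` and `1[i,j,k]` (`i, j < n`, `k ≤ d_w(M)`) hold the `k`-th coefficients of the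
numerator and of the (monic) denominator of `M i j` in lowest terms; everything else is zero. -/
def inputState {n : ℕ} (M : Matrix (Fin n) (Fin n) (RatFunc ℂ)) : FieldProgram.State ℂ where
  idx := fun v => if v = 0 then n else if v = 1 then matDegree M else 0
  val := fun a =>
    match a with
    | (0, [i, j, k]) => if h : i < n ∧ j < n then (M ⟨i, h.1⟩ ⟨j, h.2⟩).num.coeff k else 0
    | (1, [i, j, k]) => if h : i < n ∧ j < n then (M ⟨i, h.1⟩ ⟨j, h.2⟩).denom.coeff k else 0
    | _ => 0

/-- The polynomial of degree at most `e` with coefficients `a[i,j,0], …, a[i,j,e]`. -/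
def readPoly (s : FieldProgram.State ℂ) (a e i j : ℕ) : ℂ[X] :=
  ∑ k ∈ Finset.range (e + 1), Polynomial.C (s.val (a, [i, j, k])) * Polynomial.X ^ k

/-- The state `s` stores the matrix `A`: register `r` holds a degree bound, and the arrays `p` and
`q` hold, up to that degree, the coefficients of numerators and (nonzero) denominators of the
entries of `A`. -/
def Stores (s : FieldProgram.State ℂ) (r p q : ℕ) {n : ℕ}
    (A : Matrix (Fin n) (Fin n) (RatFunc ℂ)) : Prop :=
  ∀ i j : Fin n, readPoly s q (s.idx r) i j ≠ 0 ∧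
    A i j = algebraMap ℂ[X] (RatFunc ℂ) (readPoly s p (s.idx r) i j) /
      algebraMap ℂ[X] (RatFunc ℂ) (readPoly s q (s.idx r) i j)

end ClutchingReduction

end

/-! The two multipliers can be found independently, each by a local problem at one point. If `U₁`
over `ringOne` makes `M U₁` regular and invertible at `2`, and `U₂` over `ringTwo` makes `U₂ M`
regular and invertible at `1`, then `U₂ M U₁` is invertible over `ringS` and at both points:
functions in `ringOne` have no pole at `1`, and functions in `ringTwo` have none at `2`. An element
of `ringS` regular at `1` and `2` is a Laurent polynomial (`mem_ringLaurent`); this applies to the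
entries and to the inverse of the determinant. Transposition turns the problem for `U₂` into one
about right multipliers of `Mᵀ`.

For the local problem at `p`, let `d = d_w(M)` and clear denominators: `A₀ = (w (w-1) (w-2))^d M` is
polynomial of degree at most `4d`, so `det A₀ ≠ 0` vanishes at `p` to order at most `K = 4dn`.
Transform `A = A₀` until `A(p) = 1`. Suppose the first `r` columns of `A(p)` are unit vectors. If
column `r` of `A(p)` has a nonzero entry in a row from `r` on, constant row operations make it a
unit vector too. Otherwise it is a combination of the earlier columns; after subtracting that
combination, column `r` of `A` is divisible by `w - p` and is multiplied by `(α w + β)/(w - p)`.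
This factor is a unit of the relevant ring, `w/(w-2)` or `1/(w-1)`, and lowers the order of `det A`
at `p` by one. Hence `m + (n - r)`, with `m` that order, drops in every step, and at most `K + n`
steps are needed. Degrees do not grow (`ReduceInv`, `reduceAll_spec`).

The row operations are constant and need not be recorded. The column operations `V` are recorded as
the polynomial matrix `P = (w-p)^(d+K) V`; it stays polynomial because `(w-p)^m` divides it
throughout. Finally `U = P / ((α w + β)^d (w-p)^K)` is a multiplier (`inGL_of_tracked`): the factor
`((w-p)/(α w + β))^d` passed from `P` to `U` removes the zero of order `d` at `p` introduced by
clearing denominators.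

To obtain a program, algorithms are written as functions on `PolyState`, whose arrays hold
polynomials. `Rep` relates such states to concrete memory with `N` coefficients per polynomial, and
`Realizable` says that one program carries out the function in time polynomial in `N`. It is closed
under composition, branching, bounded iteration and array assignment. Correctness is then proved for
the functions alone, with `N = 4dn + 4d + n + 2`. -/

noncomputable section

namespace FieldProgram

/-- Registers together with doubly indexed arrays of polynomials. -/
structure PolyState where
  reg : ℕ → ℕ
  arr : ℕ → ℕ → ℕ → ℂ[X]

/-- The concrete state `s` represents `σ` with polynomials of degree less than `N`. Registers and
array names from `100` on are scratch space; register `100` holds `N`. -/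
structure Rep (N : ℕ) (s : State ℂ) (σ : PolyState) : Prop where
  dim : s.idx 100 = N
  reg : ∀ v < 100, s.idx v = σ.reg v
  coeff : ∀ a < 100, ∀ i j k, k < N → s.val (a, [i, j, k]) = (σ.arr a i j).coeff k
  deg : ∀ a i j, (σ.arr a i j).natDegree < N

/-- Changes confined to scratch space are invisible to the represented state. -/
theorem Rep.congr {N : ℕ} {s s' : State ℂ} {σ : PolyState} (h : Rep N s σ)
    (hi : ∀ v ≤ 100, s'.idx v = s.idx v)
    (hv : ∀ x : ℕ × List ℕ, x.1 < 100 → s'.val x = s.val x) : Rep N s' σ where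
  dim := by rw [hi 100 le_rfl, h.dim]
  reg v hlt := by rw [hi v hlt.le, h.reg v hlt]
  coeff a ha i j k hk := by rw [hv _ ha, h.coeff a ha i j k hk]
  deg := h.deg

/-! ### Index expressions, tests and field expressions

They may depend on the state and on three counters `i`, `j`, `k`, kept in registers
`101`, `102`, `103`. -/

def IdxComp (f : PolyState → ℕ → ℕ → ℕ → ℕ) : Prop :=
  ∃ e : IdxExpr, ∀ N s σ, Rep N s σ → e.eval s = f σ (s.idx 101) (s.idx 102) (s.idx 103)

def TestComp (p : PolyState → ℕ → ℕ → ℕ → Prop) : Prop :=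
  ∃ b : Test, ∀ N s σ, Rep N s σ → (b.Holds s ↔ p σ (s.idx 101) (s.idx 102) (s.idx 103))

/-- `e` can be computed into the scratch cell `100[m]` without touching `100[m']`, `m' < m`. -/
def ExprComp (e : PolyState → ℕ → ℕ → ℕ → ℂ) : Prop :=
  ∀ m : ℕ, ∃ (c : Cmd) (T : ℕ), ∀ N s σ, Rep N s σ → ∃ t s', Exec c s t s' ∧ t ≤ T ∧
    s'.idx = s.idx ∧ s'.val (100, [m]) = e σ (s.idx 101) (s.idx 102) (s.idx 103) ∧
    ∀ x : ℕ × List ℕ, (x.1 ≠ 100 ∨ ∃ m' < m, x = (100, [m'])) → s'.val x = s.val x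

theorem IdxComp.lit (m : ℕ) : IdxComp fun _ _ _ _ => m := ⟨.lit m, fun _ _ _ _ => rfl⟩

theorem IdxComp.fst : IdxComp fun _ i _ _ => i := ⟨.reg 101, fun _ _ _ _ => rfl⟩

theorem IdxComp.snd : IdxComp fun _ _ j _ => j := ⟨.reg 102, fun _ _ _ _ => rfl⟩

theorem IdxComp.trd : IdxComp fun _ _ _ k => k := ⟨.reg 103, fun _ _ _ _ => rfl⟩

theorem IdxComp.reg {v : ℕ} (hv : v < 100) : IdxComp fun σ _ _ _ => σ.reg v :=
  ⟨.reg v, fun _ _ _ h => h.reg v hv⟩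

theorem IdxComp.add {f g : PolyState → ℕ → ℕ → ℕ → ℕ} (hf : IdxComp f) (hg : IdxComp g) :
    IdxComp fun σ i j k => f σ i j k + g σ i j k := by
  obtain ⟨e, he⟩ := hf
  obtain ⟨e', he'⟩ := hg
  exact ⟨.add e e', fun N s σ h => by simp only [IdxExpr.eval, he N s σ h, he' N s σ h]⟩

theorem IdxComp.sub {f g : PolyState → ℕ → ℕ → ℕ → ℕ} (hf : IdxComp f) (hg : IdxComp g) :
    IdxComp fun σ i j k => f σ i j k - g σ i j k := by
  obtain ⟨e, he⟩ := hf
  obtain ⟨e', he'⟩ := hg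
  exact ⟨.sub e e', fun N s σ h => by simp only [IdxExpr.eval, he N s σ h, he' N s σ h]⟩

theorem TestComp.lt {f g : PolyState → ℕ → ℕ → ℕ → ℕ} (hf : IdxComp f) (hg : IdxComp g) :
    TestComp fun σ i j k => f σ i j k < g σ i j k := by
  obtain ⟨e, he⟩ := hf
  obtain ⟨e', he'⟩ := hg
  exact ⟨.lt e e', fun N s σ h => by simp only [Test.Holds, he N s σ h, he' N s σ h]⟩

theorem TestComp.coeff_zero_eq_zero {a : ℕ} (ha : a < 100) {f g : PolyState → ℕ → ℕ → ℕ → ℕ}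
    (hf : IdxComp f) (hg : IdxComp g) :
    TestComp fun σ i j k => (σ.arr a (f σ i j k) (g σ i j k)).coeff 0 = 0 := by
  obtain ⟨e, he⟩ := hf
  obtain ⟨e', he'⟩ := hg
  refine ⟨.isZero ⟨a, [e, e', .lit 0]⟩, fun N s σ h => ?_⟩
  have h0 : 0 < N := (Nat.zero_le _).trans_lt (h.deg 0 0 0)
  simp only [Test.Holds, Cell.get, Cell.addr, List.map_cons, List.map_nil, he N s σ h, he' N s σ h,
    IdxExpr.eval, h.coeff a ha _ _ _ h0]

/-- The scratch cell `100[m]`. -/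
abbrev tmp (m : ℕ) : Cell := ⟨100, [.lit m]⟩

theorem tmp_addr (s : State ℂ) (m : ℕ) : (tmp m).addr s = (100, [m]) := rfl

theorem set_frame {s : State ℂ} {m : ℕ} {z : ℂ} {x : ℕ × List ℕ}
    (hx : x.1 ≠ 100 ∨ ∃ m' < m, x = (100, [m'])) : ((tmp m).set s z).val x = s.val x := by
  simp only [Cell.set, tmp_addr]
  apply Function.update_of_ne
  rintro rfl
  rcases hx with h | ⟨m', h, h'⟩
  · exact h rfl
  · simp only [Prod.mk.injEq, List.cons.injEq, and_true, true_and] at h'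
    omega

theorem set_tmp (s : State ℂ) (m : ℕ) (z : ℂ) : ((tmp m).set s z).val (100, [m]) = z := by
  simp [Cell.set, tmp_addr]

theorem ExprComp.const (z : ℤ) : ExprComp fun _ _ _ _ => (z : ℂ) := fun m =>
  ⟨.const (tmp m) z, 1, fun _ s _ _ => ⟨1, _, .const s _ z, le_rfl, rfl, set_tmp _ _ _,
    fun _ hx => set_frame hx⟩⟩

/-- The result is a separate function `f` that agrees with the branches, so that it may be a
coefficient of `C a` or `X * q`, which is not literally a case distinction. -/
theorem ExprComp.ite {p : PolyState → ℕ → ℕ → ℕ → Prop} (hp : TestComp p)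
    {e e' : PolyState → ℕ → ℕ → ℕ → ℂ} (he : ExprComp e) (he' : ExprComp e')
    {f : PolyState → ℕ → ℕ → ℕ → ℂ} (hf : ∀ σ i j k, p σ i j k → f σ i j k = e σ i j k)
    (hf' : ∀ σ i j k, ¬ p σ i j k → f σ i j k = e' σ i j k) : ExprComp f := by
  intro m
  obtain ⟨b, hb⟩ := hp
  obtain ⟨c, T, hc⟩ := he m
  obtain ⟨c', T', hc'⟩ := he' m
  refine ⟨.ite b c c', T + T' + 1, fun N s σ h => ?_⟩
  by_cases hbs : b.Holds s
  · obtain ⟨t, s', h1, h2, h3, h4, h5⟩ := hc N s σ h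
    exact ⟨t + 1, s', .iteTrue hbs h1, by omega, h3,
      by rw [h4, hf _ _ _ _ ((hb N s σ h).1 hbs)], h5⟩
  · obtain ⟨t, s', h1, h2, h3, h4, h5⟩ := hc' N s σ h
    exact ⟨t + 1, s', .iteFalse hbs h1, by omega, h3,
      by rw [h4, hf' _ _ _ _ (fun hh => hbs ((hb N s σ h).2 hh))], h5⟩

/-- `Rep` does not control cells with last subscript `N` or more, hence the test against register
`100`; beyond it the coefficient is zero by the degree bound. -/
theorem ExprComp.coeff {a : ℕ} (ha : a < 100) {f g l : PolyState → ℕ → ℕ → ℕ → ℕ}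
    (hf : IdxComp f) (hg : IdxComp g) (hl : IdxComp l) :
    ExprComp fun σ i j k => (σ.arr a (f σ i j k) (g σ i j k)).coeff (l σ i j k) := by
  intro m
  obtain ⟨e, he⟩ := hf
  obtain ⟨e', he'⟩ := hg
  obtain ⟨e'', he''⟩ := hl
  refine ⟨.ite (.lt e'' (.reg 100)) (.move (tmp m) ⟨a, [e, e', e'']⟩) (.const (tmp m) 0), 2,
    fun N s σ h => ?_⟩
  have hN := h.dim
  by_cases hlt : (Test.lt e'' (.reg 100)).Holds s
  · refine ⟨2, _, .iteTrue hlt (.move _ _ _), le_rfl, rfl, ?_, fun _ hx => set_frame hx⟩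
    simp only [Test.Holds, IdxExpr.eval, hN, he'' N s σ h] at hlt
    rw [set_tmp]
    simp only [Cell.get, Cell.addr, List.map_cons, List.map_nil, he N s σ h, he' N s σ h,
      he'' N s σ h, h.coeff a ha _ _ _ hlt]
  · refine ⟨2, _, .iteFalse hlt (.const _ _ _), le_rfl, rfl, ?_, fun _ hx => set_frame hx⟩
    simp only [Test.Holds, IdxExpr.eval, hN, he'' N s σ h, not_lt] at hlt
    rw [set_tmp]
    beta_reduce
    rw [Polynomial.coeff_eq_zero_of_natDegree_lt ((h.deg _ _ _).trans_le hlt), Int.cast_zero]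

/-- Array `100` acts as a stack: evaluating the second operand at height `m + 1` preserves the first
one in `100[m]`. Two steps are allowed because a division is preceded by a zero test. -/
theorem ExprComp.binop {op : ℂ → ℂ → ℂ}
    (hop : ∀ m, ∃ c : Cmd, ∀ s : State ℂ, ∃ t ≤ 2, Exec c s t
      ((tmp m).set s (op (s.val (100, [m])) (s.val (100, [m + 1])))))
    {e e' : PolyState → ℕ → ℕ → ℕ → ℂ} (he : ExprComp e)
    (he' : ExprComp e') : ExprComp fun σ i j k => op (e σ i j k) (e' σ i j k) := by
  intro m
  obtain ⟨c, T, hc⟩ := he m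
  obtain ⟨c', T', hc'⟩ := he' (m + 1)
  obtain ⟨c'', hc''⟩ := hop m
  refine ⟨.seq c (.seq c' c''), T + (T' + 2), fun N s σ h => ?_⟩
  obtain ⟨t₁, s₁, h1, h2, h3, h4, h5⟩ := hc N s σ h
  have hR₁ : Rep N s₁ σ := h.congr (fun v _ => by rw [h3])
    (fun x hx => h5 x (Or.inl (by omega)))
  obtain ⟨t₂, s₂, g1, g2, g3, g4, g5⟩ := hc' N s₁ σ hR₁
  obtain ⟨t₃, ht₃, h6⟩ := hc'' s₂
  refine ⟨_, _, .seq h1 (.seq g1 h6), by omega, g3.trans h3, ?_, fun x hx => ?_⟩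
  · rw [set_tmp, g4, g5 _ (Or.inr ⟨m, by omega, rfl⟩), h4, h3]
  · rw [set_frame hx, g5 x (hx.imp_right fun ⟨m', hm', hx'⟩ => ⟨m', by omega, hx'⟩), h5 x hx]

theorem ExprComp.add {e e' : PolyState → ℕ → ℕ → ℕ → ℂ} (he : ExprComp e)
    (he' : ExprComp e') : ExprComp fun σ i j k => e σ i j k + e' σ i j k :=
  .binop (op := (· + ·)) (fun m => ⟨.arith .add (tmp m) (tmp m) (tmp (m + 1)), fun s =>
    ⟨1, by norm_num, .arith s .add _ _ _ (by simp)⟩⟩) he he'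

theorem ExprComp.sub {e e' : PolyState → ℕ → ℕ → ℕ → ℂ} (he : ExprComp e)
    (he' : ExprComp e') : ExprComp fun σ i j k => e σ i j k - e' σ i j k :=
  .binop (op := (· - ·)) (fun m => ⟨.arith .sub (tmp m) (tmp m) (tmp (m + 1)), fun s =>
    ⟨1, by norm_num, .arith s .sub _ _ _ (by simp)⟩⟩) he he'

theorem ExprComp.mul {e e' : PolyState → ℕ → ℕ → ℕ → ℂ} (he : ExprComp e)
    (he' : ExprComp e') : ExprComp fun σ i j k => e σ i j k * e' σ i j k :=
  .binop (op := (· * ·)) (fun m => ⟨.arith .mul (tmp m) (tmp m) (tmp (m + 1)), fun s =>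
    ⟨1, by norm_num, .arith s .mul _ _ _ (by simp)⟩⟩) he he'

/-- The program would get stuck on a zero divisor, so it tests first and stores `0`, in agreement
with `x / 0 = 0`. No nonvanishing hypothesis has to be carried along. -/
theorem ExprComp.div {e e' : PolyState → ℕ → ℕ → ℕ → ℂ} (he : ExprComp e)
    (he' : ExprComp e') : ExprComp fun σ i j k => e σ i j k / e' σ i j k := by
  refine .binop (op := (· / ·)) (fun m => ⟨.ite (.isZero (tmp (m + 1))) (.const (tmp m) 0)
    (.arith .div (tmp m) (tmp m) (tmp (m + 1))), fun s => ?_⟩) he he'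
  by_cases h0 : s.val (100, [m + 1]) = 0
  · exact ⟨2, le_rfl, .iteTrue h0 (by simpa [h0] using Exec.const s (tmp m) 0)⟩
  · exact ⟨2, le_rfl, .iteFalse h0 (.arith s .div _ _ _ fun _ => h0)⟩

/-! ### Counting loops -/

def State.incr (s : State ℂ) (v : ℕ) : State ℂ :=
  { s with idx := Function.update s.idx v (s.idx v + 1) }

/-- `while v < b do (c; v := v + 1)` -/
def countLoop (v b : ℕ) (c : Cmd) : Cmd :=
  .loop (.lt (.reg v) (.reg b)) (.seq c (.setIdx v (.add (.reg v) (.lit 1))))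

/-- `I m` is the invariant before round `m`. A round costs `T` for the body and two for test and
increment; the final failing test adds one. -/
theorem exec_countLoop {c : Cmd} {v b T N : ℕ} (I : ℕ → State ℂ → Prop)
    (hb : ∀ m s, I m s → s.idx b = N) (hv : ∀ m s, I m s → s.idx v = m)
    (step : ∀ m < N, ∀ s, I m s → ∃ t s', Exec c s t s' ∧ t ≤ T ∧ I (m + 1) (s'.incr v)) :
    ∀ s, I 0 s → ∃ t s', Exec (countLoop v b c) s t s' ∧ t ≤ N * (T + 2) + 1 ∧ I N s' := by
  have key : ∀ k m s, m + k = N → I m s →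
      ∃ t s', Exec (countLoop v b c) s t s' ∧ t ≤ k * (T + 2) + 1 ∧ I N s' := by
    intro k
    induction k with
    | zero =>
      intro m s hm hI
      obtain rfl : m = N := by omega
      exact ⟨1, s, .loopFalse (by simp [Test.Holds, IdxExpr.eval, hb _ _ hI, hv _ _ hI]),
        by omega, hI⟩
    | succ k ih =>
      intro m s hm hI
      obtain ⟨t, s', h1, h2, h3⟩ := step m (by omega) s hI
      obtain ⟨t', s'', h4, h5, h6⟩ := ih (m + 1) (s'.incr v) (by omega) h3
      refine ⟨_, s'', .loopTrue ?_ (.seq h1 (.setIdx _ _ _)) h4, ?_, h6⟩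
      · simp only [Test.Holds, IdxExpr.eval, hb _ _ hI, hv _ _ hI]
        omega
      · rw [add_mul]
        omega
  exact fun s hs => key N 0 s (by omega) hs

/-- `v := 0; while v < b do (c; v := v + 1)` -/
def forLoop (v b : ℕ) (c : Cmd) : Cmd :=
  .seq (.setIdx v (.lit 0)) (countLoop v b c)

def State.setReg (s : State ℂ) (v m : ℕ) : State ℂ :=
  { s with idx := Function.update s.idx v m }

theorem exec_forLoop {c : Cmd} {v b T N : ℕ} (I : ℕ → State ℂ → Prop)
    (hb : ∀ m s, I m s → s.idx b = N) (hv : ∀ m s, I m s → s.idx v = m)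
    (step : ∀ m < N, ∀ s, I m s → ∃ t s', Exec c s t s' ∧ t ≤ T ∧ I (m + 1) (s'.incr v))
    (s : State ℂ) (hs : I 0 (s.setReg v 0)) :
    ∃ t s', Exec (forLoop v b c) s t s' ∧ t ≤ N * (T + 2) + 2 ∧ I N s' := by
  obtain ⟨t, s', h1, h2, h3⟩ := exec_countLoop I hb hv step _ hs
  exact ⟨_, s', .seq (.setIdx _ _ _) h1, by omega, h3⟩

/-! ### Filling an array cell by cell -/

/-- `s` arises from `s₀` by storing the values `g i j k` in the cells `b[i,j,k]` with `D i j k`,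
up to scratch cells and counters. -/
structure Filled (s₀ : State ℂ) (b : ℕ) (g : ℕ → ℕ → ℕ → ℂ) (D : ℕ → ℕ → ℕ → Prop)
    (s : State ℂ) : Prop where
  idx : ∀ v, v ≠ 101 → v ≠ 102 → v ≠ 103 → s.idx v = s₀.idx v
  val : ∀ i j k, D i j k → s.val (b, [i, j, k]) = g i j k
  frame : ∀ x : ℕ × List ℕ, x.1 ≠ 100 → (∀ i j k, D i j k → x ≠ (b, [i, j, k])) →
    s.val x = s₀.val x

theorem Filled.mono {s₀ : State ℂ} {b : ℕ} {g : ℕ → ℕ → ℕ → ℂ} {D D' : ℕ → ℕ → ℕ → Prop}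
    {s s' : State ℂ} (h : Filled s₀ b g D s) (hD : ∀ i j k, D i j k ↔ D' i j k)
    (hval : s'.val = s.val)
    (hidx : ∀ v, v ≠ 101 → v ≠ 102 → v ≠ 103 → s'.idx v = s.idx v) : Filled s₀ b g D' s' where
  idx v h1 h2 h3 := by rw [hidx v h1 h2 h3, h.idx v h1 h2 h3]
  val i j k hd := by rw [hval, h.val i j k ((hD i j k).2 hd)]
  frame x hx hd := by
    rw [hval, h.frame x hx fun i j k h => hd i j k ((hD i j k).1 h)]

/-- The cells visited before `(i, j, k)`, in the lexicographic order of the nested loops. -/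
def Done (N i j k i' j' k' : ℕ) : Prop :=
  j' < N ∧ k' < N ∧ (i' < i ∨ i' = i ∧ (j' < j ∨ j' = j ∧ k' < k))

theorem State.incr_idx_of_ne (s : State ℂ) {v u : ℕ} (h : u ≠ v) :
    (s.incr v).idx u = s.idx u := Function.update_of_ne h _ _

theorem State.incr_idx_self (s : State ℂ) (v : ℕ) : (s.incr v).idx v = s.idx v + 1 :=
  Function.update_self _ _ _

theorem State.setReg_idx_of_ne (s : State ℂ) {v u : ℕ} (m : ℕ) (h : u ≠ v) :
    (s.setReg v m).idx u = s.idx u := Function.update_of_ne h _ _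

theorem State.setReg_idx_self (s : State ℂ) (v m : ℕ) : (s.setReg v m).idx v = m :=
  Function.update_self _ _ _

/-- The three nested loops that run the counters through `i, j, k < N`. -/
def fillLoop (c : Cmd) : Cmd :=
  forLoop 101 100 (forLoop 102 100 (forLoop 103 100 c))

/-- The body need only work in states that differ from `s₀` in array `b`, scratch cells and
counters. Thus `g` can be given by the original contents of the other arrays. -/
theorem exec_fillLoop {c : Cmd} {T N b : ℕ} {g : ℕ → ℕ → ℕ → ℂ} {s₀ : State ℂ}
    (hN : s₀.idx 100 = N) (hb : b ≠ 100)
    (hc : ∀ s D, Filled s₀ b g D s → s.idx 101 < N → s.idx 102 < N → s.idx 103 < N →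
      ∃ t s', Exec c s t s' ∧ t ≤ T ∧ s'.idx = s.idx ∧
        s'.val (b, [s.idx 101, s.idx 102, s.idx 103]) = g (s.idx 101) (s.idx 102) (s.idx 103) ∧
        ∀ x : ℕ × List ℕ, x.1 ≠ 100 → x ≠ (b, [s.idx 101, s.idx 102, s.idx 103]) →
          s'.val x = s.val x) :
    ∃ t s', Exec (fillLoop c) s₀ t s' ∧
      t ≤ N * (N * (N * (T + 2) + 2 + 2) + 2 + 2) + 2 ∧
      Filled s₀ b g (fun i j k => i < N ∧ j < N ∧ k < N) s' := by
  have dim : ∀ {D s}, Filled s₀ b g D s → s.idx 100 = N := fun h => by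
    rw [h.idx 100 (by norm_num) (by norm_num) (by norm_num), hN]
  have main := exec_forLoop (c := forLoop 102 100 (forLoop 103 100 c))
    (v := 101) (b := 100) (T := N * (N * (T + 2) + 2 + 2) + 2) (N := N)
    (fun i s => Filled s₀ b g (Done N i 0 0) s ∧ s.idx 101 = i)
    (fun _ _ h => dim h.1) (fun _ _ h => h.2) ?_ s₀ ?_
  · obtain ⟨t, s', h1, h2, h3, _⟩ := main
    refine ⟨t, s', h1, h2, h3.mono (fun i j k => ?_) rfl fun _ _ _ _ => rfl⟩
    simp only [Done]
    omega
  · rintro i hi s ⟨hs, rfl⟩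
    have main := exec_forLoop (c := forLoop 103 100 c)
      (v := 102) (b := 100) (T := N * (T + 2) + 2) (N := N)
      (fun j s' => Filled s₀ b g (Done N (s.idx 101) j 0) s' ∧ s'.idx 101 = s.idx 101 ∧
        s'.idx 102 = j)
      (fun _ _ h => dim h.1) (fun _ _ h => h.2.2) ?_ s ?_
    · obtain ⟨t, s', h1, h2, h3, h4, _⟩ := main
      refine ⟨t, s', h1, h2, h3.mono (fun i j k => ?_) rfl fun v hv _ _ =>
        s'.incr_idx_of_ne hv, by rw [State.incr_idx_self, h4]⟩
      simp only [Done]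
      omega
    · rintro j hj s₁ ⟨hs₁, hi₁, rfl⟩
      have main := exec_forLoop (c := c)
        (v := 103) (b := 100) (T := T) (N := N)
        (fun k s' => Filled s₀ b g (Done N (s.idx 101) (s₁.idx 102) k) s' ∧
          s'.idx 101 = s.idx 101 ∧ s'.idx 102 = s₁.idx 102 ∧ s'.idx 103 = k)
        (fun _ _ h => dim h.1) (fun _ _ h => h.2.2.2) ?_ s₁ ?_
      · obtain ⟨t, s', h1, h2, h3, h4, h5, _⟩ := main
        refine ⟨t, s', h1, h2, h3.mono (fun i j k => ?_) rfl fun v _ hv _ =>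
          s'.incr_idx_of_ne hv, ?_, by rw [State.incr_idx_self, h5]⟩
        · simp only [Done]
          omega
        · rw [State.incr_idx_of_ne _ (by norm_num), h4]
      · rintro k hk s₂ ⟨hs₂, hi₂, hj₂, rfl⟩
        obtain ⟨t, s', h1, h2, h3, h4, h5⟩ := hc s₂ _ hs₂ (by omega) (by omega) hk
        have e1 : (s'.incr 103).idx 101 = s.idx 101 := by
          rw [State.incr_idx_of_ne _ (by norm_num), h3, hi₂]
        have e2 : (s'.incr 103).idx 102 = s₁.idx 102 := by
          rw [State.incr_idx_of_ne _ (by norm_num), h3, hj₂]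
        refine ⟨t, s', h1, h2, ⟨fun v hv1 hv2 hv3 => ?_, fun i' j' k' hd => ?_,
          fun x hx hd => ?_⟩, e1, e2, by rw [State.incr_idx_self, h3]⟩
        · rw [State.incr_idx_of_ne _ hv3, h3, hs₂.idx v hv1 hv2 hv3]
        · change s'.val _ = _
          by_cases heq : i' = s₂.idx 101 ∧ j' = s₂.idx 102 ∧ k' = s₂.idx 103
          · obtain ⟨rfl, rfl, rfl⟩ := heq
            exact h4
          · have hne : ((b, [i', j', k']) : ℕ × List ℕ) ≠
                (b, [s₂.idx 101, s₂.idx 102, s₂.idx 103]) := by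
              simpa using heq
            have hdone : Done N (s.idx 101) (s₁.idx 102) (s₂.idx 103) i' j' k' := by
              simp only [Done] at hd ⊢
              omega
            rw [h5 _ hb hne, hs₂.val _ _ _ hdone]
        · change s'.val _ = _
          rw [h5 x hx (hd _ _ _ (by simp only [Done]; omega)), hs₂.frame x hx fun i j k h =>
            hd i j k (by simp only [Done] at h ⊢; omega)]
      · refine ⟨hs₁.mono (fun i j k => ?_) rfl fun v _ _ hv =>
          s₁.setReg_idx_of_ne _ hv, ?_, ?_, s₁.setReg_idx_self _ _⟩
        · simp only [Done]
        · rw [State.setReg_idx_of_ne _ _ (by norm_num), hi₁]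
        · rw [State.setReg_idx_of_ne _ _ (by norm_num)]
    · refine ⟨hs.mono (fun i j k => ?_) rfl fun v _ hv _ =>
        s.setReg_idx_of_ne _ hv, ?_, s.setReg_idx_self _ _⟩
      · simp only [Done]
      · rw [State.setReg_idx_of_ne _ _ (by norm_num)]
  · refine ⟨⟨fun v hv _ _ => s₀.setReg_idx_of_ne _ hv, fun i j k hd => ?_, fun _ _ _ => rfl⟩,
      s₀.setReg_idx_self _ _⟩
    simp only [Done] at hd
    omega

/-! ### Realizable transformations -/

/-- The part of `p` of degree less than `N`. -/
def cut (N : ℕ) (p : ℂ[X]) : ℂ[X] := ∑ k ∈ Finset.range N, Polynomial.monomial k (p.coeff k)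

theorem coeff_cut (N : ℕ) (p : ℂ[X]) (k : ℕ) :
    (cut N p).coeff k = if k < N then p.coeff k else 0 := by
  simp [cut, Polynomial.coeff_monomial]

theorem cut_eq_self {N : ℕ} {p : ℂ[X]} (h : p.natDegree < N) : cut N p = p := by
  ext k
  rw [coeff_cut]
  split_ifs with hk
  · rfl
  · exact (Polynomial.coeff_eq_zero_of_natDegree_lt (by omega)).symm

theorem natDegree_cut_lt {N : ℕ} (hN : 0 < N) (p : ℂ[X]) : (cut N p).natDegree < N := by
  refine Nat.lt_of_le_pred hN (Polynomial.natDegree_le_iff_coeff_eq_zero.2 fun k hk => ?_)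
  rw [coeff_cut, if_neg]
  rw [Nat.pred_eq_sub_one] at hk
  omega

/-- One program realizes `F N` on all states, for every `N`, in time polynomial in `N`. -/
def Realizable (F : ℕ → PolyState → PolyState) : Prop :=
  ∃ (c : Cmd) (l : ℕ) (T : ℕ[X]), 104 ≤ l ∧ ∀ N s σ, Rep N s σ → ∃ t s', Exec c s t s' ∧
    t ≤ T.eval N ∧ Rep N s' (F N σ) ∧ ∀ v, l ≤ v → s'.idx v = s.idx v

theorem Realizable.comp {F G : ℕ → PolyState → PolyState} (hF : Realizable F)
    (hG : Realizable G) : Realizable fun N σ => G N (F N σ) := by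
  obtain ⟨c, l, T, hl, hc⟩ := hF
  obtain ⟨c', l', T', hl', hc'⟩ := hG
  refine ⟨.seq c c', max l l', T + T', by omega, fun N s σ h => ?_⟩
  obtain ⟨t, s₁, h1, h2, h3, h4⟩ := hc N s σ h
  obtain ⟨t', s₂, g1, g2, g3, g4⟩ := hc' N s₁ _ h3
  refine ⟨_, _, .seq h1 g1, by rw [Polynomial.eval_add]; omega, g3, fun v hv => ?_⟩
  rw [g4 v (by omega), h4 v (by omega)]

theorem Realizable.ite {p : PolyState → Prop} [DecidablePred p] (hp : TestComp fun σ _ _ _ => p σ)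
    {F G : ℕ → PolyState → PolyState} (hF : Realizable F) (hG : Realizable G) :
    Realizable fun N σ => if p σ then F N σ else G N σ := by
  obtain ⟨b, hb⟩ := hp
  obtain ⟨c, l, T, hl, hc⟩ := hF
  obtain ⟨c', l', T', hl', hc'⟩ := hG
  refine ⟨.ite b c c', max l l', T + T' + 1, by omega, fun N s σ h => ?_⟩
  simp only [Polynomial.eval_add, Polynomial.eval_one]
  by_cases hs : b.Holds s
  · obtain ⟨t, s₁, h1, h2, h3, h4⟩ := hc N s σ h
    rw [if_pos ((hb N s σ h).1 hs)]
    exact ⟨_, _, .iteTrue hs h1, by omega, h3, fun v hv => h4 v (by omega)⟩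
  · obtain ⟨t, s₁, h1, h2, h3, h4⟩ := hc' N s σ h
    rw [if_neg fun hh => hs ((hb N s σ h).2 hh)]
    exact ⟨_, _, .iteFalse hs h1, by omega, h3, fun v hv => h4 v (by omega)⟩

theorem Realizable.id : Realizable fun _ σ => σ :=
  ⟨.skip, 104, 1, le_rfl, fun _ s _ h => ⟨1, s, .skip s, by simp, h, fun _ _ => rfl⟩⟩

def PolyState.setReg (σ : PolyState) (v m : ℕ) : PolyState :=
  { σ with reg := Function.update σ.reg v m }

theorem Realizable.setReg {v : ℕ} (hv : v < 100) {f : PolyState → ℕ}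
    (hf : IdxComp fun σ _ _ _ => f σ) : Realizable fun _ σ => σ.setReg v (f σ) := by
  obtain ⟨e, he⟩ := hf
  refine ⟨.setIdx v e, 104, 1, le_rfl, fun N s σ h => ⟨1, _, .setIdx s v e, by simp,
    ⟨?_, fun u hu => ?_, h.coeff, h.deg⟩, fun u hu => ?_⟩⟩
  · exact (Function.update_of_ne (by omega) _ _).trans h.dim
  · rcases eq_or_ne u v with rfl | hne
    · simp [PolyState.setReg, he N s σ h]
    · simp [PolyState.setReg, hne, h.reg u hu]
  · exact Function.update_of_ne (by omega) _ _

/-- Capping the number of rounds at `N` keeps the running time polynomial in `N` in every state,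
whatever the value of `f`. The counter and its bound live in the registers `l` and `l + 1`, which
the body does not touch. -/
theorem Realizable.iterate_min {f : ℕ → PolyState → ℕ}
    (hf : ∃ e : IdxExpr, ∀ N s σ, Rep N s σ → e.eval s = f N σ)
    {F : ℕ → PolyState → PolyState} (hF : Realizable F) :
    Realizable fun N σ => (F N)^[min N (f N σ)] σ := by
  obtain ⟨e, he⟩ := hf
  obtain ⟨c, l, T, hl, hc⟩ := hF
  refine ⟨.seq (.setIdx (l + 1) (.sub (.reg 100) (.sub (.reg 100) e))) (forLoop l (l + 1) c),
    l + 2, Polynomial.X * (T + 2) + 3, by omega, fun N s σ h => ?_⟩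
  set B := min N (f N σ) with hB
  have hBN : B ≤ N := by omega
  -- With truncated subtraction, `N - (N - x)` is `min N x`.
  have hval : (IdxExpr.sub (.reg 100) (.sub (.reg 100) e)).eval s = B := by
    simp only [IdxExpr.eval, he N s σ h, h.dim]
    omega
  have hs₁ := Exec.setIdx s (l + 1) (.sub (.reg 100) (.sub (.reg 100) e))
  rw [hval] at hs₁
  change Exec _ _ _ (s.setReg (l + 1) B) at hs₁
  have main := exec_forLoop (c := c)
    (v := l) (b := l + 1) (T := T.eval N) (N := B)
    (fun m s' => Rep N s' ((F N)^[m] σ) ∧ s'.idx l = m ∧ s'.idx (l + 1) = B ∧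
      ∀ v, l + 2 ≤ v → s'.idx v = s.idx v)
    (fun _ _ hI => hI.2.2.1) (fun _ _ hI => hI.2.1) ?_ (s.setReg (l + 1) B) ?_
  · obtain ⟨t, s', h1, h2, h3, _, _, h6⟩ := main
    refine ⟨_, _, .seq hs₁ h1, ?_, h3, h6⟩
    simp only [Polynomial.eval_add, Polynomial.eval_mul, Polynomial.eval_X,
      Polynomial.eval_ofNat]
    have := Nat.mul_le_mul_right (T.eval N + 2) hBN
    omega
  · rintro m hm s₁ ⟨hR, rfl, hb, hfr⟩
    obtain ⟨t, s₂, g1, g2, g3, g4⟩ := hc N s₁ _ hR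
    refine ⟨t, s₂, g1, g2, ?_, ?_, ?_, fun v hv => ?_⟩
    · rw [Function.iterate_succ_apply']
      exact g3.congr (fun v hv => s₂.incr_idx_of_ne (by omega)) fun _ _ => rfl
    · rw [State.incr_idx_self, g4 l le_rfl]
    · rw [State.incr_idx_of_ne _ (by omega), g4 _ (by omega), hb]
    · rw [State.incr_idx_of_ne _ (by omega), g4 _ (by omega), hfr v hv]
  · refine ⟨h.congr (fun v hv => ?_) fun _ _ => rfl, State.setReg_idx_self _ _ _, ?_,
      fun v hv => ?_⟩
    · rw [State.setReg_idx_of_ne _ _ (by omega), State.setReg_idx_of_ne _ _ (by omega)]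
    · rw [State.setReg_idx_of_ne _ _ (by omega), State.setReg_idx_self]
    · rw [State.setReg_idx_of_ne _ _ (by omega), State.setReg_idx_of_ne _ _ (by omega)]

theorem Realizable.iterate {F : ℕ → PolyState → PolyState} (hF : Realizable F) :
    Realizable fun N σ => (F N)^[N] σ := by
  simpa using Realizable.iterate_min (f := fun N _ => N) ⟨.reg 100, fun _ _ _ h => h.dim⟩ hF

theorem Realizable.iterate_reg {v : ℕ} (hv : v < 100) {F : ℕ → PolyState → PolyState}
    (hF : Realizable F) : Realizable fun N σ => (F N)^[min N (σ.reg v)] σ :=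
  Realizable.iterate_min (f := fun _ σ => σ.reg v) ⟨.reg v, fun _ _ _ h => h.reg v hv⟩ hF

/-- Simultaneous assignment `a[i,j] := E σ i j` for all `i, j < N`, cut to degree less than `N`. -/
def PolyState.update (σ : PolyState) (N a : ℕ) (E : ℕ → ℕ → ℂ[X]) : PolyState :=
  { σ with arr := fun b i j => if b = a ∧ i < N ∧ j < N then cut N (E i j) else σ.arr b i j }

/-- A polynomial expression all of whose coefficients can be computed. -/
def PolyComp (E : PolyState → ℕ → ℕ → ℂ[X]) : Prop :=
  ExprComp fun σ i j k => (E σ i j).coeff k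

/-- `E` may read array `a` itself, for instance in a row swap. All new coefficients are therefore
first computed into the buffer array `101` and copied in a second pass. The cut to degree less than
`N` preserves `Rep` without any degree hypothesis; that nothing is lost is shown separately in each
application. -/
theorem Realizable.update {a : ℕ} (ha : a < 100) {E : PolyState → ℕ → ℕ → ℂ[X]}
    (hE : PolyComp E) :
    Realizable fun N σ => σ.update N a (E σ) := by
  obtain ⟨c, T, hc⟩ := hE 0
  let fill (T : ℕ) : ℕ[X] := Polynomial.X * (Polynomial.X * (Polynomial.X *
    ((T : ℕ[X]) + 2) + 2 + 2) + 2 + 2) + 2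
  refine ⟨.seq (fillLoop (.seq c (.move ⟨101, [.reg 101, .reg 102, .reg 103]⟩ (tmp 0))))
    (fillLoop (.move ⟨a, [.reg 101, .reg 102, .reg 103]⟩
      ⟨101, [.reg 101, .reg 102, .reg 103]⟩)), 104, fill (T + 1) + fill 1, le_rfl,
    fun N s σ h => ?_⟩
  obtain ⟨t₁, s₁, h1, h2, h3⟩ := exec_fillLoop (s₀ := s) (b := 101)
    (c := .seq c (.move ⟨101, [.reg 101, .reg 102, .reg 103]⟩ (tmp 0))) (T := T + 1)
    (g := fun i j k => (E σ i j).coeff k) h.dim (by norm_num) (by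
      intro s₁ D hf hi hj hk
      have hR : Rep N s₁ σ := h.congr (fun v hv => hf.idx v (by omega) (by omega) (by omega))
        fun x hx => hf.frame x (by omega) fun i j k _ => by rintro rfl; simp at hx
      obtain ⟨t, s₂, g1, g2, g3, g4, g5⟩ := hc N s₁ σ hR
      refine ⟨_, _, .seq g1 (.move _ _ _), by omega, g3, ?_, fun x hx hne => ?_⟩
      · simp [Cell.set, Cell.addr, Cell.get, IdxExpr.eval, g3, g4]
      · rw [← g5 x (Or.inl hx)]
        apply Function.update_of_ne
        simpa [Cell.addr, IdxExpr.eval, g3] using hne)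
  obtain ⟨t₂, s₂, g1, g2, g3⟩ := exec_fillLoop (s₀ := s₁) (b := a)
    (c := .move ⟨a, [.reg 101, .reg 102, .reg 103]⟩ ⟨101, [.reg 101, .reg 102, .reg 103]⟩)
    (T := 1) (N := N) (g := fun i j k => (E σ i j).coeff k)
    (by rw [h3.idx 100 (by norm_num) (by norm_num) (by norm_num), h.dim]) (by omega) (by
      intro s₂ D hf hi hj hk
      refine ⟨_, _, .move _ _ _, le_rfl, rfl, ?_, fun x hx hne => ?_⟩
      · have : s₂.val (101, [s₂.idx 101, s₂.idx 102, s₂.idx 103]) =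
            s₁.val (101, [s₂.idx 101, s₂.idx 102, s₂.idx 103]) :=
          hf.frame _ (by simp) fun i j k _ => by
            simp only [ne_eq, Prod.mk.injEq, not_and]
            omega
        simp only [Cell.set, Cell.addr, Cell.get, IdxExpr.eval, List.map_cons, List.map_nil,
          Function.update_self, this]
        exact h3.val _ _ _ ⟨hi, hj, hk⟩
      · apply Function.update_of_ne
        simpa [Cell.addr, IdxExpr.eval] using hne)
  have hN : 0 < N := (Nat.zero_le _).trans_lt (h.deg 0 0 0)
  have hidx : ∀ v, v ≠ 101 → v ≠ 102 → v ≠ 103 → s₂.idx v = s.idx v := fun v e1 e2 e3 => by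
    rw [g3.idx v e1 e2 e3, h3.idx v e1 e2 e3]
  refine ⟨_, _, .seq h1 g1, ?_, ⟨?_, fun v hv => ?_, fun b hb i j k hk => ?_, fun b i j => ?_⟩,
    fun v hv => hidx v (by omega) (by omega) (by omega)⟩
  · simp only [fill, Polynomial.eval_add, Polynomial.eval_mul, Polynomial.eval_X,
      Polynomial.eval_ofNat, Polynomial.eval_natCast, Nat.cast_id]
    exact Nat.add_le_add h2 g2
  · rw [hidx 100 (by omega) (by omega) (by omega), h.dim]
  · rw [hidx v (by omega) (by omega) (by omega), h.reg v hv]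
    rfl
  · simp only [PolyState.update]
    split_ifs with hcond
    · obtain ⟨rfl, hi, hj⟩ := hcond
      rw [g3.val i j k ⟨hi, hj, hk⟩, coeff_cut, if_pos hk]
    · rw [g3.frame _ (by simp; omega), h3.frame _ (by simp; omega), h.coeff b hb i j k hk]
      · intro i' j' k' _
        simp only [ne_eq, Prod.mk.injEq, not_and]
        omega
      · intro i' j' k' hd
        simp only [ne_eq, Prod.mk.injEq, List.cons.injEq, not_and]
        rintro rfl rfl rfl
        exact absurd ⟨rfl, hd.1, hd.2.1⟩ hcond
  · simp only [PolyState.update]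
    split_ifs
    · exact natDegree_cut_lt hN _
    · exact h.deg b i j

end FieldProgram

/-! ### Computable polynomial expressions. -/

namespace FieldProgram

open Polynomial

theorem TestComp.eq {f g : PolyState → ℕ → ℕ → ℕ → ℕ} (hf : IdxComp f) (hg : IdxComp g) :
    TestComp fun σ i j k => f σ i j k = g σ i j k := by
  -- Both truncated differences vanish exactly when the two numbers agree.
  have h := TestComp.lt ((hf.sub hg).add (hg.sub hf)) (IdxComp.lit 1)
  have e : (fun σ i j k => f σ i j k = g σ i j k) =
      fun σ i j k => f σ i j k - g σ i j k + (g σ i j k - f σ i j k) < 1 := by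
    funext σ i j k
    exact propext ⟨fun h => by omega, fun h => by omega⟩
  rw [e]
  exact h

theorem PolyComp.arr {a : ℕ} (ha : a < 100) {f g : PolyState → ℕ → ℕ → ℕ}
    (hf : IdxComp fun σ i j _ => f σ i j) (hg : IdxComp fun σ i j _ => g σ i j) :
    PolyComp fun σ i j => σ.arr a (f σ i j) (g σ i j) :=
  ExprComp.coeff ha hf hg .trd

theorem PolyComp.C {e : PolyState → ℕ → ℕ → ℂ} (he : ExprComp fun σ i j _ => e σ i j) :
    PolyComp fun σ i j => C (e σ i j) :=
  ExprComp.ite (.eq .trd (.lit 0)) he (ExprComp.const 0)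
    (fun _ _ _ k hk => by simp [hk]) (fun _ _ _ k hk => by simp [coeff_C, hk])

theorem PolyComp.intCast (z : ℤ) : PolyComp fun _ _ _ => (z : ℂ[X]) := by
  simpa using PolyComp.C (ExprComp.const z)

theorem PolyComp.add {E E' : PolyState → ℕ → ℕ → ℂ[X]} (h : PolyComp E) (h' : PolyComp E') :
    PolyComp fun σ i j => E σ i j + E' σ i j := by
  simpa [PolyComp] using ExprComp.add h h'

theorem PolyComp.sub {E E' : PolyState → ℕ → ℕ → ℂ[X]} (h : PolyComp E) (h' : PolyComp E') :
    PolyComp fun σ i j => E σ i j - E' σ i j := by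
  simpa [PolyComp] using ExprComp.sub h h'

theorem PolyComp.C_mul {e : PolyState → ℕ → ℕ → ℂ} (he : ExprComp fun σ i j _ => e σ i j)
    {E : PolyState → ℕ → ℕ → ℂ[X]} (h : PolyComp E) :
    PolyComp fun σ i j => Polynomial.C (e σ i j) * E σ i j := by
  simpa [PolyComp] using ExprComp.mul he h

theorem PolyComp.divX {a : ℕ} (ha : a < 100) {f g : PolyState → ℕ → ℕ → ℕ}
    (hf : IdxComp fun σ i j _ => f σ i j) (hg : IdxComp fun σ i j _ => g σ i j) :
    PolyComp fun σ i j => (σ.arr a (f σ i j) (g σ i j)).divX := by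
  simpa [PolyComp] using ExprComp.coeff ha hf hg (IdxComp.trd.add (.lit 1))

/-- The linear polynomial `α w + β`. -/
def lin (α β : ℤ) : ℂ[X] := Polynomial.C (α : ℂ) * X + Polynomial.C (β : ℂ)

/-- Coefficient `k` is `α` times the old coefficient `k - 1` plus `β` times the old coefficient `k`.
The case `k = 0` is tested because truncation makes `0 - 1 = 0`. -/
theorem PolyComp.mul_lin {a : ℕ} (ha : a < 100) {f g : PolyState → ℕ → ℕ → ℕ}
    (hf : IdxComp fun σ i j _ => f σ i j) (hg : IdxComp fun σ i j _ => g σ i j) (α β : ℤ) :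
    PolyComp fun σ i j => σ.arr a (f σ i j) (g σ i j) * lin α β := by
  have h1 := ExprComp.mul (.const α) (ExprComp.ite (.lt (.lit 0) .trd)
    (ExprComp.coeff ha hf hg (IdxComp.trd.sub (.lit 1))) (.const 0)
    (f := fun σ i j k => (X * σ.arr a (f σ i j) (g σ i j)).coeff k)
    (fun σ i j k hk => by
      obtain ⟨k, rfl⟩ := Nat.exists_eq_succ_of_ne_zero hk.ne'
      simp) (fun σ i j k hk => by
      obtain rfl : k = 0 := by omega
      simp))
  have h2 := h1.add (.mul (.const β) (ExprComp.coeff ha hf hg .trd))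
  have e : ∀ p : ℂ[X], p * lin α β =
      Polynomial.C (α : ℂ) * (X * p) + Polynomial.C (β : ℂ) * p := fun p => by
    rw [lin]
    ring
  simp only [PolyComp, e, coeff_add, coeff_C_mul]
  exact h2

theorem PolyComp.ite {p : PolyState → ℕ → ℕ → Prop} [∀ σ i j, Decidable (p σ i j)]
    (hp : TestComp fun σ i j _ => p σ i j)
    {E E' : PolyState → ℕ → ℕ → ℂ[X]} (h : PolyComp E) (h' : PolyComp E') :
    PolyComp fun σ i j => if p σ i j then E σ i j else E' σ i j :=
  ExprComp.ite hp h h' (fun _ _ _ _ hk => by simp only [if_pos hk])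
    (fun _ _ _ _ hk => by simp only [if_neg hk])

theorem ExprComp.coeff_zero {a : ℕ} (ha : a < 100) {f g : PolyState → ℕ → ℕ → ℕ → ℕ}
    (hf : IdxComp f) (hg : IdxComp g) :
    ExprComp fun σ i j k => (σ.arr a (f σ i j k) (g σ i j k)).coeff 0 :=
  ExprComp.coeff ha hf hg (.lit 0)

theorem PolyState.update_arr_of_ne (σ : PolyState) (N : ℕ) {a b : ℕ} (E : ℕ → ℕ → ℂ[X])
    (h : b ≠ a) : (σ.update N a E).arr b = σ.arr b := by
  ext1 i
  ext1 j
  simp [update, h]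

theorem PolyState.update_arr_self (σ : PolyState) {N a i j : ℕ} {E : ℕ → ℕ → ℂ[X]}
    (hi : i < N) (hj : j < N) (hE : (E i j).natDegree < N) :
    (σ.update N a E).arr a i j = E i j := by
  simp [update, hi, hj, cut_eq_self hE]

@[simp] theorem PolyState.setReg_arr (σ : PolyState) (v m : ℕ) :
    (σ.setReg v m).arr = σ.arr := rfl

@[simp] theorem PolyState.setReg_reg_self (σ : PolyState) (v m : ℕ) :
    (σ.setReg v m).reg v = m := Function.update_self _ _ _

theorem PolyState.setReg_reg_of_ne (σ : PolyState) {v u : ℕ} (m : ℕ) (h : u ≠ v) :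
    (σ.setReg v m).reg u = σ.reg u := Function.update_of_ne h _ _

/-! ### Division by a linear polynomial -/

/-- Horner's recursion `q_k = g_{k+1} + p q_{k+1}`, written as a fixed point equation for the
quotient. Iterating its right-hand side computes the quotient from the top coefficient down. -/
theorem divX_add_C_mul_divX_divByMonic (g : ℂ[X]) (p : ℂ) :
    g.divX + C p * (g /ₘ (X - C p)).divX = g /ₘ (X - C p) := by
  set q := g /ₘ (X - C p)
  have hg : g = (X - C p) * q + C (g.eval p) := by
    have := modByMonic_add_div g (X - C p)
    rw [modByMonic_X_sub_C_eq_C_eval] at this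
    rw [add_comm, this]
  ext k
  have hk := congrArg (fun f => f.coeff (k + 1)) hg
  simp only [coeff_add, sub_mul, coeff_sub, coeff_X_mul, coeff_C_mul, coeff_C_succ,
    add_zero] at hk
  simp only [coeff_add, coeff_divX, coeff_C_mul, hk]
  ring

theorem coeff_zero_add_mul_divByMonic (g : ℂ[X]) (p : ℂ) :
    g.coeff 0 + p * (g /ₘ (X - C p)).coeff 0 = g.eval p := by
  have hg : g = (X - C p) * (g /ₘ (X - C p)) + C (g.eval p) := by
    have := modByMonic_add_div g (X - C p)
    rw [modByMonic_X_sub_C_eq_C_eval] at this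
    rw [add_comm, this]
  have hk := congrArg (fun f => f.coeff 0) hg
  simp only [coeff_add, sub_mul, coeff_sub, coeff_C_zero, mul_coeff_zero,
    coeff_X_zero, zero_mul, zero_sub] at hk
  linear_combination hk

/-- Synthetic division of array `a` by `w - p`: the quotients go to array `10`. -/
def quotOp (a : ℕ) (p : ℤ) (N : ℕ) (σ : PolyState) : PolyState :=
  (fun σ : PolyState => σ.update N 10 fun i j =>
    (σ.arr a i j).divX + C (p : ℂ) * (σ.arr 10 i j).divX)^[N] (σ.update N 10 fun _ _ => 0)

/-- Division with remainder of array `a` by `w - p`: quotients in array `10`, remainders in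
array `11`. -/
def divOp (a : ℕ) (p : ℤ) (N : ℕ) (σ : PolyState) : PolyState :=
  (quotOp a p N σ).update N 11 fun i j =>
    C (((quotOp a p N σ).arr a i j).coeff 0 + (p : ℂ) * ((quotOp a p N σ).arr 10 i j).coeff 0)

theorem realizable_divOp {a : ℕ} (ha : a < 100) (p : ℤ) : Realizable (divOp a p) := by
  have e0 : PolyComp fun _ _ _ => 0 := by simpa using PolyComp.intCast 0
  have e1 : PolyComp fun σ i j => (σ.arr a i j).divX + C (p : ℂ) * (σ.arr 10 i j).divX :=
    PolyComp.add (.divX ha .fst .snd) (.C_mul (.const p) (.divX (by norm_num) .fst .snd))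
  have h1 : Realizable (quotOp a p) :=
    (Realizable.update (by norm_num) e0).comp (Realizable.iterate (.update (by norm_num) e1))
  have e2 : PolyComp fun σ i j => C ((σ.arr a i j).coeff 0 + (p : ℂ) * (σ.arr 10 i j).coeff 0) :=
    PolyComp.C (.add (.coeff_zero ha .fst .snd)
      (.mul (.const p) (.coeff_zero (by norm_num) .fst .snd)))
  exact h1.comp (Realizable.update (a := 11) (by norm_num) e2)

structure DivSpec (a : ℕ) (p : ℤ) (N : ℕ) (σ σ' : PolyState) : Prop where
  reg : σ'.reg = σ.reg
  arr : ∀ b, b ≠ 10 → b ≠ 11 → σ'.arr b = σ.arr b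
  quot : ∀ i j, i < N → j < N → (σ.arr a i j).natDegree < N →
    σ'.arr 10 i j = σ.arr a i j /ₘ (X - C (p : ℂ))
  rem : ∀ i j, i < N → j < N → (σ.arr a i j).natDegree < N →
    σ'.arr 11 i j = C ((σ.arr a i j).eval (p : ℂ))

theorem natDegree_divByMonic_X_sub_C_le (g : ℂ[X]) (p : ℂ) :
    (g /ₘ (X - C p)).natDegree ≤ g.natDegree - 1 := by
  rw [natDegree_divByMonic _ (monic_X_sub_C p), natDegree_X_sub_C]

theorem divOp_spec {a : ℕ} (ha : a ≠ 10) (p : ℤ) {N : ℕ} (σ : PolyState) :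
    DivSpec a p N σ (divOp a p N σ) := by
  set F : PolyState → PolyState := fun σ => σ.update N 10 fun i j =>
    (σ.arr a i j).divX + C (p : ℂ) * (σ.arr 10 i j).divX with hF
  set σ₀ := σ.update N 10 fun _ _ => 0 with hσ₀
  have hfr : ∀ m, (F^[m] σ₀).reg = σ.reg ∧ ∀ b ≠ 10, (F^[m] σ₀).arr b = σ.arr b := by
    intro m
    induction m with
    | zero => exact ⟨rfl, fun b hb => σ.update_arr_of_ne _ _ hb⟩
    | succ m ih =>
      rw [Function.iterate_succ_apply']
      exact ⟨ih.1, fun b hb => (PolyState.update_arr_of_ne _ _ _ hb).trans (ih.2 b hb)⟩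
  have hq : ∀ i j, i < N → j < N → (σ.arr a i j).natDegree < N →
      (F^[N] σ₀).arr 10 i j = σ.arr a i j /ₘ (X - C (p : ℂ)) := by
    intro i j hi hj hd
    set g := σ.arr a i j
    set q := g /ₘ (X - C (p : ℂ)) with hqdef
    have hqd : q.natDegree < N := (natDegree_divByMonic_X_sub_C_le g p).trans_lt (by omega)
    -- After `m` rounds the top `m` of the `N` coefficients are final, since coefficient `k` only
    -- needs coefficient `k + 1`.
    have key : ∀ m, (((F^[m] σ₀).arr 10 i j).natDegree < N) ∧
        ∀ k, N ≤ k + m → ((F^[m] σ₀).arr 10 i j).coeff k = q.coeff k := by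
      intro m
      induction m with
      | zero =>
        have : (F^[0] σ₀).arr 10 i j = 0 :=
          PolyState.update_arr_self _ hi hj (by simp; omega)
        rw [this]
        refine ⟨by simp; omega, fun k hk => ?_⟩
        rw [coeff_zero, coeff_eq_zero_of_natDegree_lt (by omega)]
      | succ m ih =>
        set x := (F^[m] σ₀).arr 10 i j
        have hdeg : (g.divX + C (p : ℂ) * x.divX).natDegree < N := by
          have h1 := natDegree_divX_eq_natDegree_tsub_one (p := g)
          have h2 := natDegree_divX_eq_natDegree_tsub_one (p := x)
          have h3 := natDegree_C_mul_le (p : ℂ) x.divX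
          have h4 := natDegree_add_le g.divX (C (p : ℂ) * x.divX)
          omega
        have : (F^[m + 1] σ₀).arr 10 i j = g.divX + C (p : ℂ) * x.divX := by
          rw [Function.iterate_succ_apply', hF]
          have hg : (F^[m] σ₀).arr a i j = g := by rw [(hfr m).2 a ha]
          refine (PolyState.update_arr_self _ hi hj ?_).trans ?_
          · rw [hg]
            exact hdeg
          · rw [hg]
        rw [this]
        refine ⟨hdeg, fun k hk => ?_⟩
        have hfix := divX_add_C_mul_divX_divByMonic g p
        rw [← hqdef] at hfix
        rw [← hfix]
        simp only [coeff_add, coeff_divX, coeff_C_mul, ih.2 (k + 1) (by omega)]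
    ext k
    exact (key N).2 k (by omega)
  have hquot : quotOp a p N σ = F^[N] σ₀ := rfl
  refine ⟨(hfr N).1, fun b h1 h2 => (PolyState.update_arr_of_ne _ _ _ h2).trans ((hfr N).2 b h1),
    fun i j hi hj hd => ?_, fun i j hi hj hd => ?_⟩
  · rw [divOp, PolyState.update_arr_of_ne _ _ _ (by norm_num)]
    exact hq i j hi hj hd
  · rw [divOp, PolyState.update_arr_self _ hi hj (by rw [natDegree_C]; omega), hquot, hq i j hi hj hd,
      (hfr N).2 a ha, coeff_zero_add_mul_divByMonic]

end FieldProgram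

namespace FieldProgram

open Polynomial

/-! ### Clearing denominators -/

theorem lin_one_neg (p : ℤ) : lin 1 (-p) = X - C (p : ℂ) := by
  simp [lin, sub_eq_add_neg]

/-- Array `0` holds numerators and array `1` denominators; the fractions are multiplied by `w - p`,
cancelling where possible. -/
def clearOp (p : ℤ) (N : ℕ) (σ : PolyState) : PolyState :=
  ((divOp 1 p N σ).update N 0 fun i j =>
    if ((divOp 1 p N σ).arr 11 i j).coeff 0 = 0 then (divOp 1 p N σ).arr 0 i j
    else (divOp 1 p N σ).arr 0 i j * lin 1 (-p)).update N 1 fun i j =>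
    if ((divOp 1 p N σ).arr 11 i j).coeff 0 = 0 then (divOp 1 p N σ).arr 10 i j
    else (divOp 1 p N σ).arr 1 i j

/-- The effect of `clearOp` on a single numerator and denominator. -/
def clearStep (p : ℤ) (x : ℂ[X] × ℂ[X]) : ℂ[X] × ℂ[X] :=
  if x.2.eval (p : ℂ) = 0 then (x.1, x.2 /ₘ (X - C (p : ℂ))) else (x.1 * (X - C (p : ℂ)), x.2)

theorem realizable_clearOp (p : ℤ) : Realizable (clearOp p) := by
  have t : TestComp fun σ i j _ => (σ.arr 11 i j).coeff 0 = 0 :=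
    .coeff_zero_eq_zero (by norm_num) .fst .snd
  have e1 : PolyComp fun σ i j => if (σ.arr 11 i j).coeff 0 = 0 then σ.arr 0 i j
      else σ.arr 0 i j * lin 1 (-p) :=
    .ite t (.arr (by norm_num) .fst .snd) (.mul_lin (by norm_num) .fst .snd _ _)
  have e2 : PolyComp fun σ i j => if (σ.arr 11 i j).coeff 0 = 0 then σ.arr 10 i j
      else σ.arr 1 i j :=
    .ite t (.arr (by norm_num) .fst .snd) (.arr (by norm_num) .fst .snd)
  exact ((realizable_divOp (a := 1) (by norm_num) p).comp
    (Realizable.update (a := 0) (by norm_num) e1)).comp (Realizable.update (a := 1) (by norm_num) e2)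

theorem clearOp_spec (p : ℤ) {N : ℕ} (σ : PolyState) :
    (clearOp p N σ).reg = σ.reg ∧ ∀ i j, i < N → j < N → (σ.arr 0 i j).natDegree + 1 < N →
      (σ.arr 1 i j).natDegree < N →
      ((clearOp p N σ).arr 0 i j, (clearOp p N σ).arr 1 i j) =
        clearStep p (σ.arr 0 i j, σ.arr 1 i j) := by
  have h := divOp_spec (a := 1) (by norm_num) p (N := N) σ
  refine ⟨h.reg, fun i j hi hj h0 h1 => ?_⟩
  have hrem : ((divOp 1 p N σ).arr 11 i j).coeff 0 = (σ.arr 1 i j).eval (p : ℂ) := by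
    rw [h.rem i j hi hj h1, coeff_C_zero]
  have hm : (σ.arr 0 i j * (X - C (p : ℂ))).natDegree < N :=
    (natDegree_mul_le.trans (by rw [natDegree_X_sub_C])).trans_lt h0
  have hq := natDegree_divByMonic_X_sub_C_le (σ.arr 1 i j) (p : ℂ)
  rw [clearOp, PolyState.update_arr_of_ne _ _ _ (by norm_num), clearStep]
  by_cases he : (σ.arr 1 i j).eval (p : ℂ) = 0
  · rw [PolyState.update_arr_self _ hi hj, PolyState.update_arr_self _ hi hj] <;>
      simp only [hrem, he, if_true, h.quot i j hi hj h1, h.arr 0 (by norm_num) (by norm_num)] <;>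
      omega
  · rw [PolyState.update_arr_self _ hi hj, PolyState.update_arr_self _ hi hj] <;>
      simp only [hrem, he, if_false, h.arr 0 (by norm_num) (by norm_num),
        h.arr 1 (by norm_num) (by norm_num), lin_one_neg] <;> omega

def clearRound (N : ℕ) (σ : PolyState) : PolyState :=
  clearOp 2 N (clearOp 1 N (clearOp 0 N σ))

def clearAll (N : ℕ) (σ : PolyState) : PolyState :=
  (clearRound N)^[min N (σ.reg 1)] σ

theorem realizable_clearAll : Realizable clearAll :=
  Realizable.iterate_reg (by norm_num)
    (((realizable_clearOp 0).comp (realizable_clearOp 1)).comp (realizable_clearOp 2))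

/-! ### Column reduction at a point

Register `0` holds the size `n`, register `1` the exponent `d`, register `4` the number `r` of
columns already reduced, register `5` the bound `K`. Array `12` is reduced, array `13` records the
column operations, array `14` is the common denominator. -/

def mulOp (a : ℕ) (α β : ℤ) (N : ℕ) (σ : PolyState) : PolyState :=
  σ.update N a fun i j => σ.arr a i j * lin α β

theorem realizable_mulOp {a : ℕ} (ha : a < 100) (α β : ℤ) : Realizable (mulOp a α β) :=
  Realizable.update ha (PolyComp.mul_lin ha .fst .snd α β)

def initOne (N : ℕ) (σ : PolyState) : PolyState :=
  ((σ.update N 13 fun i j => if i = j then 1 else 0).update N 14 fun _ _ => 1).setReg 4 0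

theorem realizable_initOne : Realizable initOne := by
  have e0 : PolyComp fun _ _ _ => 0 := by simpa using PolyComp.intCast 0
  have e1 : PolyComp fun _ _ _ => 1 := by simpa using PolyComp.intCast 1
  have t : TestComp fun _ i j _ => i = j := .eq .fst .snd
  have e2 : PolyComp fun _ i j => if i = j then 1 else 0 := .ite t e1 e0
  exact ((Realizable.update (by norm_num) e2).comp (Realizable.update (by norm_num) e1)).comp
    (Realizable.setReg (by norm_num) (.lit 0))

def mulPair (a α β : ℤ) (N : ℕ) (σ : PolyState) : PolyState :=
  mulOp 14 α β N (mulOp 13 1 (-a) N σ)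

theorem realizable_mulPair (a α β : ℤ) : Realizable (mulPair a α β) :=
  (realizable_mulOp (by norm_num) _ _).comp (realizable_mulOp (by norm_num) _ _)

/-- With `d` in register `1` and `K` in register `5`, array `13` becomes `(w - a)^(d + K)` times the
identity, enough to keep all later column operations polynomial. Every entry of array `14` becomes
the final denominator `(α w + β)^d (w - a)^K`. -/
def initAll (a α β : ℤ) (N : ℕ) (σ : PolyState) : PolyState :=
  (fun σ : PolyState => (mulPair a 1 (-a) N)^[min N (σ.reg 5)] σ)
    ((fun σ : PolyState => (mulPair a α β N)^[min N (σ.reg 1)] σ) (initOne N σ))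

theorem realizable_initAll (a α β : ℤ) : Realizable (initAll a α β) :=
  (realizable_initOne.comp (.iterate_reg (by norm_num) (realizable_mulPair a α β))).comp
    (.iterate_reg (by norm_num) (realizable_mulPair a 1 (-a)))

/-- The entry in row `i` and column `r` of the constant matrix in array `11`. -/
def PolyState.pivotCol (σ : PolyState) (i : ℕ) : ℂ := (σ.arr 11 i (σ.reg 4)).coeff 0

/-- Register `6` is the row being scanned, register `7` the last admissible row found. -/
def searchStep (_N : ℕ) (σ : PolyState) : PolyState :=
  (fun σ : PolyState => σ.setReg 6 (σ.reg 6 + 1))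
    (if σ.reg 6 < σ.reg 4 then σ else if σ.pivotCol (σ.reg 6) = 0 then σ
      else σ.setReg 7 (σ.reg 6))

/-- Register `7` receives the index of a pivot row, if there is one. -/
def searchOp (N : ℕ) (σ : PolyState) : PolyState :=
  (fun σ : PolyState => (searchStep N)^[min N (σ.reg 0)] σ) ((σ.setReg 7 (σ.reg 4)).setReg 6 0)

theorem testComp_pivotCol {v : ℕ} (hv : v < 100) :
    TestComp fun σ _ _ _ => σ.pivotCol (σ.reg v) = 0 :=
  .coeff_zero_eq_zero (by norm_num) (.reg hv) (.reg (by norm_num))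

theorem exprComp_pivotCol_reg {v : ℕ} (hv : v < 100) :
    ExprComp fun σ _ _ _ => σ.pivotCol (σ.reg v) :=
  .coeff_zero (by norm_num) (.reg hv) (.reg (by norm_num))

theorem exprComp_pivotCol : ExprComp fun σ i _ _ => σ.pivotCol i :=
  .coeff_zero (by norm_num) .fst (.reg (by norm_num))

theorem realizable_searchOp : Realizable searchOp := by
  have r (v : ℕ) (hv : v < 100 := by norm_num) : IdxComp fun σ _ _ _ => σ.reg v := .reg hv
  have t1 : TestComp fun σ _ _ _ => σ.reg 6 < σ.reg 4 := .lt (r 6) (r 4)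
  have t2 : TestComp fun σ _ _ _ => σ.pivotCol (σ.reg 6) = 0 := testComp_pivotCol (by norm_num)
  have h0 : Realizable fun _ σ => σ.setReg 7 (σ.reg 6) := .setReg (by norm_num) (r 6)
  have h1 : Realizable searchStep := (Realizable.ite t1 .id (.ite t2 .id h0)).comp
    (.setReg (v := 6) (by norm_num) ((r 6).add (.lit 1)))
  exact ((Realizable.setReg (v := 7) (by norm_num) (r 4)).comp
    (Realizable.setReg (v := 6) (by norm_num) (.lit 0))).comp (.iterate_reg (by norm_num) h1)

def swapOp (a : ℕ) (N : ℕ) (σ : PolyState) : PolyState :=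
  σ.update N a fun i j => if i = σ.reg 4 then σ.arr a (σ.reg 7) j
    else if i = σ.reg 7 then σ.arr a (σ.reg 4) j else σ.arr a i j

def elimOp (N : ℕ) (σ : PolyState) : PolyState :=
  σ.update N 12 fun i j => if i = σ.reg 4 then C (1 / σ.pivotCol (σ.reg 4)) * σ.arr 12 (σ.reg 4) j
    else σ.arr 12 i j - C (σ.pivotCol i / σ.pivotCol (σ.reg 4)) * σ.arr 12 (σ.reg 4) j

/-- Array `11`, the matrix evaluated at the point, is swapped along with array `12` because `elimOp`
takes its multipliers from it. -/
def rowOp (N : ℕ) (σ : PolyState) : PolyState :=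
  (fun σ : PolyState => σ.setReg 4 (σ.reg 4 + 1)) (elimOp N (swapOp 11 N (swapOp 12 N σ)))

theorem realizable_swapOp {a : ℕ} (ha : a < 100) : Realizable (swapOp a) := by
  have r (v : ℕ) (hv : v < 100 := by norm_num) : IdxComp fun σ _ _ _ => σ.reg v := .reg hv
  have t4 : TestComp fun σ i _ _ => i = σ.reg 4 := .eq .fst (r 4)
  have t7 : TestComp fun σ i _ _ => i = σ.reg 7 := .eq .fst (r 7)
  have e : PolyComp fun σ i j => if i = σ.reg 4 then σ.arr a (σ.reg 7) j
    else if i = σ.reg 7 then σ.arr a (σ.reg 4) j else σ.arr a i j :=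
    PolyComp.ite t4 (PolyComp.arr ha (r 7) .snd)
      (PolyComp.ite t7 (PolyComp.arr ha (r 4) .snd) (PolyComp.arr ha .fst .snd))
  exact .update ha e

theorem realizable_elimOp : Realizable elimOp := by
  have r4 : IdxComp fun σ _ _ _ => σ.reg 4 := .reg (by norm_num)
  have t4 : TestComp fun σ i _ _ => i = σ.reg 4 := .eq .fst r4
  have hone : ExprComp fun _ _ _ _ => 1 := by simpa using ExprComp.const 1
  have h4 : ExprComp fun σ _ _ _ => σ.pivotCol (σ.reg 4) := exprComp_pivotCol_reg (by norm_num)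
  have e4 : PolyComp fun σ _ j => σ.arr 12 (σ.reg 4) j := .arr (by norm_num) r4 .snd
  have e1 : PolyComp fun σ _ j => C (1 / σ.pivotCol (σ.reg 4)) * σ.arr 12 (σ.reg 4) j := by
    have d : ExprComp fun σ _ _ _ => 1 / σ.pivotCol (σ.reg 4) := ExprComp.div hone h4
    exact .C_mul d e4
  have e2 : PolyComp fun σ i j => C (σ.pivotCol i / σ.pivotCol (σ.reg 4)) *
      σ.arr 12 (σ.reg 4) j := by
    have d : ExprComp fun σ i _ _ => σ.pivotCol i / σ.pivotCol (σ.reg 4) :=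
      ExprComp.div exprComp_pivotCol h4
    exact .C_mul d e4
  have e3 : PolyComp fun σ i j => σ.arr 12 i j := .arr (by norm_num) .fst .snd
  have e : PolyComp fun σ i j => if i = σ.reg 4 then
      C (1 / σ.pivotCol (σ.reg 4)) * σ.arr 12 (σ.reg 4) j
    else σ.arr 12 i j - C (σ.pivotCol i / σ.pivotCol (σ.reg 4)) * σ.arr 12 (σ.reg 4) j :=
    PolyComp.ite t4 e1 (PolyComp.sub e3 e2)
  exact Realizable.update (a := 12) (by norm_num) e

theorem realizable_rowOp : Realizable rowOp := by
  have hinc : Realizable fun _ σ => σ.setReg 4 (σ.reg 4 + 1) :=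
    .setReg (by norm_num) ((IdxComp.reg (by norm_num)).add (.lit 1))
  exact (((realizable_swapOp (a := 12) (by norm_num)).comp
    (realizable_swapOp (a := 11) (by norm_num))).comp realizable_elimOp).comp hinc

def subColOp (a : ℕ) (N : ℕ) (σ : PolyState) : PolyState :=
  σ.update N a fun i j => if j = σ.reg 4 then
    σ.arr a i j - C (σ.pivotCol (σ.reg 6)) * σ.arr a i (σ.reg 6) else σ.arr a i j

def subColStep (N : ℕ) (σ : PolyState) : PolyState :=
  (fun σ : PolyState => σ.setReg 6 (σ.reg 6 + 1)) (subColOp 13 N (subColOp 12 N σ))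

def mulColOp (a : ℕ) (α β : ℤ) (N : ℕ) (σ : PolyState) : PolyState :=
  σ.update N a fun i j => if j = σ.reg 4 then σ.arr a i j * lin α β else σ.arr a i j

def divColOp (a : ℕ) (p : ℤ) (N : ℕ) (σ : PolyState) : PolyState :=
  (fun σ : PolyState => σ.update N a fun i j => if j = σ.reg 4 then σ.arr 10 i j else σ.arr a i j)
    (divOp a p N σ)

/-- Array `a`: column `r` is multiplied by `(α w + β) / (w - p)`. -/
def scaleColOp (a : ℕ) (p α β : ℤ) (N : ℕ) (σ : PolyState) : PolyState :=
  divColOp a p N (mulColOp a α β N σ)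

/-- The earlier columns are unit vectors at `p`, so the entries of the evaluated column `r` are
themselves the coefficients of the combination to subtract. The same operations are applied to
arrays `12` and `13`. -/
def colOp (p α β : ℤ) (N : ℕ) (σ : PolyState) : PolyState :=
  scaleColOp 13 p α β N (scaleColOp 12 p α β N
    ((fun σ : PolyState => (subColStep N)^[min N (σ.reg 4)] σ) (σ.setReg 6 0)))

theorem realizable_colOp (p α β : ℤ) : Realizable (colOp p α β) := by
  have r (v : ℕ) (hv : v < 100 := by norm_num) : IdxComp fun σ _ _ _ => σ.reg v := .reg hv
  have t4 : TestComp fun σ _ j _ => j = σ.reg 4 := .eq .snd (r 4)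
  have h1 (a : ℕ) (ha : a < 100) : Realizable (subColOp a) := .update ha
    (PolyComp.ite t4 (PolyComp.sub (.arr ha .fst .snd)
      (.C_mul (exprComp_pivotCol_reg (by norm_num)) (.arr ha .fst (r 6)))) (.arr ha .fst .snd))
  have h2 : Realizable subColStep := ((h1 12 (by norm_num)).comp (h1 13 (by norm_num))).comp
    (.setReg (v := 6) (by norm_num) ((r 6).add (.lit 1)))
  have h3 (a : ℕ) (ha : a < 100) : Realizable (mulColOp a α β) := .update ha
    (PolyComp.ite t4 (PolyComp.mul_lin ha .fst .snd α β) (PolyComp.arr ha .fst .snd))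
  have h4 (a : ℕ) (ha : a < 100) : Realizable (divColOp a p) :=
    (realizable_divOp ha p).comp (Realizable.update ha
      (PolyComp.ite t4 (PolyComp.arr (by norm_num) .fst .snd) (PolyComp.arr ha .fst .snd)))
  have h5 (a : ℕ) (ha : a < 100) : Realizable (scaleColOp a p α β) := (h3 a ha).comp (h4 a ha)
  exact (((Realizable.setReg (v := 6) (by norm_num) (.lit 0)).comp
    (.iterate_reg (by norm_num) h2)).comp (h5 12 (by norm_num))).comp (h5 13 (by norm_num))

def pivotOp (p α β : ℤ) (N : ℕ) (σ : PolyState) : PolyState :=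
  (fun σ : PolyState => if σ.pivotCol (σ.reg 7) = 0 then colOp p α β N σ else rowOp N σ)
    (searchOp N (divOp 12 p N σ))

def reduceStep (p α β : ℤ) (N : ℕ) (σ : PolyState) : PolyState :=
  if σ.reg 4 < σ.reg 0 then pivotOp p α β N σ else σ

/-- Always `N` rounds; once all columns are reduced, the surplus rounds do nothing. -/
def reduceAll (p α β : ℤ) (N : ℕ) (σ : PolyState) : PolyState :=
  (reduceStep p α β N)^[N] (initAll p α β N σ)

theorem realizable_reduceAll (p α β : ℤ) : Realizable (reduceAll p α β) := by
  have r (v : ℕ) (hv : v < 100 := by norm_num) : IdxComp fun σ _ _ _ => σ.reg v := .reg hv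
  have t7 : TestComp fun σ _ _ _ => σ.pivotCol (σ.reg 7) = 0 := testComp_pivotCol (by norm_num)
  have t4 : TestComp fun σ _ _ _ => σ.reg 4 < σ.reg 0 := .lt (r 4) (r 0)
  have h1 : Realizable (pivotOp p α β) :=
    ((realizable_divOp (a := 12) (by norm_num) p).comp realizable_searchOp).comp
      (.ite t7 (realizable_colOp p α β) realizable_rowOp)
  have h2 : Realizable (reduceStep p α β) := .ite t4 h1 .id
  exact (realizable_initAll p α β).comp (.iterate h2)

def copyOp (a b : ℕ) (N : ℕ) (σ : PolyState) : PolyState :=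
  σ.update N a fun i j => σ.arr b i j

def transposeOp (a b : ℕ) (N : ℕ) (σ : PolyState) : PolyState :=
  σ.update N a fun i j => σ.arr b j i

theorem realizable_copyOp {a b : ℕ} (ha : a < 100) (hb : b < 100) : Realizable (copyOp a b) :=
  .update ha (PolyComp.arr hb .fst .snd)

theorem realizable_transposeOp {a b : ℕ} (ha : a < 100) (hb : b < 100) :
    Realizable (transposeOp a b) := .update ha (PolyComp.arr hb .snd .fst)

/-- The right multiplier comes from the reduction of the matrix at `2` with factor `w/(w-2)`, the
left one from that of its transpose at `1` with factor `1/(w-1)`. Array `0` keeps the cleared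
numerators for the second reduction. -/
def mainOp (N : ℕ) (σ : PolyState) : PolyState :=
  transposeOp 5 14 N (transposeOp 4 13 N (reduceAll 1 0 1 N (transposeOp 12 0 N
    (copyOp 3 14 N (copyOp 2 13 N (reduceAll 2 1 0 N (copyOp 12 0 N (clearAll N σ))))))))

theorem realizable_mainOp : Realizable mainOp := by
  have c (a b : ℕ) (ha : a < 100 := by norm_num) (hb : b < 100 := by norm_num) :=
    realizable_copyOp ha hb
  have t (a b : ℕ) (ha : a < 100 := by norm_num) (hb : b < 100 := by norm_num) :=
    realizable_transposeOp ha hb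
  exact (((((((realizable_clearAll.comp (c 12 0)).comp (realizable_reduceAll 2 1 0)).comp
    (c 2 13)).comp (c 3 14)).comp (t 12 0)).comp (realizable_reduceAll 1 0 1)).comp
    (t 4 13)).comp (t 5 14)

end FieldProgram

namespace FieldProgram

open Polynomial

/-! ### The effect of clearing denominators -/

/-- `w (w - 1) (w - 2)` -/
def poleProd : ℂ[X] := (X - C ((0 : ℤ) : ℂ)) * (X - C ((1 : ℤ) : ℂ)) * (X - C ((2 : ℤ) : ℂ))

/-- As fractions, `y = x f`; the numerator degree grows by at most `k`, and divisibility of the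
denominators ensures that no new poles appear. -/
structure ClearSpec (x y : ℂ[X] × ℂ[X]) (f : ℂ[X]) (k : ℕ) : Prop where
  monic : y.2.Monic
  dvd : y.2 ∣ x.2
  cross : y.1 * x.2 = x.1 * f * y.2
  deg : y.1.natDegree ≤ x.1.natDegree + k

theorem ClearSpec.trans {x y z : ℂ[X] × ℂ[X]} {f g : ℂ[X]} {k l : ℕ} (h : ClearSpec x y f k)
    (h' : ClearSpec y z g l) : ClearSpec x z (f * g) (k + l) where
  monic := h'.monic
  dvd := h'.dvd.trans h.dvd
  cross := by
    have h1 := h.cross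
    have h2 := h'.cross
    apply mul_right_cancel₀ h.monic.ne_zero
    linear_combination x.2 * h2 + g * z.2 * h1
  deg := by
    have := h.deg
    have := h'.deg
    omega

theorem clearStep_spec (p : ℤ) {x : ℂ[X] × ℂ[X]} (hx : x.2.Monic) :
    ClearSpec x (clearStep p x) (X - C (p : ℂ)) 1 := by
  unfold clearStep
  split_ifs with h
  · have hd := mul_divByMonic_eq_iff_isRoot.2 (show x.2.IsRoot (p : ℂ) from h)
    refine ⟨(monic_X_sub_C (p : ℂ)).of_mul_monic_left (by rw [hd]; exact hx),
      ⟨X - C (p : ℂ), by rw [mul_comm]; exact hd.symm⟩, ?_, by simp⟩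
    change x.1 * x.2 = x.1 * (X - C (p : ℂ)) * (x.2 /ₘ (X - C (p : ℂ)))
    rw [mul_assoc, hd]
  · exact ⟨hx, dvd_rfl, rfl, natDegree_mul_le.trans (by rw [natDegree_X_sub_C])⟩

theorem clearStep_natDegree_lt (p : ℤ) {x : ℂ[X] × ℂ[X]} (hx : x.2.Monic)
    (h : x.2.eval (p : ℂ) = 0) : (clearStep p x).2.natDegree < x.2.natDegree := by
  have h0 : 0 < x.2.natDegree := by
    by_contra hc
    rw [hx.natDegree_eq_zero.1 (by omega)] at h
    simp at h
  rw [clearStep, if_pos h]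
  exact (natDegree_divByMonic_X_sub_C_le _ _).trans_lt (by omega)

def clearRoundStep (x : ℂ[X] × ℂ[X]) : ℂ[X] × ℂ[X] := clearStep 2 (clearStep 1 (clearStep 0 x))

theorem clearRoundStep_spec {x : ℂ[X] × ℂ[X]} (hx : x.2.Monic) :
    ClearSpec x (clearRoundStep x) poleProd 3 :=
  have h0 := clearStep_spec 0 hx
  have h1 := clearStep_spec 1 h0.monic
  have h2 := clearStep_spec 2 h1.monic
  (h0.trans h1).trans h2

theorem ClearSpec.natDegree_le {x y : ℂ[X] × ℂ[X]} {f : ℂ[X]} {k : ℕ} (h : ClearSpec x y f k)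
    (hx : x.2.Monic) : y.2.natDegree ≤ x.2.natDegree := natDegree_le_of_dvd h.dvd hx.ne_zero

/-- A nonconstant denominator has a complex root, which must be `0`, `1` or `2`; one of the three
steps of the round then divides out a linear factor. -/
theorem clearRoundStep_natDegree {x : ℂ[X] × ℂ[X]} (hx : x.2.Monic) {m : ℕ}
    (hm : x.2 ∣ poleProd ^ m) :
    (clearRoundStep x).2.natDegree ≤ x.2.natDegree - 1 := by
  have h0 := clearStep_spec 0 hx
  have h1 := clearStep_spec 1 h0.monic
  have h2 := clearStep_spec 2 h1.monic
  have d0 := h0.natDegree_le hx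
  have d1 := h1.natDegree_le h0.monic
  have d2 := h2.natDegree_le h1.monic
  change (clearStep 2 (clearStep 1 (clearStep 0 x))).2.natDegree ≤ _
  by_cases hz : x.2.natDegree = 0
  · omega
  obtain ⟨z, hz⟩ := Complex.exists_root (f := x.2) (by
    rw [degree_eq_natDegree hx.ne_zero]
    exact_mod_cast Nat.pos_of_ne_zero hz)
  have hr : (poleProd ^ m).eval z = 0 := by
    obtain ⟨q, hq⟩ := hm
    rw [hq, eval_mul, hz.eq_zero, zero_mul]
  have hr' : poleProd.eval z = 0 := by
    rw [eval_pow] at hr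
    exact eq_zero_of_pow_eq_zero hr
  simp only [poleProd, eval_mul, eval_sub, eval_X, eval_C, mul_eq_zero, sub_eq_zero] at hr'
  have key : ∀ (p : ℤ) (y : ℂ[X] × ℂ[X]), y.2.eval (p : ℂ) ≠ 0 → (clearStep p y).2 = y.2 :=
    fun p y hy => by rw [clearStep, if_neg hy]
  by_cases e0 : x.2.eval ((0 : ℤ) : ℂ) = 0
  · have := clearStep_natDegree_lt 0 hx e0
    omega
  by_cases e1 : x.2.eval ((1 : ℤ) : ℂ) = 0
  · have := clearStep_natDegree_lt 1 h0.monic (by rw [key 0 x e0]; exact e1)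
    omega
  by_cases e2 : x.2.eval ((2 : ℤ) : ℂ) = 0
  · have := clearStep_natDegree_lt 2 h1.monic
      (by rw [key 1 _ (by rw [key 0 x e0]; exact e1), key 0 x e0]; exact e2)
    omega
  rcases hr' with (rfl | rfl) | rfl
  · exact absurd hz e0
  · exact absurd hz e1
  · exact absurd hz e2

theorem iterate_clearRoundStep {x : ℂ[X] × ℂ[X]} (hx : x.2.Monic) {m : ℕ}
    (hm : x.2 ∣ poleProd ^ m) (t : ℕ) :
    ClearSpec x (clearRoundStep^[t] x) (poleProd ^ t) (3 * t) ∧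
      (clearRoundStep^[t] x).2.natDegree ≤ x.2.natDegree - t := by
  induction t with
  | zero => exact ⟨⟨hx, dvd_rfl, by simp, by simp⟩, by simp⟩
  | succ t ih =>
    rw [Function.iterate_succ_apply', pow_succ, mul_add]
    refine ⟨ih.1.trans (clearRoundStep_spec ih.1.monic), ?_⟩
    have := clearRoundStep_natDegree ih.1.monic (ih.1.dvd.trans hm)
    omega

theorem clearRound_spec {N : ℕ} (σ : PolyState) :
    (clearRound N σ).reg = σ.reg ∧ ∀ i j, i < N → j < N → (σ.arr 0 i j).natDegree + 3 < N →
      (σ.arr 1 i j).natDegree < N → (σ.arr 1 i j).Monic →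
      ((clearRound N σ).arr 0 i j, (clearRound N σ).arr 1 i j) =
        clearRoundStep (σ.arr 0 i j, σ.arr 1 i j) := by
  have h0 := clearOp_spec 0 (N := N) σ
  have h1 := clearOp_spec 1 (N := N) (clearOp 0 N σ)
  have h2 := clearOp_spec 2 (N := N) (clearOp 1 N (clearOp 0 N σ))
  refine ⟨by rw [clearRound, h2.1, h1.1, h0.1], fun i j hi hj hd0 hd1 hm => ?_⟩
  have e0 := h0.2 i j hi hj (by omega) hd1
  have s0 := clearStep_spec 0 (x := (σ.arr 0 i j, σ.arr 1 i j)) hm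
  have l0 := s0.natDegree_le hm
  rw [← e0] at s0 l0
  have b0 := s0.deg
  simp only at b0 l0
  have e1 := h1.2 i j hi hj (by omega) (by omega)
  have s1 := clearStep_spec 1 s0.monic
  have l1 := s1.natDegree_le s0.monic
  rw [← e1] at s1 l1
  have b1 := s1.deg
  simp only at b1 l1
  have e2 := h2.2 i j hi hj (by omega) (by omega)
  rw [clearRound, clearRoundStep, e2, e1, e0]

theorem clearAll_spec {N d m : ℕ} (σ : PolyState) (hd : σ.reg 1 = d) (hN : 4 * d < N) :
    (clearAll N σ).reg = σ.reg ∧ ∀ i j, i < N → j < N → (σ.arr 0 i j).natDegree ≤ d →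
      (σ.arr 1 i j).natDegree ≤ d → (σ.arr 1 i j).Monic → σ.arr 1 i j ∣ poleProd ^ m →
      (clearAll N σ).arr 0 i j * σ.arr 1 i j = σ.arr 0 i j * poleProd ^ d ∧
        ((clearAll N σ).arr 0 i j).natDegree ≤ 4 * d := by
  have hreg : ∀ t, ((clearRound N)^[t] σ).reg = σ.reg := by
    intro t
    induction t with
    | zero => rfl
    | succ t ih => rw [Function.iterate_succ_apply', (clearRound_spec _).1, ih]
  rw [clearAll, hd, min_eq_right (by omega)]
  refine ⟨hreg d, fun i j hi hj h0 h1 hm hdvd => ?_⟩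
  set x := (σ.arr 0 i j, σ.arr 1 i j) with hx
  have key : ∀ t ≤ d, (((clearRound N)^[t] σ).arr 0 i j, ((clearRound N)^[t] σ).arr 1 i j) =
      clearRoundStep^[t] x := by
    intro t
    induction t with
    | zero => exact fun _ => rfl
    | succ t ih =>
      intro ht
      have ih := ih (by omega)
      have hs := (iterate_clearRoundStep (x := x) hm hdvd t).1
      have hl := hs.natDegree_le hm
      have hg := hs.deg
      rw [Function.iterate_succ_apply', Function.iterate_succ_apply']
      rw [← ih] at hs hl hg ⊢
      simp only [hx] at hl hg
      exact (clearRound_spec _).2 i j hi hj (by omega) (by omega) hs.monic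
  obtain ⟨hs, hg⟩ := iterate_clearRoundStep (x := x) hm hdvd d
  rw [← key d le_rfl] at hs hg
  simp only [hx] at hg
  -- A denominator of degree at most `d` loses a degree in each of the `d` rounds until it is
  -- constant, and being monic it ends as `1`.
  have hone := hs.monic.natDegree_eq_zero.1 (by simp only; omega)
  have hc := hs.cross
  have hb := hs.deg
  simp only [hx] at hone hc hb
  rw [hone, mul_one] at hc
  exact ⟨hc, by omega⟩

/-! ### The effect of the column reduction steps -/

theorem natDegree_lin_le (α β : ℤ) : (lin α β).natDegree ≤ 1 := natDegree_linear_le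

theorem mulOp_spec {a N : ℕ} (α β : ℤ) (σ : PolyState) {i j : ℕ} (hi : i < N) (hj : j < N)
    (hd : (σ.arr a i j).natDegree + 1 < N) :
    (mulOp a α β N σ).arr a i j = σ.arr a i j * lin α β :=
  PolyState.update_arr_self _ hi hj ((natDegree_mul_le.trans
    (Nat.add_le_add_left (natDegree_lin_le α β) _)).trans_lt hd)

theorem mulOp_arr_of_ne {a b N : ℕ} (α β : ℤ) (σ : PolyState) (h : b ≠ a) :
    (mulOp a α β N σ).arr b = σ.arr b := PolyState.update_arr_of_ne _ _ _ h

theorem iterate_mulPair {N : ℕ} (p α β : ℤ) (σ : PolyState) (t : ℕ) :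
    ((mulPair p α β N)^[t] σ).reg = σ.reg ∧
    (∀ b, b ≠ 13 → b ≠ 14 → ((mulPair p α β N)^[t] σ).arr b = σ.arr b) ∧
    ∀ i j, i < N → j < N → (σ.arr 13 i j).natDegree + t < N → (σ.arr 14 i j).natDegree + t < N →
      ((mulPair p α β N)^[t] σ).arr 13 i j = σ.arr 13 i j * (X - C (p : ℂ)) ^ t ∧
      ((mulPair p α β N)^[t] σ).arr 14 i j = σ.arr 14 i j * lin α β ^ t := by
  induction t with
  | zero => simp
  | succ t ih =>
    rw [Function.iterate_succ_apply']
    set τ := (mulPair p α β N)^[t] σ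
    refine ⟨ih.1, fun b h1 h2 => ?_, fun i j hi hj h1 h2 => ?_⟩
    · rw [mulPair, mulOp_arr_of_ne _ _ _ h2, mulOp_arr_of_ne _ _ _ h1, ih.2.1 b h1 h2]
    · obtain ⟨e1, e2⟩ := ih.2.2 i j hi hj (by omega) (by omega)
      have d1 : (τ.arr 13 i j).natDegree ≤ (σ.arr 13 i j).natDegree + t := by
        rw [e1]
        refine natDegree_mul_le.trans (Nat.add_le_add_left (natDegree_pow_le.trans ?_) _)
        rw [natDegree_X_sub_C, mul_one]
      have d2 : (τ.arr 14 i j).natDegree ≤ (σ.arr 14 i j).natDegree + t := by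
        rw [e2]
        refine natDegree_mul_le.trans (Nat.add_le_add_left (natDegree_pow_le.trans ?_) _)
        exact (Nat.mul_le_mul_left _ (natDegree_lin_le α β)).trans (by rw [mul_one])
      constructor
      · rw [mulPair, mulOp_arr_of_ne _ _ _ (by norm_num), mulOp_spec _ _ _ hi hj (by omega), e1,
          lin_one_neg, pow_succ, mul_assoc]
      · rw [mulPair, mulOp_spec _ _ _ hi hj] <;> rw [mulOp_arr_of_ne _ _ _ (by norm_num)]
        · rw [e2, pow_succ, mul_assoc]
        · omega

structure InitSpec (p α β : ℤ) (N : ℕ) (σ σ' : PolyState) : Prop where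
  count : σ'.reg 4 = 0
  reg : ∀ v, v ≠ 4 → σ'.reg v = σ.reg v
  arr : ∀ b, b ≠ 13 → b ≠ 14 → σ'.arr b = σ.arr b
  mult : ∀ i j, i < N → j < N →
    σ'.arr 13 i j = if i = j then (X - C (p : ℂ)) ^ (σ.reg 1 + σ.reg 5) else 0
  den : ∀ i j, i < N → j < N →
    σ'.arr 14 i j = lin α β ^ σ.reg 1 * (X - C (p : ℂ)) ^ σ.reg 5

theorem initAll_spec (p α β : ℤ) {N : ℕ} (σ : PolyState) (h : σ.reg 1 + σ.reg 5 < N) :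
    InitSpec p α β N σ (initAll p α β N σ) := by
  set σ₁ := initOne N σ with hσ₁
  have r1 : ∀ v, v ≠ 4 → σ₁.reg v = σ.reg v := fun v hv => PolyState.setReg_reg_of_ne _ _ hv
  have r4 : σ₁.reg 4 = 0 := PolyState.setReg_reg_self _ _ _
  have a1 : ∀ b, b ≠ 13 → b ≠ 14 → σ₁.arr b = σ.arr b := fun b h1 h2 =>
    (PolyState.update_arr_of_ne _ _ _ h2).trans (PolyState.update_arr_of_ne _ _ _ h1)
  have m1 : ∀ i j, i < N → j < N → σ₁.arr 13 i j = if i = j then 1 else 0 := fun i j hi hj => by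
    rw [hσ₁, initOne, PolyState.setReg_arr, PolyState.update_arr_of_ne _ _ _ (by norm_num)]
    refine PolyState.update_arr_self _ hi hj ?_
    split_ifs <;> simp <;> omega
  have q1 : ∀ i j, i < N → j < N → σ₁.arr 14 i j = 1 := fun i j hi hj => by
    rw [hσ₁, initOne, PolyState.setReg_arr]
    exact PolyState.update_arr_self _ hi hj (by simp; omega)
  set σ₂ := (mulPair p α β N)^[min N (σ₁.reg 1)] σ₁ with hσ₂
  have h12 := iterate_mulPair (N := N) p α β σ₁ (min N (σ₁.reg 1))
  rw [← hσ₂] at h12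
  have h23 := iterate_mulPair (N := N) p 1 (-p) σ₂ (min N (σ₂.reg 5))
  have hfin : initAll p α β N σ = (mulPair p 1 (-p) N)^[min N (σ₂.reg 5)] σ₂ := rfl
  rw [← hfin] at h23
  have v1 : min N (σ₁.reg 1) = σ.reg 1 := by rw [r1 1 (by norm_num)]; omega
  have v2 : min N (σ₂.reg 5) = σ.reg 5 := by rw [h12.1, r1 5 (by norm_num)]; omega
  rw [v1] at h12
  rw [v2] at h23
  have ent : ∀ i j, i < N → j < N → (initAll p α β N σ).arr 13 i j =
      (if i = j then (X - C (p : ℂ)) ^ (σ.reg 1 + σ.reg 5) else 0) ∧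
      (initAll p α β N σ).arr 14 i j = lin α β ^ σ.reg 1 * (X - C (p : ℂ)) ^ σ.reg 5 := by
    intro i j hi hj
    have n1 : (σ₁.arr 13 i j).natDegree = 0 := by
      rw [m1 i j hi hj]
      split_ifs <;> simp
    have n2 : (σ₁.arr 14 i j).natDegree = 0 := by simp [q1 i j hi hj]
    obtain ⟨e1, e2⟩ := h12.2.2 i j hi hj (by omega) (by omega)
    have d1 : (σ₂.arr 13 i j).natDegree ≤ σ.reg 1 := by
      rw [e1]
      refine natDegree_mul_le.trans ?_
      rw [n1, zero_add]
      refine natDegree_pow_le.trans ?_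
      rw [natDegree_X_sub_C, mul_one]
    have d2 : (σ₂.arr 14 i j).natDegree ≤ σ.reg 1 := by
      rw [e2]
      refine natDegree_mul_le.trans ?_
      rw [n2, zero_add]
      exact natDegree_pow_le.trans
        ((Nat.mul_le_mul_left _ (natDegree_lin_le α β)).trans (by rw [mul_one]))
    obtain ⟨f1, f2⟩ := h23.2.2 i j hi hj (by omega) (by omega)
    rw [f1, f2, e1, e2, m1 i j hi hj, q1 i j hi hj, lin_one_neg]
    refine ⟨?_, by rw [one_mul]⟩
    split_ifs
    · rw [one_mul, pow_add]
    · rw [zero_mul, zero_mul]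
  exact ⟨by rw [h23.1, h12.1, r4], fun v hv => by rw [h23.1, h12.1, r1 v hv],
    fun b hb hb' => by rw [h23.2.1 b hb hb', h12.2.1 b hb hb', a1 b hb hb'],
    fun i j hi hj => (ent i j hi hj).1, fun i j hi hj => (ent i j hi hj).2⟩

structure SearchSpec (σ σ' : PolyState) : Prop where
  reg : ∀ v, v ≠ 6 → v ≠ 7 → σ'.reg v = σ.reg v
  arr : σ'.arr = σ.arr
  le : σ.reg 4 ≤ σ'.reg 7
  lt : σ'.reg 7 < σ.reg 0
  zero : σ.pivotCol (σ'.reg 7) = 0 → ∀ i, σ.reg 4 ≤ i → i < σ.reg 0 → σ.pivotCol i = 0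

/-- Register `7` starts at row `r` and moves only to rows with nonzero entry. A zero entry in the
final row therefore means that it never moved and that the column vanishes from row `r` on. -/
theorem searchOp_spec {N : ℕ} (σ : PolyState) (hN : σ.reg 0 ≤ N) (hr : σ.reg 4 < σ.reg 0) :
    SearchSpec σ (searchOp N σ) := by
  set σ₁ := (σ.setReg 7 (σ.reg 4)).setReg 6 0 with hσ₁
  have r1 : ∀ v, v ≠ 6 → v ≠ 7 → σ₁.reg v = σ.reg v := fun v h6 h7 =>
    (PolyState.setReg_reg_of_ne _ _ h6).trans (PolyState.setReg_reg_of_ne _ _ h7)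
  have r6 : σ₁.reg 6 = 0 := PolyState.setReg_reg_self _ _ _
  have r7 : σ₁.reg 7 = σ.reg 4 :=
    (PolyState.setReg_reg_of_ne _ _ (by norm_num)).trans (PolyState.setReg_reg_self _ _ _)
  have key : ∀ t ≤ σ.reg 0, (∀ v, v ≠ 6 → v ≠ 7 → ((searchStep N)^[t] σ₁).reg v = σ.reg v) ∧
      ((searchStep N)^[t] σ₁).arr = σ.arr ∧ ((searchStep N)^[t] σ₁).reg 6 = t ∧
      σ.reg 4 ≤ ((searchStep N)^[t] σ₁).reg 7 ∧ ((searchStep N)^[t] σ₁).reg 7 < σ.reg 0 ∧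
      (σ.pivotCol (((searchStep N)^[t] σ₁).reg 7) = 0 →
        ∀ i, σ.reg 4 ≤ i → i < t → σ.pivotCol i = 0) := by
    intro t
    induction t with
    | zero => exact fun _ => ⟨r1, rfl, r6, r7.ge, r7.trans_lt hr, fun _ i _ h => absurd h (by omega)⟩
    | succ t ih =>
      intro ht
      obtain ⟨h1, h2, h3, h4, h5, h6⟩ := ih (by omega)
      rw [Function.iterate_succ_apply']
      set τ := (searchStep N)^[t] σ₁
      have hpc : ∀ i, τ.pivotCol i = σ.pivotCol i := fun i => by
        rw [PolyState.pivotCol, h1 4 (by norm_num) (by norm_num), h2, PolyState.pivotCol]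
      have fin : ∀ τ' : PolyState, searchStep N τ = τ'.setReg 6 (τ'.reg 6 + 1) →
          (∀ v, v ≠ 7 → τ'.reg v = τ.reg v) → τ'.arr = τ.arr →
          (∀ v, v ≠ 6 → v ≠ 7 → (searchStep N τ).reg v = σ.reg v) ∧
          (searchStep N τ).arr = σ.arr ∧ (searchStep N τ).reg 6 = t + 1 ∧
          (searchStep N τ).reg 7 = τ'.reg 7 := by
        intro τ' he hreg harr
        rw [he]
        refine ⟨fun v h6 h7 => ?_, harr.trans h2, ?_, ?_⟩
        · rw [PolyState.setReg_reg_of_ne _ _ h6, hreg v h7, h1 v h6 h7]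
        · rw [PolyState.setReg_reg_self, hreg 6 (by norm_num), h3]
        · rw [PolyState.setReg_reg_of_ne _ _ (by norm_num)]
      by_cases c1 : τ.reg 6 < τ.reg 4
      · obtain ⟨g1, g2, g3, g4⟩ := fin τ (by simp [searchStep, c1]) (fun _ _ => rfl) rfl
        rw [h3, h1 4 (by norm_num) (by norm_num)] at c1
        refine ⟨g1, g2, g3, by omega, by omega, fun hz i hi hit => ?_⟩
        omega
      by_cases c2 : τ.pivotCol (τ.reg 6) = 0
      · obtain ⟨g1, g2, g3, g4⟩ := fin τ (by simp [searchStep, c1, c2]) (fun _ _ => rfl) rfl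
        rw [h3, hpc] at c2
        refine ⟨g1, g2, g3, by omega, by omega, fun hz i hi hit => ?_⟩
        rw [g4] at hz
        rcases Nat.lt_succ_iff_lt_or_eq.1 hit with hlt | rfl
        · exact h6 hz i hi hlt
        · exact c2
      · obtain ⟨g1, g2, g3, g4⟩ := fin (τ.setReg 7 (τ.reg 6)) (by simp [searchStep, c1, c2])
          (fun v hv => PolyState.setReg_reg_of_ne _ _ hv) rfl
        rw [PolyState.setReg_reg_self, h3] at g4
        rw [h3, hpc] at c2
        rw [h3, h1 4 (by norm_num) (by norm_num)] at c1
        refine ⟨g1, g2, g3, by omega, by omega, fun hz => ?_⟩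
        rw [g4] at hz
        exact absurd hz c2
  have hfin : searchOp N σ = (searchStep N)^[σ.reg 0] σ₁ := by
    change (searchStep N)^[min N (σ₁.reg 0)] σ₁ = _
    rw [r1 0 (by norm_num) (by norm_num), min_eq_right hN]
  obtain ⟨h1, h2, h3, h4, h5, h6⟩ := key _ le_rfl
  rw [hfin]
  exact ⟨h1, h2, h4, h5, h6⟩

end FieldProgram

namespace FieldProgram

open Polynomial

theorem swapOp_spec {n N a : ℕ} (σ : PolyState) (hn : n ≤ N) (hr : σ.reg 4 < n)
    (hq : σ.reg 7 < n) (hd : ∀ i j, i < n → j < n → (σ.arr a i j).natDegree < N) {i j : ℕ}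
    (hi : i < n) (hj : j < n) : Equiv.swap (σ.reg 4) (σ.reg 7) i < n ∧
    (swapOp a N σ).arr a i j = σ.arr a (Equiv.swap (σ.reg 4) (σ.reg 7) i) j := by
  have hs : Equiv.swap (σ.reg 4) (σ.reg 7) i < n := by
    rw [Equiv.swap_apply_def]
    split_ifs <;> assumption
  have e : (if i = σ.reg 4 then σ.arr a (σ.reg 7) j
      else if i = σ.reg 7 then σ.arr a (σ.reg 4) j else σ.arr a i j) =
      σ.arr a (Equiv.swap (σ.reg 4) (σ.reg 7) i) j := by
    rw [Equiv.swap_apply_def]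
    split_ifs <;> rfl
  refine ⟨hs, ?_⟩
  rw [swapOp, PolyState.update_arr_self _ (hi.trans_le hn) (hj.trans_le hn)] <;> rw [e]
  exact hd _ _ hs hj

structure RowSpec (n N : ℕ) (σ σ' : PolyState) : Prop where
  count : σ'.reg 4 = σ.reg 4 + 1
  reg : ∀ v, v ≠ 4 → σ'.reg v = σ.reg v
  arr : ∀ b, b ≠ 11 → b ≠ 12 → σ'.arr b = σ.arr b
  pivot : ∀ j < n, σ'.arr 12 (σ.reg 4) j =
    C (1 / σ.pivotCol (σ.reg 7)) * σ.arr 12 (σ.reg 7) j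
  other : ∀ i j, i < n → j < n → i ≠ σ.reg 4 → σ'.arr 12 i j =
    σ.arr 12 (Equiv.swap (σ.reg 4) (σ.reg 7) i) j -
      C (σ.pivotCol (Equiv.swap (σ.reg 4) (σ.reg 7) i) / σ.pivotCol (σ.reg 7)) *
        σ.arr 12 (σ.reg 7) j

theorem rowOp_spec {n N : ℕ} (σ : PolyState) (hn : n ≤ N) (hr : σ.reg 4 < n) (hq : σ.reg 7 < n)
    (h11 : ∀ i j, i < n → j < n → (σ.arr 11 i j).natDegree < N)
    (h12 : ∀ i j, i < n → j < n → (σ.arr 12 i j).natDegree < N) :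
    RowSpec n N σ (rowOp N σ) := by
  set σ₁ := swapOp 12 N σ with hσ₁
  set σ₂ := swapOp 11 N σ₁ with hσ₂
  have a1 : ∀ b, b ≠ 12 → σ₁.arr b = σ.arr b := fun b hb => PolyState.update_arr_of_ne _ _ _ hb
  have a2 : ∀ b, b ≠ 11 → σ₂.arr b = σ₁.arr b := fun b hb => PolyState.update_arr_of_ne _ _ _ hb
  have s1 := fun i j (hi : i < n) (hj : j < n) => swapOp_spec σ hn hr hq h12 hi hj
  have s2 := fun i j (hi : i < n) (hj : j < n) => swapOp_spec (a := 11) σ₁ hn hr hq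
    (fun i j hi hj => by rw [a1 11 (by norm_num)]; exact h11 i j hi hj) hi hj
  have e12 : ∀ i j, i < n → j < n →
      σ₂.arr 12 i j = σ.arr 12 (Equiv.swap (σ.reg 4) (σ.reg 7) i) j := fun i j hi hj => by
    rw [a2 12 (by norm_num), (s1 i j hi hj).2]
  have ep : ∀ i, i < n → σ₂.pivotCol i = σ.pivotCol (Equiv.swap (σ.reg 4) (σ.reg 7) i) :=
    fun i hi => by
      change (σ₂.arr 11 i (σ.reg 4)).coeff 0 = _
      rw [(s2 i _ hi hr).2, a1 11 (by norm_num)]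
      rfl
  have hdeg : ∀ (c : ℂ) i j, i < n → j < n → (C c * σ₂.arr 12 i j).natDegree < N :=
    fun c i j hi hj => (natDegree_C_mul_le _ _).trans_lt (by
      rw [e12 i j hi hj]
      exact h12 _ _ (s1 i j hi hj).1 hj)
  have main : ∀ i j, i < n → j < n → (elimOp N σ₂).arr 12 i j =
      if i = σ.reg 4 then C (1 / σ₂.pivotCol (σ.reg 4)) * σ₂.arr 12 (σ.reg 4) j
      else σ₂.arr 12 i j - C (σ₂.pivotCol i / σ₂.pivotCol (σ.reg 4)) * σ₂.arr 12 (σ.reg 4) j := by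
    intro i j hi hj
    refine PolyState.update_arr_self _ (hi.trans_le hn) (hj.trans_le hn) ?_
    split_ifs
    · exact hdeg _ _ _ hr hj
    · refine (natDegree_sub_le _ _).trans_lt (max_lt ?_ (hdeg _ _ _ hr hj))
      rw [e12 i j hi hj]
      exact h12 _ _ (s1 i j hi hj).1 hj
  refine ⟨PolyState.setReg_reg_self _ _ _, fun v hv => PolyState.setReg_reg_of_ne _ _ hv,
    fun b h1 h2 => ?_, fun j hj => ?_, fun i j hi hj hne => ?_⟩
  · exact (PolyState.update_arr_of_ne _ _ _ h2).trans ((a2 b h1).trans (a1 b h2))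
  · change (elimOp N σ₂).arr 12 _ _ = _
    rw [main _ _ hr hj, if_pos rfl, ep _ hr, e12 _ _ hr hj, Equiv.swap_apply_left]
  · change (elimOp N σ₂).arr 12 _ _ = _
    rw [main _ _ hi hj, if_neg hne, ep _ hr, ep _ hi, e12 _ _ hr hj, e12 _ _ hi hj,
      Equiv.swap_apply_left]

/-- Row `i` of column `r` of the array `a` after subtracting multiples of the first `t` columns. -/
def PolyState.comb (σ : PolyState) (a t i : ℕ) : ℂ[X] :=
  σ.arr a i (σ.reg 4) - ∑ l ∈ Finset.range t, C (σ.pivotCol l) * σ.arr a i l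

theorem PolyState.natDegree_comb_le {σ : PolyState} {a t i n D : ℕ} (hr : σ.reg 4 < n)
    (ht : t ≤ n) (h : ∀ j < n, (σ.arr a i j).natDegree ≤ D) : (σ.comb a t i).natDegree ≤ D := by
  refine (natDegree_sub_le _ _).trans (max_le (h _ hr) ?_)
  refine natDegree_sum_le_of_forall_le _ _ fun l hl => ?_
  have := Finset.mem_range.1 hl
  exact (natDegree_C_mul_le _ _).trans (h _ (by omega))

theorem subColOp_spec {n N a D : ℕ} (σ τ : PolyState) (hn : n ≤ N) (hr : σ.reg 4 < n)
    (hD : D < N) (h : ∀ i j, i < n → j < n → (σ.arr a i j).natDegree ≤ D) {t : ℕ}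
    (ht : t < σ.reg 4) (h4 : τ.reg 4 = σ.reg 4) (h6 : τ.reg 6 = t)
    (hp : ∀ i, τ.pivotCol i = σ.pivotCol i)
    (hτ : ∀ i j, i < n → j < n →
      τ.arr a i j = if j = σ.reg 4 then σ.comb a t i else σ.arr a i j) :
    ∀ i j, i < n → j < n → (subColOp a N τ).arr a i j =
      if j = σ.reg 4 then σ.comb a (t + 1) i else σ.arr a i j := by
  intro i j hi hj
  have e : (if j = τ.reg 4 then
      τ.arr a i j - C (τ.pivotCol (τ.reg 6)) * τ.arr a i (τ.reg 6) else τ.arr a i j) =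
      if j = σ.reg 4 then σ.comb a (t + 1) i else σ.arr a i j := by
    rw [h4, h6, hp, hτ i j hi hj, hτ i t hi (by omega), if_neg ht.ne]
    split_ifs
    · rw [PolyState.comb, PolyState.comb, Finset.sum_range_succ]
      ring
    · rfl
  rw [subColOp, PolyState.update_arr_self _ (hi.trans_le hn) (hj.trans_le hn)] <;> rw [e]
  split_ifs
  · exact (PolyState.natDegree_comb_le hr (by omega) (h i · hi)).trans_lt hD
  · exact (h i j hi hj).trans_lt hD

theorem subColOp_arr_of_ne {a b : ℕ} (N : ℕ) (σ : PolyState) (h : b ≠ a) :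
    (subColOp a N σ).arr b = σ.arr b := PolyState.update_arr_of_ne _ _ _ h

/-- Multiplication by a polynomial of degree at most one precedes division by `w - p`. The degree
exceeds `D` by at most one in between, whence `D + 1 < N`, and is bounded by `D` again afterwards.
-/
theorem scaleColOp_spec {n N a D : ℕ} (p α β : ℤ) (σ : PolyState) (hn : n ≤ N) (ha : a ≠ 10)
    (ha' : a ≠ 11) (hD : D + 1 < N) (h : ∀ i j, i < n → j < n → (σ.arr a i j).natDegree ≤ D) :
    (scaleColOp a p α β N σ).reg = σ.reg ∧
    (∀ b, b ≠ 10 → b ≠ 11 → b ≠ a → (scaleColOp a p α β N σ).arr b = σ.arr b) ∧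
    ∀ i j, i < n → j < n → (scaleColOp a p α β N σ).arr a i j =
      if j = σ.reg 4 then (σ.arr a i j * lin α β) /ₘ (X - C (p : ℂ)) else σ.arr a i j := by
  set σ₁ := mulColOp a α β N σ with hσ₁
  have hl : ∀ i j, i < n → j < n → (σ.arr a i j * lin α β).natDegree ≤ D + 1 :=
    fun i j hi hj => natDegree_mul_le.trans (add_le_add (h i j hi hj) (natDegree_lin_le α β))
  have e1 : ∀ i j, i < n → j < n →
      σ₁.arr a i j = if j = σ.reg 4 then σ.arr a i j * lin α β else σ.arr a i j := by
    intro i j hi hj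
    refine PolyState.update_arr_self _ (hi.trans_le hn) (hj.trans_le hn) ?_
    split_ifs
    · exact (hl i j hi hj).trans_lt hD
    · exact (h i j hi hj).trans_lt (by omega)
  have hd1 : ∀ i j, i < n → j < n → (σ₁.arr a i j).natDegree < N := by
    intro i j hi hj
    rw [e1 i j hi hj]
    split_ifs
    · exact (hl i j hi hj).trans_lt hD
    · exact (h i j hi hj).trans_lt (by omega)
  have hs := divOp_spec ha p (N := N) σ₁
  have h4 : (divOp a p N σ₁).reg 4 = σ.reg 4 := by rw [hs.reg]; rfl
  refine ⟨hs.reg, fun b h1 h2 h3 => ?_, fun i j hi hj => ?_⟩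
  · exact (PolyState.update_arr_of_ne _ _ _ h3).trans
      ((hs.arr b h1 h2).trans (PolyState.update_arr_of_ne _ _ _ h3))
  · have e : (if j = (divOp a p N σ₁).reg 4 then (divOp a p N σ₁).arr 10 i j
        else (divOp a p N σ₁).arr a i j) =
        if j = σ.reg 4 then (σ.arr a i j * lin α β) /ₘ (X - C (p : ℂ)) else σ.arr a i j := by
      rw [h4, hs.quot i j (hi.trans_le hn) (hj.trans_le hn) (hd1 i j hi hj), hs.arr a ha ha',
        e1 i j hi hj]
      split_ifs <;> rfl
    rw [scaleColOp, divColOp, PolyState.update_arr_self _ (hi.trans_le hn) (hj.trans_le hn)] <;>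
      rw [e]
    split_ifs
    · exact ((natDegree_divByMonic_X_sub_C_le _ _).trans
        (Nat.sub_le_of_le_add (hl i j hi hj))).trans_lt (by omega)
    · exact (h i j hi hj).trans_lt (by omega)

structure ColSpec (n : ℕ) (p α β : ℤ) (σ σ' : PolyState) : Prop where
  reg : ∀ v, v ≠ 6 → σ'.reg v = σ.reg v
  arr : ∀ b, b ≠ 10 → b ≠ 11 → b ≠ 12 → b ≠ 13 → σ'.arr b = σ.arr b
  col : ∀ a, a = 12 ∨ a = 13 → ∀ i j, i < n → j < n → σ'.arr a i j = if j = σ.reg 4 then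
    (σ.comb a (σ.reg 4) i * lin α β) /ₘ (X - C (p : ℂ)) else σ.arr a i j

theorem colOp_spec {n N D : ℕ} (p α β : ℤ) (σ : PolyState) (hn : n ≤ N) (hr : σ.reg 4 < n)
    (hD : D + 1 < N) (h12 : ∀ i j, i < n → j < n → (σ.arr 12 i j).natDegree ≤ D)
    (h13 : ∀ i j, i < n → j < n → (σ.arr 13 i j).natDegree ≤ D) :
    ColSpec n p α β σ (colOp p α β N σ) := by
  set σ₁ := σ.setReg 6 0 with hσ₁
  have r1 : ∀ v, v ≠ 6 → σ₁.reg v = σ.reg v := fun v hv => PolyState.setReg_reg_of_ne _ _ hv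
  have key : ∀ t ≤ σ.reg 4, (∀ v, v ≠ 6 → ((subColStep N)^[t] σ₁).reg v = σ.reg v) ∧
      ((subColStep N)^[t] σ₁).reg 6 = t ∧
      (∀ b, b ≠ 12 → b ≠ 13 → ((subColStep N)^[t] σ₁).arr b = σ.arr b) ∧
      ∀ a, a = 12 ∨ a = 13 → ∀ i j, i < n → j < n → ((subColStep N)^[t] σ₁).arr a i j =
        if j = σ.reg 4 then σ.comb a t i else σ.arr a i j := by
    intro t
    induction t with
    | zero =>
      refine fun _ => ⟨r1, PolyState.setReg_reg_self _ _ _, fun _ _ _ => rfl,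
        fun a _ i j _ _ => ?_⟩
      simp only [PolyState.comb, Finset.range_zero, Finset.sum_empty, sub_zero]
      split_ifs with hj
      · rw [hj]; rfl
      · rfl
    | succ t ih =>
      intro ht
      obtain ⟨g1, g2, g3, g4⟩ := ih (by omega)
      rw [Function.iterate_succ_apply']
      set τ := (subColStep N)^[t] σ₁
      have hp : ∀ i, τ.pivotCol i = σ.pivotCol i := fun i => by
        rw [PolyState.pivotCol, g1 4 (by norm_num), g3 11 (by norm_num) (by norm_num),
          PolyState.pivotCol]
      set τ₁ := subColOp 12 N τ with hτ₁
      have b1 : ∀ b, b ≠ 12 → τ₁.arr b = τ.arr b := fun b hb =>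
        PolyState.update_arr_of_ne _ _ _ hb
      have hp' : ∀ i, τ₁.pivotCol i = σ.pivotCol i := fun i => by
        rw [← hp i]
        change (τ₁.arr 11 i (τ.reg 4)).coeff 0 = _
        rw [b1 11 (by norm_num)]
        rfl
      have c12 := subColOp_spec σ τ hn hr (by omega) h12 (by omega) (g1 4 (by norm_num)) g2 hp
        (g4 12 (Or.inl rfl))
      have c13 := subColOp_spec σ τ₁ hn hr (by omega) h13 (by omega) (g1 4 (by norm_num)) g2 hp'
        (by rw [b1 13 (by norm_num)]; exact g4 13 (Or.inr rfl))
      refine ⟨fun v hv => (PolyState.setReg_reg_of_ne _ _ hv).trans (g1 v hv), ?_,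
        fun b hb hb' => ?_, ?_⟩
      · exact (PolyState.setReg_reg_self _ _ _).trans (congrArg (· + 1) g2)
      · exact (PolyState.update_arr_of_ne _ _ _ hb').trans ((b1 b hb).trans (g3 b hb hb'))
      · rintro a (rfl | rfl) i j hi hj
        · rw [← c12 i j hi hj]
          exact congrFun (congrFun (subColOp_arr_of_ne (a := 13) (b := 12) N τ₁ (by norm_num)) i) j
        · exact c13 i j hi hj
  obtain ⟨g1, g2, g3, g4⟩ := key _ le_rfl
  set τ := (subColStep N)^[σ.reg 4] σ₁ with hτ
  have hdeg : ∀ a, a = 12 ∨ a = 13 → (∀ i j, i < n → j < n → (σ.arr a i j).natDegree ≤ D) →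
      ∀ i j, i < n → j < n → (τ.arr a i j).natDegree ≤ D := by
    intro a ha h i j hi hj
    rw [g4 a ha i j hi hj]
    split_ifs
    · exact PolyState.natDegree_comb_le hr hr.le (h i · hi)
    · exact h i j hi hj
  have hfin : colOp p α β N σ = scaleColOp 13 p α β N (scaleColOp 12 p α β N τ) := by
    rw [hτ, colOp, hσ₁]
    change scaleColOp 13 p α β N (scaleColOp 12 p α β N
      ((subColStep N)^[min N ((σ.setReg 6 0).reg 4)] _)) = _
    rw [PolyState.setReg_reg_of_ne _ _ (by norm_num), min_eq_right (by omega)]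
  obtain ⟨k1, k2, k3⟩ := scaleColOp_spec p α β τ hn (a := 12) (by norm_num) (by norm_num) hD
    (hdeg 12 (Or.inl rfl) h12)
  set τ₁ := scaleColOp 12 p α β N τ
  obtain ⟨l1, l2, l3⟩ := scaleColOp_spec p α β τ₁ hn (a := 13) (by norm_num) (by norm_num) hD
    (by rw [k2 13 (by norm_num) (by norm_num) (by norm_num)]; exact hdeg 13 (Or.inr rfl) h13)
  have e4 := g1 4 (by norm_num)
  have fin : ∀ a, a = 12 ∨ a = 13 → ∀ i j, i < n → j < n →
      (if j = σ.reg 4 then (τ.arr a i j * lin α β) /ₘ (X - C (p : ℂ)) else τ.arr a i j) =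
      if j = σ.reg 4 then (σ.comb a (σ.reg 4) i * lin α β) /ₘ (X - C (p : ℂ))
      else σ.arr a i j := by
    intro a ha i j hi hj
    rw [g4 a ha i j hi hj]
    split_ifs <;> rfl
  rw [hfin]
  refine ⟨fun v hv => by rw [l1, k1, g1 v hv], fun b h0 h1 h2 h3 => by
    rw [l2 b h0 h1 h3, k2 b h0 h1 h2, g3 b h2 h3], ?_⟩
  rintro a (rfl | rfl) i j hi hj
  · rw [l2 12 (by norm_num) (by norm_num) (by norm_num), k3 i j hi hj, e4]
    exact fin 12 (Or.inl rfl) i j hi hj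
  · rw [l3 i j hi hj, k1, e4, k2 13 (by norm_num) (by norm_num) (by norm_num)]
    exact fin 13 (Or.inr rfl) i j hi hj

end FieldProgram

/-! ### Matrices invertible over a subalgebra, elementary operations, and the order of the
determinant. -/

namespace ClutchingReduction

open Polynomial

/-- `V` is invertible over the subalgebra `R`. -/
structure InGL {n : ℕ} (R : Subalgebra ℂ (RatFunc ℂ)) (V : Matrix (Fin n) (Fin n) (RatFunc ℂ)) :
    Prop where
  mem : ∀ i j, V i j ∈ R
  det_ne_zero : V.det ≠ 0
  inv_mem : V.det⁻¹ ∈ R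

theorem InGL.mul {n : ℕ} {R : Subalgebra ℂ (RatFunc ℂ)} {V W : Matrix (Fin n) (Fin n) (RatFunc ℂ)}
    (hV : InGL R V) (hW : InGL R W) : InGL R (V * W) where
  mem i j := by
    rw [Matrix.mul_apply]
    exact sum_mem fun l _ => mul_mem (hV.mem i l) (hW.mem l j)
  det_ne_zero := by
    rw [Matrix.det_mul]
    exact mul_ne_zero hV.det_ne_zero hW.det_ne_zero
  inv_mem := by
    rw [Matrix.det_mul, mul_inv]
    exact mul_mem hV.inv_mem hW.inv_mem

theorem InGL.one (n : ℕ) (R : Subalgebra ℂ (RatFunc ℂ)) :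
    InGL R (1 : Matrix (Fin n) (Fin n) (RatFunc ℂ)) where
  mem i j := by
    rw [Matrix.one_apply]
    split_ifs
    · exact one_mem R
    · exact zero_mem R
  det_ne_zero := by simp
  inv_mem := by simp

theorem InGL.mono {n : ℕ} {R S : Subalgebra ℂ (RatFunc ℂ)} (h : R ≤ S)
    {V : Matrix (Fin n) (Fin n) (RatFunc ℂ)} (hV : InGL R V) : InGL S V :=
  ⟨fun i j => h (hV.mem i j), hV.det_ne_zero, h hV.inv_mem⟩

theorem InGL.transpose {n : ℕ} {R : Subalgebra ℂ (RatFunc ℂ)}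
    {V : Matrix (Fin n) (Fin n) (RatFunc ℂ)} (hV : InGL R V) : InGL R V.transpose :=
  ⟨fun i j => hV.mem j i, by rw [Matrix.det_transpose]; exact hV.det_ne_zero,
    by rw [Matrix.det_transpose]; exact hV.inv_mem⟩

theorem InGL.smul {n : ℕ} {R : Subalgebra ℂ (RatFunc ℂ)} {c : RatFunc ℂ} (hc : c ∈ R)
    (hc0 : c ≠ 0) (hc' : c⁻¹ ∈ R)
    {V : Matrix (Fin n) (Fin n) (RatFunc ℂ)} (hV : InGL R V) : InGL R (c • V) where
  mem i j := by
    rw [Matrix.smul_apply, smul_eq_mul]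
    exact mul_mem hc (hV.mem i j)
  det_ne_zero := by
    rw [Matrix.det_smul]
    exact mul_ne_zero (pow_ne_zero _ hc0) hV.det_ne_zero
  inv_mem := by
    rw [Matrix.det_smul, mul_inv, ← inv_pow]
    exact mul_mem (pow_mem hc' _) hV.inv_mem

theorem InGL.exists_toRat {n : ℕ} {R : Subalgebra ℂ (RatFunc ℂ)}
    {V : Matrix (Fin n) (Fin n) (RatFunc ℂ)} (hV : InGL R V) : ∃ U : GL (Fin n) R, toRat U = V := by
  let W : Matrix (Fin n) (Fin n) R := Matrix.of fun i j => ⟨V i j, hV.mem i j⟩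
  have hW : W.map (fun a => (a : RatFunc ℂ)) = V := rfl
  have hdet : ((W.det : R) : RatFunc ℂ) = V.det := by
    rw [← hW]
    exact R.val.toRingHom.map_det W
  have hu : IsUnit W.det := IsUnit.of_mul_eq_one (⟨V.det⁻¹, hV.inv_mem⟩ : R) (by
    apply Subtype.ext
    change ((W.det : R) : RatFunc ℂ) * V.det⁻¹ = 1
    rw [hdet, mul_inv_cancel₀ hV.det_ne_zero])
  exact ⟨Matrix.GeneralLinearGroup.mk'' W hu, rfl⟩

theorem inGL_toRat {n : ℕ} {R : Subalgebra ℂ (RatFunc ℂ)} (U : GL (Fin n) R) :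
    InGL R (toRat U) := by
  have hdet : (toRat U).det = (((U : Matrix (Fin n) (Fin n) R).det : R) : RatFunc ℂ) :=
    (R.val.toRingHom.map_det _).symm
  have hu : IsUnit (U : Matrix (Fin n) (Fin n) R).det := Matrix.isUnits_det_units U
  obtain ⟨b, hb⟩ := hu.exists_right_inv
  have hb' : (toRat U).det * (b : RatFunc ℂ) = 1 := by
    rw [hdet]
    exact congrArg Subtype.val hb
  exact ⟨fun i j => SetLike.coe_mem _, left_ne_zero_of_mul_eq_one hb',
    by rw [inv_eq_of_mul_eq_one_right hb']; exact b.2⟩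

section ColumnUpdate

variable {n : ℕ} {K : Type*} [CommRing K]

/-- The identity with one column replaced serves twice: on the right it replaces column `r` by a
combination of columns, on the left it performs an elimination with pivot row `r`. -/
theorem mul_updateCol_one_apply (A : Matrix (Fin n) (Fin n) K) (r : Fin n) (w : Fin n → K)
    (i j : Fin n) : (A * (1 : Matrix (Fin n) (Fin n) K).updateCol r w) i j =
      if j = r then ∑ l, A i l * w l else A i j := by
  rw [Matrix.mul_apply]
  split_ifs with h
  · simp [h]
  · simp [h, Matrix.one_apply]

theorem updateCol_one_mul_apply (A : Matrix (Fin n) (Fin n) K) (r : Fin n) (w : Fin n → K)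
    (i j : Fin n) : ((1 : Matrix (Fin n) (Fin n) K).updateCol r w * A) i j =
      if i = r then w r * A r j else A i j + w i * A r j := by
  rw [Matrix.mul_apply]
  have : ∀ l, (1 : Matrix (Fin n) (Fin n) K).updateCol r w i l * A l j =
      (if l = r then w i * A r j else 0) + (if l = i then if i = r then 0 else A i j else 0) := by
    intro l
    rw [Matrix.updateCol_apply, Matrix.one_apply]
    by_cases h1 : l = r <;> by_cases h2 : i = l <;> simp_all [eq_comm]
  rw [Finset.sum_congr rfl fun l _ => this l, Finset.sum_add_distrib]
  simp only [Finset.sum_ite_eq', Finset.mem_univ, if_true]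
  split_ifs with h
  · rw [h, add_zero]
  · rw [add_comm]

theorem det_updateCol_one (r : Fin n) (w : Fin n → K) :
    ((1 : Matrix (Fin n) (Fin n) K).updateCol r w).det = w r := by
  rw [← Matrix.cramer_apply, Matrix.cramer_one]
  rfl

end ColumnUpdate

/-- The embedding of polynomials into rational functions. -/
abbrev toFrac : ℂ[X] →+* RatFunc ℂ := algebraMap ℂ[X] (RatFunc ℂ)

theorem toFrac_injective : Function.Injective toFrac := IsFractionRing.injective ℂ[X] (RatFunc ℂ)

theorem toFrac_ne_zero {p : ℂ[X]} (h : p ≠ 0) : toFrac p ≠ 0 :=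
  (map_ne_zero_iff _ toFrac_injective).2 h

theorem toFrac_C (c : ℂ) : toFrac (C c) = algebraMap ℂ (RatFunc ℂ) c :=
  (IsScalarTower.algebraMap_apply ℂ ℂ[X] (RatFunc ℂ) c).symm

/-- The polynomial matrices `A` and `P` arise from `A₀` and `(w - p)^e` by invertible constant row
operations on `A` and by column operations over `R`. -/
def Tracked {n : ℕ} (R : Subalgebra ℂ (RatFunc ℂ)) (A₀ : Matrix (Fin n) (Fin n) ℂ[X]) (p : ℂ)
    (e : ℕ) (A P : Matrix (Fin n) (Fin n) ℂ[X]) : Prop :=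
  ∃ (L : Matrix (Fin n) (Fin n) ℂ) (V : Matrix (Fin n) (Fin n) (RatFunc ℂ)), L.det ≠ 0 ∧ InGL R V ∧
    A.map toFrac = (L.map C).map toFrac * A₀.map toFrac * V ∧
    P.map toFrac = toFrac ((X - C p) ^ e) • V

variable {n : ℕ} {R : Subalgebra ℂ (RatFunc ℂ)} {A₀ A P A' P' : Matrix (Fin n) (Fin n) ℂ[X]}
  {p : ℂ} {e : ℕ}

/-- Constant row operations are absorbed into `L`, so the record `P` is unaffected. -/
theorem Tracked.row (h : Tracked R A₀ p e A P) (T : Matrix (Fin n) (Fin n) ℂ) (hT : T.det ≠ 0)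
    (hA : A' = T.map C * A) : Tracked R A₀ p e A' P := by
  obtain ⟨L, V, hL, hV, h1, h2⟩ := h
  refine ⟨T * L, V, by rw [Matrix.det_mul]; exact mul_ne_zero hT hL, hV, ?_, h2⟩
  rw [hA, Matrix.map_mul, h1, Matrix.map_mul, Matrix.map_mul, Matrix.mul_assoc, Matrix.mul_assoc,
    Matrix.mul_assoc]

/-- `A'` arises from `A` by replacing column `r` by `h / (w - p)` times the combination of columns
with coefficients `c`. -/
structure ColumnStep (p : ℂ) (h : ℂ[X]) (r : Fin n) (c : Fin n → ℂ)
    (A A' : Matrix (Fin n) (Fin n) ℂ[X]) : Prop where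
  other : ∀ i j, j ≠ r → A' i j = A i j
  col : ∀ i, (X - C p) * A' i r = (∑ l, A i l * C (c l)) * h

theorem ColumnStep.map_eq {h : ℂ[X]} {r : Fin n} {c : Fin n → ℂ} (hs : ColumnStep p h r c A A') :
    A'.map toFrac = A.map toFrac * (1 : Matrix (Fin n) (Fin n) (RatFunc ℂ)).updateCol r
      (fun l => toFrac (C (c l)) * (toFrac h / toFrac (X - C p))) := by
  ext i j
  rw [mul_updateCol_one_apply, Matrix.map_apply]
  split_ifs with hj
  · subst hj
    have hx := toFrac_ne_zero (X_sub_C_ne_zero p)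
    have := congrArg toFrac (hs.col i)
    rw [map_mul, map_mul, map_sum] at this
    simp only [Matrix.map_apply, ← mul_assoc]
    rw [← Finset.sum_mul, ← mul_div_assoc, eq_div_iff hx, mul_comm, this]
    simp only [map_mul]
  · rw [hs.other i j hj, Matrix.map_apply]

theorem inGL_updateCol {r : Fin n} {c : Fin n → ℂ} (hc : c r = 1) {u : RatFunc ℂ} (hu : u ∈ R)
    (hu0 : u ≠ 0) (hu' : u⁻¹ ∈ R) : InGL R ((1 : Matrix (Fin n) (Fin n) (RatFunc ℂ)).updateCol r
      (fun l => toFrac (C (c l)) * u)) where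
  mem i j := by
    rw [Matrix.updateCol_apply]
    split_ifs
    · rw [toFrac_C]
      exact mul_mem (R.algebraMap_mem _) hu
    · exact (InGL.one n R).mem i j
  det_ne_zero := by simpa [det_updateCol_one, hc] using hu0
  inv_mem := by simpa [det_updateCol_one, hc] using hu'

/-- `V` is multiplied by an elementary matrix whose determinant is the unit `f / (w - p)` of `R`. -/
theorem Tracked.column (h : Tracked R A₀ p e A P) {f : ℂ[X]} {r : Fin n} {c : Fin n → ℂ}
    (hc : c r = 1) (hA : ColumnStep p f r c A A') (hP : ColumnStep p f r c P P')
    (hu : toFrac f / toFrac (X - C p) ∈ R) (hu0 : f ≠ 0)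
    (hu' : (toFrac f / toFrac (X - C p))⁻¹ ∈ R) : Tracked R A₀ p e A' P' := by
  obtain ⟨L, V, hL, hV, h1, h2⟩ := h
  refine ⟨L, _, hL, hV.mul (inGL_updateCol hc hu (div_ne_zero (toFrac_ne_zero hu0)
    (toFrac_ne_zero (X_sub_C_ne_zero p))) hu'), ?_, ?_⟩
  · rw [hA.map_eq, h1, Matrix.mul_assoc]
  · rw [hP.map_eq, h2, Matrix.smul_mul]

/-- The order of vanishing of `det A` at `p` is an exponent `m` with `(w - p)^m ∣ P`. -/
def DetOrder (p : ℂ) (A P : Matrix (Fin n) (Fin n) ℂ[X]) (m : ℕ) : Prop :=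
  (∃ q : ℂ[X], A.det = (X - C p) ^ m * q ∧ q.eval p ≠ 0) ∧ ∀ i j, (X - C p) ^ m ∣ P i j

theorem DetOrder.row {m : ℕ} (h : DetOrder p A P m) (T : Matrix (Fin n) (Fin n) ℂ) (hT : T.det ≠ 0)
    (hA : A' = T.map C * A) : DetOrder p A' P m := by
  obtain ⟨⟨q, h1, h2⟩, h3⟩ := h
  refine ⟨⟨C T.det * q, ?_, by simp [hT, h2]⟩, h3⟩
  have : (T.map C).det = C T.det := ((C : ℂ →+* ℂ[X]).map_det T).symm
  rw [hA, Matrix.det_mul, this, h1]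
  ring

theorem DetOrder.eq_zero {m : ℕ} (h : DetOrder p A P m) (hA : A.map (eval p) = 1) : m = 0 := by
  obtain ⟨⟨q, h1, -⟩, -⟩ := h
  have hd : (evalRingHom p) A.det = 1 := by
    rw [RingHom.map_det]
    change (A.map (eval p)).det = 1
    rw [hA, Matrix.det_one]
  by_contra hm
  rw [h1, coe_evalRingHom, eval_mul, eval_pow, eval_sub, eval_X, eval_C, sub_self, zero_pow hm,
    zero_mul] at hd
  exact zero_ne_one hd

/-- `c` is a nonzero kernel vector of `A(p)`, so `det A` vanishes at `p`. -/
theorem DetOrder.pos {m : ℕ} (h : DetOrder p A P m) {r : Fin n} {c : Fin n → ℂ} (hc : c r = 1)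
    (h0 : ∀ i, (∑ l, A i l * C (c l)).eval p = 0) : 0 < m := by
  obtain ⟨⟨q, h1, h2⟩, -⟩ := h
  have hd : (A.map (eval p)).det = 0 := by
    refine Matrix.exists_mulVec_eq_zero_iff.1 ⟨c, fun hc0 => by simp [hc0] at hc, ?_⟩
    funext i
    have := h0 i
    simp only [eval_finsetSum, eval_mul, eval_C] at this
    exact this
  have hd' : A.det.eval p = 0 := by
    rw [← hd]
    exact (evalRingHom p).map_det A
  by_contra hm
  obtain rfl : m = 0 := by omega
  rw [h1, pow_zero, one_mul] at hd'
  exact h2 hd'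

theorem ColumnStep.det_eq {h : ℂ[X]} {r : Fin n} {c : Fin n → ℂ} (hc : c r = 1)
    (hs : ColumnStep p h r c A A') : (X - C p) * A'.det = A.det * h := by
  apply toFrac_injective
  have e1 : toFrac A'.det = (A'.map toFrac).det := toFrac.map_det A'
  have e2 : toFrac A.det = (A.map toFrac).det := toFrac.map_det A
  have hx := toFrac_ne_zero (X_sub_C_ne_zero p)
  rw [map_mul, map_mul, e1, e2, hs.map_eq, Matrix.det_mul, det_updateCol_one, hc, C_1, map_one,
    one_mul]
  field_simp

/-- The determinant is multiplied by `f / (w - p)` with `f(p) ≠ 0`, so its order drops by exactly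
one. Column `r` of `P` loses at most one factor `w - p`, and `(w - p)^(m - 1)` still divides
everything. -/
theorem DetOrder.column {m : ℕ} (h : DetOrder p A P m) {f : ℂ[X]} {r : Fin n} {c : Fin n → ℂ}
    (hc : c r = 1) (hA : ColumnStep p f r c A A') (hP : ColumnStep p f r c P P')
    (hf : f.eval p ≠ 0) (hm : 0 < m) : DetOrder p A' P' (m - 1) := by
  obtain ⟨⟨q, h1, h2⟩, h3⟩ := h
  have hx := X_sub_C_ne_zero p
  obtain ⟨m, rfl⟩ := Nat.exists_eq_succ_of_ne_zero hm.ne'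
  rw [Nat.succ_eq_add_one, Nat.add_sub_cancel]
  refine ⟨⟨q * f, mul_left_cancel₀ hx ?_, by simp [h2, hf]⟩, fun i j => ?_⟩
  · rw [hA.det_eq hc, h1, pow_succ]
    ring
  · by_cases hj : j = r
    · subst hj
      have hd : (X - C p) ^ (m + 1) ∣ (X - C p) * P' i j := by
        rw [hP.col]
        exact (Finset.dvd_sum fun l _ => (h3 i l).mul_right _).mul_right _
      rw [pow_succ'] at hd
      exact (mul_dvd_mul_iff_left hx).1 hd
    · rw [hP.other i j hj]
      exact (pow_dvd_pow _ (Nat.le_succ m)).trans (h3 i j)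

end ClutchingReduction

/-! ### The invariant of the column reduction and its termination. -/

namespace ClutchingReduction

open Polynomial FieldProgram

/-- The upper left `n × n` block of array `a`. -/
def block (n a : ℕ) (σ : PolyState) : Matrix (Fin n) (Fin n) ℂ[X] :=
  Matrix.of fun i j => σ.arr a i j

theorem block_apply {n a : ℕ} (σ : PolyState) (i j : Fin n) : block n a σ i j = σ.arr a i j := rfl

/-- The invariant of the column reduction at `p` started in the state `σ₀`. -/
structure ReduceInv (n D : ℕ) (p : ℤ) (R : Subalgebra ℂ (RatFunc ℂ))
    (A₀ : Matrix (Fin n) (Fin n) ℂ[X]) (e : ℕ) (σ₀ : PolyState) (μ : ℕ) (σ : PolyState) :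
    Prop where
  reg : ∀ v, v ≠ 4 → v ≠ 6 → v ≠ 7 → σ.reg v = σ₀.reg v
  arr : ∀ b, b ≠ 10 → b ≠ 11 → b ≠ 12 → b ≠ 13 → σ.arr b = σ₀.arr b
  count_le : σ.reg 4 ≤ n
  deg : ∀ a, a = 12 ∨ a = 13 → ∀ i j, i < n → j < n → (σ.arr a i j).natDegree ≤ D
  cols : ∀ i j, i < n → j < σ.reg 4 → (σ.arr 12 i j).eval (p : ℂ) = if i = j then 1 else 0
  order : ∃ m, DetOrder (p : ℂ) (block n 12 σ) (block n 13 σ) m ∧ m + (n - σ.reg 4) ≤ μ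
  tracked : Tracked R A₀ p e (block n 12 σ) (block n 13 σ)

theorem val_swap {n : ℕ} (r q i : Fin n) :
    ((Equiv.swap r q i : Fin n) : ℕ) = Equiv.swap (r : ℕ) (q : ℕ) (i : ℕ) := by
  rw [Equiv.swap_apply_def, Equiv.swap_apply_def]
  simp only [Fin.ext_iff]
  split_ifs <;> rfl

variable {n N D : ℕ} {p α β : ℤ} {R : Subalgebra ℂ (RatFunc ℂ)}
  {A₀ : Matrix (Fin n) (Fin n) ℂ[X]} {e : ℕ} {σ₀ : PolyState} {μ : ℕ} {σ : PolyState}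

/-- The state after evaluation at `p` and pivot search. -/
structure Searched (n : ℕ) (p : ℤ) (σ τ : PolyState) : Prop where
  reg : ∀ v, v ≠ 6 → v ≠ 7 → τ.reg v = σ.reg v
  arr : ∀ b, b ≠ 10 → b ≠ 11 → τ.arr b = σ.arr b
  const : ∀ i j, i < n → j < n → (τ.arr 11 i j).natDegree = 0
  pivotCol : ∀ i < n, τ.pivotCol i = (σ.arr 12 i (σ.reg 4)).eval (p : ℂ)
  le : σ.reg 4 ≤ τ.reg 7
  lt : τ.reg 7 < n
  zero : τ.pivotCol (τ.reg 7) = 0 → ∀ i, σ.reg 4 ≤ i → i < n → τ.pivotCol i = 0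

theorem searched_searchOp (hn : n ≤ N) (h0 : σ.reg 0 = n) (hr : σ.reg 4 < n)
    (hd : ∀ i j, i < n → j < n → (σ.arr 12 i j).natDegree < N) :
    Searched n p σ (searchOp N (divOp 12 p N σ)) := by
  have h1 := divOp_spec (a := 12) (by norm_num) p (N := N) σ
  set σ₁ := divOp 12 p N σ
  have h2 := searchOp_spec (N := N) σ₁ (by rw [h1.reg, h0]; exact hn)
    (by rw [h1.reg, h0]; exact hr)
  set τ := searchOp N σ₁
  have e4 : σ₁.reg 4 = σ.reg 4 := by rw [h1.reg]
  have e0 : σ₁.reg 0 = n := by rw [h1.reg, h0]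
  have hp : ∀ i, τ.pivotCol i = σ₁.pivotCol i := fun i => by
    rw [PolyState.pivotCol, h2.arr, h2.reg 4 (by norm_num) (by norm_num), PolyState.pivotCol]
  have hrem : ∀ i j, i < n → j < n → σ₁.arr 11 i j = C ((σ.arr 12 i j).eval (p : ℂ)) :=
    fun i j hi hj => h1.rem i j (hi.trans_le hn) (hj.trans_le hn) (hd i j hi hj)
  refine ⟨fun v h6 h7 => by rw [h2.reg v h6 h7, h1.reg], fun b h10 h11 => by
    rw [h2.arr, h1.arr b h10 h11], fun i j hi hj => by rw [h2.arr, hrem i j hi hj, natDegree_C],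
    fun i hi => ?_, e4 ▸ h2.le, e0 ▸ h2.lt, fun hz i hi hin => ?_⟩
  · rw [hp, PolyState.pivotCol, e4, hrem i _ hi hr, coeff_C_zero]
  · rw [hp] at hz ⊢
    exact h2.zero hz i (e4 ▸ hi) (e0.symm ▸ hin)

/-- The budget drops because `r` grows while the order of the determinant stays the same. -/
theorem ReduceInv.rowOp (h : ReduceInv n D p R A₀ e σ₀ μ σ) (hn : n ≤ N) (hD : D < N)
    (hr : σ.reg 4 < n) {τ : PolyState} (hτ : Searched n p σ τ)
    (hz : τ.pivotCol (τ.reg 7) ≠ 0) :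
    ReduceInv n D p R A₀ e σ₀ (μ - 1) (rowOp N τ) := by
  have e4 : τ.reg 4 = σ.reg 4 := hτ.reg 4 (by norm_num) (by norm_num)
  have e12 : τ.arr 12 = σ.arr 12 := hτ.arr 12 (by norm_num) (by norm_num)
  have e13 : τ.arr 13 = σ.arr 13 := hτ.arr 13 (by norm_num) (by norm_num)
  have d12 := h.deg 12 (Or.inl rfl)
  have hs := rowOp_spec (n := n) (N := N) τ hn (e4 ▸ hr) hτ.lt
    (fun i j hi hj => by rw [hτ.const i j hi hj]; omega)
    (fun i j hi hj => by rw [e12]; exact (d12 i j hi hj).trans_lt hD)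
  set σ' := FieldProgram.rowOp N τ
  set q := τ.reg 7
  set v := τ.pivotCol
  have hv := hτ.pivotCol
  have swlt : ∀ i, i < n → Equiv.swap (σ.reg 4) q i < n := fun i hi => by
    rw [Equiv.swap_apply_def]
    split_ifs
    exacts [hτ.lt, hr, hi]
  have hpiv : ∀ j < n, σ'.arr 12 (σ.reg 4) j = C (1 / v q) * σ.arr 12 q j := by
    have := hs.pivot
    rwa [e4, e12] at this
  have hoth : ∀ i j, i < n → j < n → i ≠ σ.reg 4 → σ'.arr 12 i j =
      σ.arr 12 (Equiv.swap (σ.reg 4) q i) j -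
        C (v (Equiv.swap (σ.reg 4) q i) / v q) * σ.arr 12 q j := by
    have := hs.other
    rwa [e4, e12] at this
  have a13 : block n 13 σ' = block n 13 σ := by
    ext1 i j
    rw [block_apply, block_apply, hs.arr 13 (by norm_num) (by norm_num), e13]
  have r4 : σ'.reg 4 = σ.reg 4 + 1 := by rw [hs.count, e4]
  -- The operation is left multiplication by a transposition matrix `Pm` followed by an elimination
  -- matrix `T`, both constant and invertible.
  let r' : Fin n := ⟨σ.reg 4, hr⟩
  let q' : Fin n := ⟨q, hτ.lt⟩
  let Pm : Matrix (Fin n) (Fin n) ℂ := (1 : Matrix (Fin n) (Fin n) ℂ).submatrix (Equiv.swap r' q') id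
  let w : Fin n → ℂ := fun i => if i = r' then 1 / v q else -(v (Equiv.swap r' q' i : Fin n) / v q)
  let T : Matrix (Fin n) (Fin n) ℂ := (1 : Matrix (Fin n) (Fin n) ℂ).updateCol r' w
  have hPm : Pm.det ≠ 0 := by
    rw [Matrix.det_permute, Matrix.det_one, mul_one]
    exact_mod_cast Units.ne_zero _
  have hT : T.det ≠ 0 := by
    rw [det_updateCol_one]
    simpa [w] using hz
  have hA1 : (block n 12 σ).submatrix (Equiv.swap r' q') id = Pm.map C * block n 12 σ := by
    have : Pm.map C = (1 : Matrix (Fin n) (Fin n) ℂ[X]).submatrix (Equiv.swap r' q') id := by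
      rw [← Matrix.submatrix_map, Matrix.map_one _ C_0 C_1]
    rw [this]
    ext1 i j
    simp [Matrix.mul_apply, Matrix.one_apply]
  have hA2 : block n 12 σ' = T.map C * (block n 12 σ).submatrix (Equiv.swap r' q') id := by
    have : T.map C = (1 : Matrix (Fin n) (Fin n) ℂ[X]).updateCol r' (fun i => C (w i)) := by
      rw [Matrix.map_updateCol, Matrix.map_one _ C_0 C_1]
      rfl
    ext1 i j
    rw [this, updateCol_one_mul_apply]
    simp only [Matrix.submatrix_apply, id_eq, block_apply, Equiv.swap_apply_left]
    split_ifs with hi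
    · subst hi
      rw [hpiv j j.2]
      simp [w, q']
    · have hi' : (i : ℕ) ≠ σ.reg 4 := fun hh => hi (Fin.ext hh)
      rw [hoth i j i.2 j.2 hi', val_swap]
      simp only [w, if_neg hi, val_swap, C_neg, neg_mul, sub_eq_add_neg, r', q']
  refine ⟨fun u h4 h6 h7 => ?_, fun b h0 h1 h2 h3 => ?_, by omega, ?_, ?_, ?_, ?_⟩
  · rw [hs.reg u (by omega), hτ.reg u h6 h7, h.reg u h4 h6 h7]
  · rw [hs.arr b h1 h2, hτ.arr b h0 h1, h.arr b h0 h1 h2 h3]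
  · rintro a (rfl | rfl) i j hi hj
    · by_cases hir : i = σ.reg 4
      · rw [hir, hpiv j hj]
        exact (natDegree_C_mul_le _ _).trans (d12 _ _ hτ.lt hj)
      · rw [hoth i j hi hj hir]
        exact (natDegree_sub_le _ _).trans (max_le (d12 _ _ (swlt i hi) hj)
          ((natDegree_C_mul_le _ _).trans (d12 _ _ hτ.lt hj)))
    · rw [hs.arr 13 (by norm_num) (by norm_num), e13]
      exact h.deg 13 (Or.inr rfl) i j hi hj
  · intro i j hi hj
    rw [r4] at hj
    have hle := hτ.le
    rcases Nat.lt_succ_iff_lt_or_eq.1 hj with hlt | rfl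
    · have hq0 : (σ.arr 12 q j).eval (p : ℂ) = 0 := by
        rw [h.cols q j hτ.lt hlt, if_neg (by omega)]
      by_cases hir : i = σ.reg 4
      · rw [hir, hpiv j (by omega), eval_mul, hq0, mul_zero, if_neg (by omega)]
      · rw [hoth i j hi (by omega) hir, eval_sub, eval_mul, hq0, mul_zero, sub_zero,
          h.cols _ j (swlt i hi) hlt]
        refine if_congr ?_ rfl rfl
        rw [Equiv.swap_apply_def]
        split_ifs <;> omega
    · by_cases hir : i = σ.reg 4
      · rw [hir, hpiv _ hr, eval_mul, eval_C, ← hv q hτ.lt, if_pos rfl, one_div,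
          inv_mul_cancel₀ hz]
      · rw [hoth i _ hi hr hir, eval_sub, eval_mul, eval_C, ← hv q hτ.lt, ← hv _ (swlt i hi),
          div_mul_cancel₀ _ hz, sub_self, if_neg hir]
  · obtain ⟨m, hm, hle⟩ := h.order
    rw [a13]
    exact ⟨m, (hm.row Pm hPm hA1).row T hT hA2, by omega⟩
  · rw [a13]
    exact (h.tracked.row Pm hPm hA1).row T hT hA2

/-- Puts the combination into the form required by `ColumnStep`, with coefficient `1` at column `r`.
-/
theorem comb_eq_sum {τ : PolyState} {a i r : ℕ} (hr : τ.reg 4 = r) (hrn : r < n) :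
    τ.comb a r i = ∑ l : Fin n, τ.arr a i l *
      C (if (l : ℕ) < r then -τ.pivotCol l else if (l : ℕ) = r then 1 else 0) := by
  rw [Fin.sum_univ_eq_sum_range (fun l => τ.arr a i l *
    C (if l < r then -τ.pivotCol l else if l = r then 1 else 0)),
    ← Finset.sum_subset (Finset.range_subset_range.2 (Nat.succ_le_of_lt hrn)) (fun l _ hl => by
      rw [Finset.mem_range] at hl
      rw [if_neg (by omega), if_neg (by omega), C_0, mul_zero]), Finset.sum_range_succ,
    if_neg (lt_irrefl r), if_pos rfl, C_1, mul_one, PolyState.comb, hr, add_comm, sub_eq_add_neg,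
    ← Finset.sum_neg_distrib]
  congr 1
  refine Finset.sum_congr rfl fun l hl => ?_
  rw [if_pos (Finset.mem_range.1 hl), C_neg]
  ring

/-- The budget drops because the order of the determinant does; `r` stays the same. -/
theorem ReduceInv.colOp (h : ReduceInv n D p R A₀ e σ₀ μ σ) (hn : n ≤ N) (hD : D + 1 < N)
    (hr : σ.reg 4 < n) {τ : PolyState} (hτ : Searched n p σ τ)
    (hz : τ.pivotCol (τ.reg 7) = 0) (hl : (lin α β).eval (p : ℂ) ≠ 0)
    (hu : toFrac (lin α β) / toFrac (X - C (p : ℂ)) ∈ R)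
    (hu' : (toFrac (lin α β) / toFrac (X - C (p : ℂ)))⁻¹ ∈ R) :
    ReduceInv n D p R A₀ e σ₀ (μ - 1) (colOp p α β N τ) := by
  have e4 : τ.reg 4 = σ.reg 4 := hτ.reg 4 (by norm_num) (by norm_num)
  have e12 : τ.arr 12 = σ.arr 12 := hτ.arr 12 (by norm_num) (by norm_num)
  have e13 : τ.arr 13 = σ.arr 13 := hτ.arr 13 (by norm_num) (by norm_num)
  have eτ : ∀ a, a = 12 ∨ a = 13 → τ.arr a = σ.arr a := by
    rintro a (rfl | rfl) <;> assumption
  have hs := colOp_spec (n := n) (N := N) (D := D) p α β τ hn (e4 ▸ hr) hD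
    (by rw [e12]; exact h.deg 12 (Or.inl rfl)) (by rw [e13]; exact h.deg 13 (Or.inr rfl))
  set σ' := FieldProgram.colOp p α β N τ
  obtain ⟨m, hm, hmle⟩ := h.order
  let r' : Fin n := ⟨σ.reg 4, hr⟩
  let c : Fin n → ℂ := fun l =>
    if (l : ℕ) < σ.reg 4 then -τ.pivotCol l else if (l : ℕ) = σ.reg 4 then 1 else 0
  have hc : c r' = 1 := by simp [c, r']
  have hsum : ∀ a, a = 12 ∨ a = 13 → ∀ i : Fin n,
      τ.comb a (σ.reg 4) i = ∑ l, block n a σ i l * C (c l) := by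
    intro a ha i
    rw [comb_eq_sum e4 hr, eτ a ha]
    rfl
  have hroot : ∀ i < n, (τ.comb 12 (σ.reg 4) i).eval (p : ℂ) = 0 := by
    intro i hi
    rw [PolyState.comb, e4, e12, eval_sub, eval_finsetSum, ← hτ.pivotCol i hi]
    have : ∀ l ∈ Finset.range (σ.reg 4), (C (τ.pivotCol l) * σ.arr 12 i l).eval (p : ℂ) =
        if i = l then τ.pivotCol i else 0 := by
      intro l hl
      rw [eval_mul, eval_C, h.cols i l hi (Finset.mem_range.1 hl)]
      split_ifs with hil
      · rw [hil, mul_one]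
      · rw [mul_zero]
    rw [Finset.sum_congr rfl this, Finset.sum_ite_eq]
    split_ifs with hir
    · rw [sub_self]
    · rw [Finset.mem_range, not_lt] at hir
      rw [hτ.zero hz i hir hi, sub_zero]
  have hpos : 0 < m := hm.pos hc fun i => by
    rw [← hsum 12 (Or.inl rfl)]
    exact hroot i i.2
  have hroot' : ∀ a, a = 12 ∨ a = 13 → ∀ i : Fin n,
      (τ.comb a (σ.reg 4) i * lin α β).IsRoot (p : ℂ) := by
    rintro a (rfl | rfl) i
    · rw [IsRoot, eval_mul, hroot i i.2, zero_mul]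
    -- The division is exact in array `13` for another reason than in array `12`: all its entries
    -- are divisible by `(w - p)^m` with `m > 0`.
    · rw [← dvd_iff_isRoot, hsum 13 (Or.inr rfl)]
      exact (Finset.dvd_sum fun l _ =>
        ((dvd_pow_self _ hpos.ne').trans (hm.2 i l)).mul_right _).mul_right _
  have hstep : ∀ a, a = 12 ∨ a = 13 →
      ColumnStep (p : ℂ) (lin α β) r' c (block n a σ) (block n a σ') := by
    intro a ha
    refine ⟨fun i j hj => ?_, fun i => ?_⟩
    · rw [block_apply, hs.col a ha i j i.2 j.2, if_neg, eτ a ha, block_apply]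
      rw [e4]
      exact fun hh => hj (Fin.ext hh)
    · rw [block_apply, hs.col a ha i r' i.2 r'.2, if_pos e4.symm, e4, ← hsum a ha]
      exact mul_divByMonic_eq_iff_isRoot.2 (hroot' a ha i)
  have r4 : σ'.reg 4 = σ.reg 4 := by rw [hs.reg 4 (by norm_num), e4]
  have hlin : lin α β ≠ 0 := fun h0 => by simp [h0] at hl
  refine ⟨fun u h4 h6 h7 => ?_, fun b h0 h1 h2 h3 => ?_, by omega, ?_, ?_, ?_, ?_⟩
  · rw [hs.reg u h6, hτ.reg u h6 h7, h.reg u h4 h6 h7]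
  · rw [hs.arr b h0 h1 h2 h3, hτ.arr b h0 h1, h.arr b h0 h1 h2 h3]
  · intro a ha i j hi hj
    rw [hs.col a ha i j hi hj, eτ a ha]
    split_ifs
    · refine (natDegree_divByMonic_X_sub_C_le _ _).trans (Nat.sub_le_of_le_add ?_)
      refine natDegree_mul_le.trans (add_le_add ?_ (natDegree_lin_le α β))
      exact PolyState.natDegree_comb_le (e4 ▸ hr) (e4 ▸ hr.le)
        (by rw [eτ a ha]; exact fun j hj => h.deg a ha i j hi hj)
    · exact h.deg a ha i j hi hj
  · intro i j hi hj
    rw [r4] at hj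
    rw [hs.col 12 (Or.inl rfl) i j hi (by omega), if_neg (by omega), e12]
    exact h.cols i j hi hj
  · exact ⟨m - 1, hm.column hc (hstep 12 (Or.inl rfl)) (hstep 13 (Or.inr rfl)) hl hpos, by omega⟩
  · exact h.tracked.column hc (hstep 12 (Or.inl rfl)) (hstep 13 (Or.inr rfl)) hu hlin hu'

theorem ReduceInv.eval_eq_one (h : ReduceInv n D p R A₀ e σ₀ μ σ) (hr : σ.reg 4 = n) :
    (block n 12 σ).map (eval (p : ℂ)) = 1 := by
  ext1 i j
  rw [Matrix.map_apply, block_apply, h.cols i j i.2 (hr ▸ j.2), Matrix.one_apply]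
  exact if_congr Fin.ext_iff.symm rfl rfl

theorem ReduceInv.reduceStep (h : ReduceInv n D p R A₀ e σ₀ μ σ) (h0 : σ₀.reg 0 = n) (hn : n ≤ N)
    (hD : D + 1 < N) (hl : (lin α β).eval (p : ℂ) ≠ 0)
    (hu : toFrac (lin α β) / toFrac (X - C (p : ℂ)) ∈ R)
    (hu' : (toFrac (lin α β) / toFrac (X - C (p : ℂ)))⁻¹ ∈ R) :
    ReduceInv n D p R A₀ e σ₀ (μ - 1) (reduceStep p α β N σ) := by
  have e0 : σ.reg 0 = n := by rw [h.reg 0 (by norm_num) (by norm_num) (by norm_num), h0]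
  rw [FieldProgram.reduceStep, e0]
  split_ifs with hr
  · have hτ : Searched n p σ (searchOp N (divOp 12 p N σ)) := searched_searchOp hn e0 hr
      (fun i j hi hj => (h.deg 12 (Or.inl rfl) i j hi hj).trans_lt (by omega))
    rw [pivotOp]
    beta_reduce
    split_ifs with hz
    · exact h.colOp hn hD hr hτ hz hl hu hu'
    · exact h.rowOp hn (by omega) hr hτ hz
  -- Nothing happens, but `A(p) = 1` forces `m = 0`, so the invariant holds for every budget.
  · have hrn : σ.reg 4 = n := le_antisymm h.count_le (not_lt.1 hr)
    obtain ⟨m, hm, -⟩ := h.order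
    exact ⟨h.reg, h.arr, h.count_le, h.deg, h.cols,
      ⟨m, hm, by rw [hm.eq_zero (h.eval_eq_one hrn), hrn]; omega⟩, h.tracked⟩

/-- The result of the column reduction at `p`. -/
structure Reduction (n D : ℕ) (p α β : ℤ) (R : Subalgebra ℂ (RatFunc ℂ)) (σ σ' : PolyState) :
    Prop where
  reg : ∀ v, v ≠ 4 → v ≠ 6 → v ≠ 7 → σ'.reg v = σ.reg v
  arr : ∀ b, b < 10 → σ'.arr b = σ.arr b
  deg : ∀ i j, i < n → j < n → (σ'.arr 13 i j).natDegree ≤ D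
  den : ∀ i j, i < n → j < n →
    σ'.arr 14 i j = lin α β ^ σ.reg 1 * (X - C (p : ℂ)) ^ σ.reg 5
  eval : ∃ A : Matrix (Fin n) (Fin n) ℂ[X], A.map (eval (p : ℂ)) = 1 ∧
    Tracked R (block n 12 σ) p (σ.reg 1 + σ.reg 5) A (block n 13 σ')

theorem reduceAll_spec (h0 : σ.reg 0 = n) (hN : σ.reg 5 + n ≤ N) (hD : D + 1 < N)
    (hD' : σ.reg 1 + σ.reg 5 ≤ D) (hl : (lin α β).eval (p : ℂ) ≠ 0)
    (hu : toFrac (lin α β) / toFrac (X - C (p : ℂ)) ∈ R)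
    (hu' : (toFrac (lin α β) / toFrac (X - C (p : ℂ)))⁻¹ ∈ R)
    (hA : ∀ i j, i < n → j < n → (σ.arr 12 i j).natDegree ≤ D)
    (hdet : (block n 12 σ).det ≠ 0) (hdet' : (block n 12 σ).det.natDegree ≤ σ.reg 5) :
    Reduction n D p α β R σ (reduceAll p α β N σ) := by
  have hi := initAll_spec p α β σ (N := N) (by omega)
  set σ₁ := initAll p α β N σ with hσ₁
  have b12 : block n 12 σ₁ = block n 12 σ := by
    ext1 i j
    rw [block_apply, hi.arr 12 (by norm_num) (by norm_num), block_apply]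
  have hn : n ≤ N := by omega
  have b13 : block n 13 σ₁ = Matrix.diagonal fun _ => (X - C (p : ℂ)) ^ (σ.reg 1 + σ.reg 5) := by
    ext1 i j
    rw [block_apply, hi.mult i j (i.2.trans_le hn) (j.2.trans_le hn), Matrix.diagonal_apply]
    exact if_congr Fin.ext_iff.symm rfl rfl
  have base : ReduceInv n D p R (block n 12 σ) (σ.reg 1 + σ.reg 5) σ₁ N σ₁ := by
    refine ⟨fun _ _ _ _ => rfl, fun _ _ _ _ _ => rfl, by rw [hi.count]; omega, ?_, ?_, ?_, ?_⟩
    · rintro a (rfl | rfl) i j hin hjn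
      · rw [hi.arr 12 (by norm_num) (by norm_num)]
        exact hA i j hin hjn
      · rw [hi.mult i j (hin.trans_le hn) (hjn.trans_le hn)]
        split_ifs
        · rw [natDegree_pow, natDegree_X_sub_C, mul_one]
          exact hD'
        · simp
    · intro i j _ hj
      rw [hi.count] at hj
      omega
    · rw [b12, b13]
      -- The initial `m` is the multiplicity of `p` as a root of the determinant, at most its degree
      -- and hence at most `K`. So the budget `N ≥ K + n` suffices, and `(w - p)^m` divides the
      -- initial record.
      obtain ⟨q, hq, hnd⟩ := exists_eq_pow_rootMultiplicity_mul_and_not_dvd _ hdet (p : ℂ)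
      have hm : (block n 12 σ).det.rootMultiplicity (p : ℂ) ≤ σ.reg 5 :=
        by
        have := natDegree_le_of_dvd (pow_rootMultiplicity_dvd (block n 12 σ).det (p : ℂ)) hdet
        rw [natDegree_pow, natDegree_X_sub_C, mul_one] at this
        exact this.trans hdet'
      refine ⟨_, ⟨⟨q, hq, fun hq0 => hnd (dvd_iff_isRoot.2 hq0)⟩, fun i j => ?_⟩, ?_⟩
      · rw [Matrix.diagonal_apply]
        split_ifs
        · exact pow_dvd_pow _ (by omega)
        · exact dvd_zero _
      · rw [hi.count]
        omega
    · refine ⟨1, 1, by simp, InGL.one n R, ?_, ?_⟩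
      · rw [b12, Matrix.map_one _ C_0 C_1, Matrix.map_one _ (map_zero _) (map_one _),
          Matrix.one_mul, Matrix.mul_one]
      · rw [b13, Matrix.diagonal_map (map_zero _), Matrix.smul_one_eq_diagonal]
  have key : ∀ t, ReduceInv n D p R (block n 12 σ) (σ.reg 1 + σ.reg 5) σ₁ (N - t)
      ((reduceStep p α β N)^[t] σ₁) := by
    intro t
    induction t with
    | zero =>
      rw [Function.iterate_zero_apply, Nat.sub_zero]
      exact base
    | succ t ih =>
      rw [Function.iterate_succ_apply', ← Nat.sub_sub]
      exact ih.reduceStep (by rw [hi.reg 0 (by norm_num), h0]) hn hD hl hu hu'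
  have hf := key N
  have hfin : reduceAll p α β N σ = (reduceStep p α β N)^[N] σ₁ := by rw [reduceAll, hσ₁]
  rw [← hfin, Nat.sub_self] at hf
  have hcount : (reduceAll p α β N σ).reg 4 = n := by
    -- The exhausted budget leaves `n - r = 0`.
    obtain ⟨m, -, hm⟩ := hf.order
    have := hf.count_le
    omega
  refine ⟨fun v h4 h6 h7 => by rw [hf.reg v h4 h6 h7, hi.reg v h4], fun b hb => by
    rw [hf.arr b (by omega) (by omega) (by omega) (by omega), hi.arr b (by omega) (by omega)],
    hf.deg 13 (Or.inr rfl), fun i j hin hjn => ?_, _, hf.eval_eq_one hcount, hf.tracked⟩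
  rw [hf.arr 14 (by norm_num) (by norm_num) (by norm_num) (by norm_num),
    hi.den i j (hin.trans_le hn) (hjn.trans_le hn)]

end ClutchingReduction

namespace ClutchingReduction

open Polynomial FieldProgram

/-! ### Subrings of rational functions -/

/-- The rational functions without pole at `p`. -/
def regularAt (p : ℂ) : Subalgebra ℂ (RatFunc ℂ) where
  carrier := {x | ∃ f g : ℂ[X], g.eval p ≠ 0 ∧ x = toFrac f / toFrac g}
  mul_mem' := by
    rintro _ _ ⟨f, g, hg, rfl⟩ ⟨f', g', hg', rfl⟩
    exact ⟨f * f', g * g', by simp [hg, hg'], by rw [map_mul, map_mul, div_mul_div_comm]⟩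
  add_mem' := by
    rintro _ _ ⟨f, g, hg, rfl⟩ ⟨f', g', hg', rfl⟩
    have h : ∀ q : ℂ[X], q.eval p ≠ 0 → toFrac q ≠ 0 := fun q hq =>
      toFrac_ne_zero fun h0 => hq (by rw [h0, eval_zero])
    exact ⟨f * g' + g * f', g * g', by simp [hg, hg'], by
      rw [div_add_div _ _ (h g hg) (h g' hg'), map_mul, map_add, map_mul, map_mul]⟩
  algebraMap_mem' c := ⟨C c, 1, by simp, by rw [toFrac_C, map_one, div_one]⟩

theorem toFrac_mem_regularAt (p : ℂ) (f : ℂ[X]) : toFrac f ∈ regularAt p :=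
  ⟨f, 1, by simp, by rw [map_one, div_one]⟩

theorem inv_toFrac_mem_regularAt {p : ℂ} {f : ℂ[X]} (h : f.eval p ≠ 0) :
    (toFrac f)⁻¹ ∈ regularAt p := ⟨1, f, h, by rw [map_one, one_div]⟩

theorem toFrac_X_sub_C (p : ℂ) : toFrac (X - C p) = w - algebraMap ℂ (RatFunc ℂ) p := by
  rw [map_sub, toFrac_C, RatFunc.algebraMap_X]

theorem toFrac_X_sub_one : toFrac (X - C 1) = w - 1 := by
  rw [toFrac_X_sub_C, map_one]

theorem toFrac_X_sub_two : toFrac (X - C 2) = w - 2 := by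
  rw [toFrac_X_sub_C, map_ofNat]

theorem inv_sub_mem_regularAt {p q : ℂ} (h : p ≠ q) :
    (w - algebraMap ℂ (RatFunc ℂ) q)⁻¹ ∈ regularAt p := by
  rw [← toFrac_X_sub_C]
  exact inv_toFrac_mem_regularAt (by simpa [sub_eq_zero] using h)

theorem toFrac_mem {R : Subalgebra ℂ (RatFunc ℂ)} (h : w ∈ R) (f : ℂ[X]) : toFrac f ∈ R := by
  induction f using Polynomial.induction_on' with
  | add f g hf hg => rw [map_add]; exact add_mem hf hg
  | monomial k c =>
    rw [← C_mul_X_pow_eq_monomial, map_mul, map_pow, toFrac_C, RatFunc.algebraMap_X]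
    exact mul_mem (R.algebraMap_mem c) (pow_mem h k)

theorem w_mem_regularAt (p : ℂ) : w ∈ regularAt p := by
  have h := toFrac_mem_regularAt p X
  rwa [RatFunc.algebraMap_X] at h

theorem ringOne_le_regularAt : ringOne ≤ regularAt 1 := by
  refine Algebra.adjoin_le ?_
  rintro x (rfl | rfl)
  · simpa using inv_sub_mem_regularAt (p := 1) (q := 0) one_ne_zero
  · have h := inv_sub_mem_regularAt (p := 1) (q := 2) (by norm_num)
    rwa [map_ofNat] at h

theorem ringTwo_le_regularAt : ringTwo ≤ regularAt 2 := by
  refine Algebra.adjoin_le ?_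
  rintro x (rfl | rfl)
  · exact w_mem_regularAt 2
  · simpa using inv_sub_mem_regularAt (p := 2) (q := 1) (by norm_num)

theorem ringOne_le_ringS : ringOne ≤ ringS :=
  Algebra.adjoin_mono (by rintro x (rfl | rfl) <;> simp)

theorem ringTwo_le_ringS : ringTwo ≤ ringS :=
  Algebra.adjoin_mono (by rintro x (rfl | rfl) <;> simp)

theorem poleProd_eq : poleProd = X * (X - C 1) * (X - C 2) := by
  simp [poleProd]

theorem poleProd_ne_zero : poleProd ≠ 0 := by
  rw [poleProd_eq]
  exact mul_ne_zero (mul_ne_zero X_ne_zero (X_sub_C_ne_zero _)) (X_sub_C_ne_zero _)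

theorem exists_mul_poleProd_pow {x : RatFunc ℂ} (hx : x ∈ ringS) :
    ∃ (m : ℕ) (f : ℂ[X]), x * toFrac poleProd ^ m = toFrac f := by
  have e0 : toFrac X = w := RatFunc.algebraMap_X
  have e1 := toFrac_X_sub_one
  have e2 := toFrac_X_sub_two
  have h0 : w ≠ 0 := e0 ▸ toFrac_ne_zero X_ne_zero
  have h1 : w - 1 ≠ 0 := e1 ▸ toFrac_ne_zero (X_sub_C_ne_zero 1)
  have h2 : w - 2 ≠ 0 := e2 ▸ toFrac_ne_zero (X_sub_C_ne_zero 2)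
  have hp : toFrac poleProd = w * (w - 1) * (w - 2) := by
    rw [poleProd_eq, map_mul, map_mul, e0, e1, e2]
  induction hx using Algebra.adjoin_induction with
  | mem x hx =>
    rcases hx with rfl | rfl | rfl | rfl
    · exact ⟨0, X, by rw [pow_zero, mul_one, e0]⟩
    · refine ⟨1, (X - C 1) * (X - C 2), ?_⟩
      rw [pow_one, hp, map_mul, e1, e2]
      field_simp
    · refine ⟨1, X * (X - C 2), ?_⟩
      rw [pow_one, hp, map_mul, e0, e2]
      field_simp
    · refine ⟨1, X * (X - C 1), ?_⟩
      rw [pow_one, hp, map_mul, e0, e1]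
      field_simp
  | algebraMap c => exact ⟨0, C c, by rw [pow_zero, mul_one, toFrac_C]⟩
  | add x y _ _ hx hy =>
    obtain ⟨m, f, hf⟩ := hx
    obtain ⟨m', f', hf'⟩ := hy
    refine ⟨m + m', f * poleProd ^ m' + f' * poleProd ^ m, ?_⟩
    rw [map_add, map_mul, map_mul, map_pow, map_pow, ← hf, ← hf', pow_add]
    ring
  | mul x y _ _ hx hy =>
    obtain ⟨m, f, hf⟩ := hx
    obtain ⟨m', f', hf'⟩ := hy
    refine ⟨m + m', f * f', ?_⟩
    rw [map_mul, ← hf, ← hf', pow_add]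
    ring

theorem exists_denom_dvd {x : RatFunc ℂ} (hx : x ∈ ringS) : ∃ m, x.denom ∣ poleProd ^ m := by
  obtain ⟨m, f, hf⟩ := exists_mul_poleProd_pow hx
  have h := pow_ne_zero m poleProd_ne_zero
  refine ⟨m, (RatFunc.denom_dvd h).2 ⟨f, ?_⟩⟩
  rw [eq_div_iff (toFrac_ne_zero h), map_pow, hf]

theorem denom_eval_ne_zero {x : RatFunc ℂ} {p : ℂ} (hx : x ∈ regularAt p) :
    x.denom.eval p ≠ 0 := by
  obtain ⟨f, g, hg, hfg⟩ := hx
  have hg0 : g ≠ 0 := fun h0 => hg (by rw [h0, eval_zero])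
  obtain ⟨q, hq⟩ := (RatFunc.denom_dvd hg0).2 ⟨f, hfg⟩
  intro h0
  exact hg (by rw [hq, eval_mul, h0, zero_mul])

/-- The reduced denominator divides a power of `w (w - 1) (w - 2)` and is coprime to `w - 1` and `w
- 2`, so it divides a power of `w`. -/
theorem mem_ringLaurent {x : RatFunc ℂ} (hx : x ∈ ringS) (h1 : x ∈ regularAt 1)
    (h2 : x ∈ regularAt 2) : x ∈ ringLaurent := by
  obtain ⟨m, hm⟩ := exists_denom_dvd hx
  have hcop : ∀ p : ℂ, x ∈ regularAt p → IsCoprime x.denom ((X - C p) ^ m) := fun p hp =>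
    (((irreducible_X_sub_C p).coprime_iff_not_dvd).2 fun hd =>
      denom_eval_ne_zero hp (dvd_iff_isRoot.1 hd)).symm.pow_right
  rw [poleProd_eq, mul_pow, mul_pow] at hm
  have hX := (hcop 1 h1).dvd_of_dvd_mul_right ((hcop 2 h2).dvd_of_dvd_mul_right hm)
  obtain ⟨f, hf⟩ := (RatFunc.denom_dvd (pow_ne_zero m X_ne_zero)).1 hX
  have hw : w ∈ ringLaurent := Algebra.subset_adjoin (by simp)
  have hw' : w⁻¹ ∈ ringLaurent := Algebra.subset_adjoin (by simp)
  rw [hf, map_pow, RatFunc.algebraMap_X, div_eq_mul_inv, ← inv_pow]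
  exact mul_mem (toFrac_mem hw f) (pow_mem hw' m)

theorem InGL.laurent {n : ℕ} {V : Matrix (Fin n) (Fin n) (RatFunc ℂ)} (hS : InGL ringS V)
    (h1 : InGL (regularAt 1) V) (h2 : InGL (regularAt 2) V) : InGL ringLaurent V :=
  ⟨fun i j => mem_ringLaurent (hS.mem i j) (h1.mem i j) (h2.mem i j), hS.det_ne_zero,
    mem_ringLaurent hS.inv_mem h1.inv_mem h2.inv_mem⟩

/-! ### From the reduction to the multiplier -/

variable {n : ℕ} {p : ℂ}

theorem inGL_map_toFrac {A : Matrix (Fin n) (Fin n) ℂ[X]} (hA : A.det.eval p ≠ 0) :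
    InGL (regularAt p) (A.map toFrac) := by
  have hdet : (A.map toFrac).det = toFrac A.det := (toFrac.map_det A).symm
  refine ⟨fun i j => toFrac_mem_regularAt p _, ?_, ?_⟩ <;> rw [hdet]
  · exact toFrac_ne_zero fun h0 => hA (by rw [h0, eval_zero])
  · exact inv_toFrac_mem_regularAt hA

/-- The factor `(w - p)^d` contained in `A₀` must be undone. Dividing by it need not stay inside
`R`, so the unit `((w - p)/f)^d` is used instead, leaving `M U = (f g)^(-d) L⁻¹ A` with `f g`
nonzero at `p`. -/
theorem inGL_of_tracked {R : Subalgebra ℂ (RatFunc ℂ)} {M : Matrix (Fin n) (Fin n) (RatFunc ℂ)}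
    {A₀ A P : Matrix (Fin n) (Fin n) ℂ[X]} {d K : ℕ} {f g : ℂ[X]}
    (hA₀ : A₀.map toFrac = toFrac (poleProd ^ d) • M)
    (hg : poleProd = (X - C p) * g) (hgp : g.eval p ≠ 0) (hf : f.eval p ≠ 0)
    (hu : toFrac f / toFrac (X - C p) ∈ R) (hu' : (toFrac f / toFrac (X - C p))⁻¹ ∈ R)
    (hA : A.map (eval p) = 1) (ht : Tracked R A₀ p (d + K) A P) :
    InGL R ((toFrac (f ^ d * (X - C p) ^ K))⁻¹ • P.map toFrac) ∧
    InGL (regularAt p) (M * ((toFrac (f ^ d * (X - C p) ^ K))⁻¹ • P.map toFrac)) := by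
  obtain ⟨L, V, hL, hV, h1, h2⟩ := ht
  have hx := toFrac_ne_zero (X_sub_C_ne_zero p)
  have hf0 : toFrac f ≠ 0 := toFrac_ne_zero fun h0 => hf (by rw [h0, eval_zero])
  have hg0 : toFrac g ≠ 0 := toFrac_ne_zero fun h0 => hgp (by rw [h0, eval_zero])
  set c := (toFrac f / toFrac (X - C p))⁻¹ ^ d with hc
  have hU : (toFrac (f ^ d * (X - C p) ^ K))⁻¹ • P.map toFrac = c • V := by
    rw [h2, smul_smul]
    congr 1
    rw [hc, inv_div, div_pow, map_mul, map_pow, map_pow, map_pow, pow_add]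
    field_simp
  have hc0 : c ≠ 0 := pow_ne_zero _ (inv_ne_zero (div_ne_zero hf0 hx))
  have hcR : InGL R (c • V) := hV.smul (pow_mem hu' _) hc0 (by
    rw [← inv_pow, inv_inv]
    exact pow_mem hu _)
  rw [hU]
  refine ⟨hcR, ?_⟩
  have hAdet : A.det.eval p = 1 := by
    have : (evalRingHom p) A.det = (A.map (eval p)).det := (evalRingHom p).map_det A
    rwa [hA, Matrix.det_one] at this
  have hLi : ((L⁻¹).map C).det.eval p ≠ 0 := by
    have : ((L⁻¹).map C).det = C (L⁻¹).det := ((C : ℂ →+* ℂ[X]).map_det _).symm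
    rw [this, eval_C]
    have hm : (L⁻¹).det * L.det = 1 := by
      rw [← Matrix.det_mul, Matrix.nonsing_inv_mul _ (isUnit_iff_ne_zero.2 hL), Matrix.det_one]
    exact left_ne_zero_of_mul_eq_one hm
  have hLL : ((L⁻¹).map C).map toFrac * (L.map C).map toFrac = 1 := by
    rw [← Matrix.map_mul, ← Matrix.map_mul, Matrix.nonsing_inv_mul _ (isUnit_iff_ne_zero.2 hL),
      Matrix.map_one _ C_0 C_1, Matrix.map_one _ (map_zero _) (map_one _)]
  have hA0V : A₀.map toFrac * V = ((L⁻¹).map C).map toFrac * A.map toFrac := by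
    rw [h1, ← Matrix.mul_assoc, ← Matrix.mul_assoc, hLL, Matrix.one_mul]
  have hMU : M * (c • V) = (toFrac ((f * g) ^ d))⁻¹ •
      (((L⁻¹).map C).map toFrac * A.map toFrac) := by
    rw [← hA0V, hA₀, Matrix.smul_mul, smul_smul, Matrix.mul_smul]
    congr 1
    rw [hc, hg, map_pow, map_pow, map_mul, map_mul, ← inv_pow, ← mul_pow]
    congr 1
    field_simp
  rw [hMU]
  have hfg : ((f * g) ^ d).eval p ≠ 0 := by simp [hf, hgp]
  have hfg0 : toFrac ((f * g) ^ d) ≠ 0 := by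
    rw [map_pow, map_mul]
    exact pow_ne_zero _ (mul_ne_zero hf0 hg0)
  exact ((inGL_map_toFrac hLi).mul (inGL_map_toFrac (by rw [hAdet]; exact one_ne_zero))).smul
    (inv_toFrac_mem_regularAt hfg) (inv_ne_zero hfg0)
    (by rw [inv_inv]; exact toFrac_mem_regularAt p _)

theorem natDegree_det_le {A : Matrix (Fin n) (Fin n) ℂ[X]} {D : ℕ}
    (h : ∀ i j, (A i j).natDegree ≤ D) : A.det.natDegree ≤ n * D := by
  rw [Matrix.det_apply]
  refine natDegree_sum_le_of_forall_le _ _ fun τ _ => ?_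
  refine (natDegree_smul_le _ _).trans ((natDegree_prod_le _ _).trans ?_)
  exact (Finset.sum_le_card_nsmul _ _ D fun i _ => h _ _).trans (by simp)

theorem ratDegree_le {M : Matrix (Fin n) (Fin n) (RatFunc ℂ)} (i j : Fin n) :
    ratDegree (M i j) ≤ matDegree M :=
  (Finset.le_sup (f := fun j => ratDegree (M i j)) (Finset.mem_univ j)).trans
    (Finset.le_sup (f := fun i => Finset.univ.sup fun j => ratDegree (M i j)) (Finset.mem_univ i))

/-- Functions in `ringOne` have no pole at infinity, so `1/(w-2)` is not a unit there; the numerator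
`w` moves the zero from infinity to the permitted point `0`. -/
theorem mul_inv_mem_ringOne : toFrac (lin 1 0) / toFrac (X - C ((2 : ℤ) : ℂ)) ∈ ringOne ∧
    (toFrac (lin 1 0) / toFrac (X - C ((2 : ℤ) : ℂ)))⁻¹ ∈ ringOne := by
  have hw : toFrac (lin 1 0) = w := by simp [lin]
  have hw2 : toFrac (X - C ((2 : ℤ) : ℂ)) = w - 2 := by
    rw [Int.cast_ofNat, toFrac_X_sub_two]
  have h0 : w ≠ 0 := RatFunc.X_ne_zero
  have h2 : w - 2 ≠ 0 := hw2 ▸ toFrac_ne_zero (X_sub_C_ne_zero _)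
  have m0 : w⁻¹ ∈ ringOne := Algebra.subset_adjoin (by simp)
  have m2 : (w - 2)⁻¹ ∈ ringOne := Algebra.subset_adjoin (by simp)
  have two : (2 : RatFunc ℂ) ∈ ringOne := by simp
  rw [hw, hw2]
  constructor
  · have : w / (w - 2) = 1 + 2 * (w - 2)⁻¹ := by field_simp; ring
    rw [this]
    exact add_mem (one_mem _) (mul_mem two m2)
  · have : (w / (w - 2))⁻¹ = 1 - 2 * w⁻¹ := by field_simp
    rw [this]
    exact sub_mem (one_mem _) (mul_mem two m0)

/-- Here a pole at infinity is permitted, so `1/(w-1)` itself is a unit. -/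
theorem mul_inv_mem_ringTwo : toFrac (lin 0 1) / toFrac (X - C ((1 : ℤ) : ℂ)) ∈ ringTwo ∧
    (toFrac (lin 0 1) / toFrac (X - C ((1 : ℤ) : ℂ)))⁻¹ ∈ ringTwo := by
  have hw : toFrac (lin 0 1) = 1 := by simp [lin]
  have hw1 : toFrac (X - C ((1 : ℤ) : ℂ)) = w - 1 := by
    rw [Int.cast_one, toFrac_X_sub_one]
  have m0 : w ∈ ringTwo := Algebra.subset_adjoin (by simp)
  have m1 : (w - 1)⁻¹ ∈ ringTwo := Algebra.subset_adjoin (by simp)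
  rw [hw, hw1, one_div, inv_inv]
  exact ⟨m1, sub_mem m0 (one_mem _)⟩

end ClutchingReduction

namespace ClutchingReduction

open Polynomial FieldProgram

/-! ### The start of the program -/

/-- Register `5` receives `4 d n`, registers `2` and `3` the output bound `4 d n + 4 d` and register
`100` the bound `4 d n + 4 d + n + 2` for all loops. -/
def initCmd : Cmd :=
  .seq (countLoop 104 0 (.setIdx 5 (.add (.reg 5) (.add (.add (.reg 1) (.reg 1))
    (.add (.reg 1) (.reg 1))))))
  (.seq (.setIdx 2 (.add (.reg 5) (.add (.add (.reg 1) (.reg 1)) (.add (.reg 1) (.reg 1)))))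
  (.seq (.setIdx 3 (.reg 2)) (.setIdx 100 (.add (.reg 2) (.add (.reg 0) (.lit 2))))))

/-- A bound for the degrees of all polynomials involved. -/
def degBound (n d : ℕ) : ℕ := n * (4 * d) + 4 * d

open Classical in
/-- The polynomial matrices stored in the input state. -/
def inputPoly {n : ℕ} (M : Matrix (Fin n) (Fin n) (RatFunc ℂ)) (s : State ℂ) : PolyState where
  reg := s.idx
  arr := fun a i j => if h : i < n ∧ j < n then
      if a = 0 then (M ⟨i, h.1⟩ ⟨j, h.2⟩).num else if a = 1 then (M ⟨i, h.1⟩ ⟨j, h.2⟩).denom else 0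
    else 0

theorem exec_initCmd {n : ℕ} (M : Matrix (Fin n) (Fin n) (RatFunc ℂ)) :
    ∃ t s, Exec initCmd (inputState M) t s ∧ t ≤ 3 * n + 4 ∧
      Rep (degBound n (matDegree M) + n + 2) s (inputPoly M s) ∧ s.idx 0 = n ∧
      s.idx 1 = matDegree M ∧ s.idx 2 = degBound n (matDegree M) ∧
      s.idx 3 = degBound n (matDegree M) ∧ s.idx 5 = n * (4 * matDegree M) := by
  set d := matDegree M with hd
  -- Subscript expressions have no multiplication, so `4 d n` is computed by adding `4 d` in each of
  -- `n` rounds. Register `104` is zero in the input state.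
  have main := exec_countLoop (v := 104) (b := 0) (N := n) (T := 1)
    (c := .setIdx 5 (.add (.reg 5) (.add (.add (.reg 1) (.reg 1)) (.add (.reg 1) (.reg 1)))))
    (fun m s => s.val = (inputState M).val ∧ s.idx 0 = n ∧ s.idx 1 = d ∧ s.idx 104 = m ∧
      s.idx 5 = m * (4 * d))
    (fun _ _ h => h.2.1) (fun _ _ h => h.2.2.2.1) (by
      rintro m _ s ⟨h1, h2, h3, h4, h5⟩
      refine ⟨1, _, .setIdx s 5 _, le_rfl, h1, ?_, ?_, ?_, ?_⟩
      · rw [State.incr_idx_of_ne _ (by norm_num)]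
        exact h2
      · rw [State.incr_idx_of_ne _ (by norm_num)]
        exact h3
      · rw [State.incr_idx_self]
        exact congrArg (· + 1) h4
      · change IdxExpr.eval s _ = _
        simp only [IdxExpr.eval, h3, h5]
        ring) (inputState M) ⟨rfl, by simp [inputState], by simp [inputState, hd],
          by simp [inputState], by simp [inputState]⟩
  obtain ⟨t, s, h1, h2, hval, i0, i1, -, i5⟩ := main
  refine ⟨_, _, .seq h1 (.seq (.setIdx _ _ _) (.seq (.setIdx _ _ _) (.setIdx _ _ _))), by omega,
    ⟨?_, fun _ _ => rfl, fun a ha i j k hk => ?_, fun a i j => ?_⟩, ?_⟩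
  · simp only [IdxExpr.eval, Function.update_apply]
    simp [i0, i1, i5, degBound]
    ring
  · change s.val _ = _
    rw [hval]
    simp only [inputPoly]
    by_cases h : i < n ∧ j < n
    · match a with
      | 0 => simp [inputState, h]
      | 1 => simp [inputState, h]
      | a + 2 => simp [inputState]
    · match a with
      | 0 => simp [inputState, h]
      | 1 => simp [inputState, h]
      | a + 2 => simp [inputState]
  · simp only [inputPoly]
    have hle : ∀ i j, (M i j).num.natDegree ≤ d ∧ (M i j).denom.natDegree ≤ d := fun i j =>
      max_le_iff.1 (ratDegree_le i j)
    have hD : d < degBound n d + n + 2 := by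
      unfold degBound
      omega
    split_ifs
    · exact (hle _ _).1.trans_lt hD
    · exact (hle _ _).2.trans_lt hD
    · rw [natDegree_zero]; omega
    · rw [natDegree_zero]; omega
  · simp only [IdxExpr.eval, Function.update_apply]
    simp [i0, i1, i5, degBound]
    ring

/-! ### The whole program -/

theorem copyOp_spec {n N a b : ℕ} (σ : PolyState) (hn : n ≤ N)
    (h : ∀ i j, i < n → j < n → (σ.arr b i j).natDegree < N) :
    ∀ i j, i < n → j < n → (copyOp a b N σ).arr a i j = σ.arr b i j := fun i j hi hj =>
  PolyState.update_arr_self _ (hi.trans_le hn) (hj.trans_le hn) (h i j hi hj)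

theorem transposeOp_spec {n N a b : ℕ} (σ : PolyState) (hn : n ≤ N)
    (h : ∀ i j, i < n → j < n → (σ.arr b i j).natDegree < N) :
    ∀ i j, i < n → j < n → (transposeOp a b N σ).arr a i j = σ.arr b j i := fun i j hi hj =>
  PolyState.update_arr_self _ (hi.trans_le hn) (hj.trans_le hn) (h j i hj hi)

theorem copyOp_arr_of_ne {a b c : ℕ} (N : ℕ) (σ : PolyState) (h : c ≠ a) :
    (copyOp a b N σ).arr c = σ.arr c := PolyState.update_arr_of_ne _ _ _ h

theorem transposeOp_arr_of_ne {a b c : ℕ} (N : ℕ) (σ : PolyState) (h : c ≠ a) :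
    (transposeOp a b N σ).arr c = σ.arr c := PolyState.update_arr_of_ne _ _ _ h

/-- Arrays `x` and `y` hold numerators and denominators of a matrix `U` over `R`, of degree at most
`D`, for which `M * U` is regular and invertible at `p`. -/
def HoldsMultiplier {n : ℕ} (D : ℕ) (p : ℂ) (R : Subalgebra ℂ (RatFunc ℂ))
    (M : Matrix (Fin n) (Fin n) (RatFunc ℂ)) (x y : ℕ → ℕ → ℂ[X]) : Prop :=
  (∀ i j, i < n → j < n → (x i j).natDegree ≤ D ∧ (y i j).natDegree ≤ D ∧ y i j ≠ 0) ∧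
  ∃ U : Matrix (Fin n) (Fin n) (RatFunc ℂ), InGL R U ∧ InGL (regularAt p) (M * U) ∧
    ∀ i j : Fin n, U i j = toFrac (x i j) / toFrac (y i j)

theorem HoldsMultiplier.congr {n D : ℕ} {p : ℂ} {R : Subalgebra ℂ (RatFunc ℂ)}
    {M : Matrix (Fin n) (Fin n) (RatFunc ℂ)} {x y x' y' : ℕ → ℕ → ℂ[X]}
    (h : HoldsMultiplier D p R M x y) (hx : ∀ i j, i < n → j < n → x' i j = x i j)
    (hy : ∀ i j, i < n → j < n → y' i j = y i j) : HoldsMultiplier D p R M x' y' := by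
  obtain ⟨h1, U, h2, h3, h4⟩ := h
  refine ⟨fun i j hi hj => ?_, U, h2, h3, fun i j => ?_⟩
  · rw [hx i j hi hj, hy i j hi hj]
    exact h1 i j hi hj
  · rw [hx i j i.2 j.2, hy i j i.2 j.2]
    exact h4 i j

/-- Entries of degree at most `4 d` give a determinant of degree at most `4 d n`, the value `K` in
register `5`; `degBound` exceeds both `d + K` and the entry degrees. -/
theorem holdsMultiplier_reduceAll {n N d : ℕ} {p α β : ℤ} {R : Subalgebra ℂ (RatFunc ℂ)}
    {M : Matrix (Fin n) (Fin n) (RatFunc ℂ)} {σ : PolyState} {g : ℂ[X]}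
    (hN : N = degBound n d + n + 2)
    (h0 : σ.reg 0 = n) (h1 : σ.reg 1 = d) (h5 : σ.reg 5 = n * (4 * d))
    (hdeg : ∀ i j, i < n → j < n → (σ.arr 12 i j).natDegree ≤ 4 * d)
    (hM : (block n 12 σ).map toFrac = toFrac (poleProd ^ d) • M) (hdet : M.det ≠ 0)
    (hg : poleProd = (X - C (p : ℂ)) * g) (hgp : g.eval (p : ℂ) ≠ 0)
    (hl : (lin α β).eval (p : ℂ) ≠ 0)
    (hu : toFrac (lin α β) / toFrac (X - C (p : ℂ)) ∈ R ∧
      (toFrac (lin α β) / toFrac (X - C (p : ℂ)))⁻¹ ∈ R) :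
    (∀ v, v ≠ 4 → v ≠ 6 → v ≠ 7 → (reduceAll p α β N σ).reg v = σ.reg v) ∧
    (∀ b, b < 10 → (reduceAll p α β N σ).arr b = σ.arr b) ∧
    HoldsMultiplier (degBound n d) p R M ((reduceAll p α β N σ).arr 13)
      ((reduceAll p α β N σ).arr 14) := by
  have hdet0 : (block n 12 σ).det ≠ 0 := fun hz => by
    have e : toFrac (block n 12 σ).det = ((block n 12 σ).map toFrac).det := toFrac.map_det _
    rw [hz, map_zero, hM, Matrix.det_smul] at e
    exact mul_ne_zero (pow_ne_zero _ (toFrac_ne_zero (pow_ne_zero _ poleProd_ne_zero))) hdet e.symm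
  have hdetd : (block n 12 σ).det.natDegree ≤ σ.reg 5 := by
    rw [h5]
    exact natDegree_det_le fun i j => hdeg i j i.2 j.2
  have hred := reduceAll_spec (n := n) (N := N) (D := degBound n d) (R := R) (p := p) (α := α)
    (β := β) (σ := σ) h0 (by rw [h5, hN]; unfold degBound; omega)
    (by rw [hN]; omega) (by rw [h1, h5]; unfold degBound; omega) hl hu.1 hu.2
    (fun i j hi hj => (hdeg i j hi hj).trans (by unfold degBound; omega)) hdet0 hdetd
  set σ' := reduceAll p α β N σ
  obtain ⟨A, hA, ht⟩ := hred.eval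
  have hlin : lin α β ≠ 0 := fun hz => hl (by rw [hz, eval_zero])
  have hden := hred.den
  rw [h1, h5] at hden ht
  refine ⟨hred.reg, hred.arr, fun i j hi hj => ⟨hred.deg i j hi hj, ?_, ?_⟩, _,
    (inGL_of_tracked hM hg hgp hl hu.1 hu.2 hA ht).1,
    (inGL_of_tracked hM hg hgp hl hu.1 hu.2 hA ht).2, fun i j => ?_⟩
  · rw [hden i j hi hj]
    have e1 : (lin α β ^ d).natDegree ≤ d :=
      natDegree_pow_le.trans ((Nat.mul_le_mul_left _ (natDegree_lin_le α β)).trans (by omega))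
    have e2 : ((X - C (p : ℂ)) ^ (n * (4 * d))).natDegree = n * (4 * d) := by
      rw [natDegree_pow, natDegree_X_sub_C, mul_one]
    refine natDegree_mul_le.trans ?_
    unfold degBound
    omega
  · rw [hden i j hi hj]
    exact mul_ne_zero (pow_ne_zero _ hlin) (pow_ne_zero _ (X_sub_C_ne_zero _))
  · rw [hden i j i.2 j.2, Matrix.smul_apply, Matrix.map_apply, block_apply, smul_eq_mul, mul_comm,
      div_eq_mul_inv]

theorem block_clearAll {n N : ℕ} {M : Matrix (Fin n) (Fin n) (RatFunc ℂ)} {s : State ℂ}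
    (hM : ∀ i j, M i j ∈ ringS) (h1 : s.idx 1 = matDegree M) (hN : 4 * matDegree M < N)
    (hn : n ≤ N) :
    (clearAll N (inputPoly M s)).reg = s.idx ∧
    (∀ i j, i < n → j < n →
      ((clearAll N (inputPoly M s)).arr 0 i j).natDegree ≤ 4 * matDegree M) ∧
    (block n 0 (clearAll N (inputPoly M s))).map toFrac =
      toFrac (poleProd ^ matDegree M) • M := by
  have key : ∀ i j : Fin n,
      (clearAll N (inputPoly M s)).arr 0 i j * (M i j).denom =
        (M i j).num * poleProd ^ matDegree M ∧
      ((clearAll N (inputPoly M s)).arr 0 i j).natDegree ≤ 4 * matDegree M := by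
    intro i j
    obtain ⟨m, hm⟩ := exists_denom_dvd (hM i j)
    have a0 : (inputPoly M s).arr 0 i j = (M i j).num := by simp [inputPoly]
    have a1 : (inputPoly M s).arr 1 i j = (M i j).denom := by simp [inputPoly]
    have hle := max_le_iff.1 (ratDegree_le (M := M) i j)
    have := (clearAll_spec (m := m) (inputPoly M s) h1 hN).2 i j (i.2.trans_le hn)
      (j.2.trans_le hn)
    rw [a0, a1] at this
    exact this hle.1 hle.2 (RatFunc.monic_denom _) hm
  refine ⟨(clearAll_spec (m := 0) (inputPoly M s) h1 hN).1,
    fun i j hi hj => (key ⟨i, hi⟩ ⟨j, hj⟩).2, ?_⟩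
  ext1 i j
  rw [Matrix.map_apply, Matrix.smul_apply, block_apply, smul_eq_mul]
  have h := congrArg toFrac (key i j).1
  have hd := toFrac_ne_zero (RatFunc.denom_ne_zero (M i j))
  have hnd : M i j = toFrac (M i j).num / toFrac (M i j).denom :=
    (RatFunc.num_div_denom (M i j)).symm
  rw [map_mul, map_mul] at h
  conv_rhs => rw [hnd]
  rw [← mul_div_assoc, eq_div_iff hd, h, mul_comm]

theorem mainOp_spec {n N : ℕ} {M : Matrix (Fin n) (Fin n) (RatFunc ℂ)} {s : State ℂ}
    (hM : InGL ringS M) (hN : N = degBound n (matDegree M) + n + 2) (h0 : s.idx 0 = n)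
    (h1 : s.idx 1 = matDegree M) (h5 : s.idx 5 = n * (4 * matDegree M)) :
    (mainOp N (inputPoly M s)).reg 2 = s.idx 2 ∧ (mainOp N (inputPoly M s)).reg 3 = s.idx 3 ∧
    HoldsMultiplier (degBound n (matDegree M)) 2 ringOne M ((mainOp N (inputPoly M s)).arr 2)
      ((mainOp N (inputPoly M s)).arr 3) ∧
    HoldsMultiplier (degBound n (matDegree M)) 1 ringTwo M.transpose
      (fun i j => (mainOp N (inputPoly M s)).arr 4 j i)
      (fun i j => (mainOp N (inputPoly M s)).arr 5 j i) := by
  set d := matDegree M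
  set D := degBound n d with hD
  have hn : n ≤ N := by omega
  have hDN : D < N := by omega
  have h4D : 4 * d ≤ D := by rw [hD, degBound]; omega
  obtain ⟨r1, g1, m1⟩ := block_clearAll (s := s) hM.mem h1 (N := N) (by omega) hn
  set σ₁ := clearAll N (inputPoly M s)
  set σ₂ := copyOp 12 0 N σ₁ with hσ₂
  have c2 : ∀ i j, i < n → j < n → σ₂.arr 12 i j = σ₁.arr 0 i j :=
    copyOp_spec σ₁ hn fun i j hi hj => (g1 i j hi hj).trans_lt (by omega)
  have b2 : block n 12 σ₂ = block n 0 σ₁ := by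
    ext1 i j
    exact c2 i j i.2 j.2
  have r2 : σ₂.reg = s.idx := r1
  have hp1 : poleProd = (X - C ((2 : ℤ) : ℂ)) * (X * (X - C 1)) := by
    rw [poleProd_eq, Int.cast_ofNat]
    ring
  have hp2 : poleProd = (X - C ((1 : ℤ) : ℂ)) * (X * (X - C 2)) := by
    rw [poleProd_eq, Int.cast_one]
    ring
  obtain ⟨r3, f3, u3⟩ := holdsMultiplier_reduceAll (N := N) (d := d) (p := 2) (α := 1) (β := 0)
    (R := ringOne) (M := M) (σ := σ₂) hN (by rw [r2, h0]) (by rw [r2, h1]) (by rw [r2, h5])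
    (fun i j hi hj => by rw [c2 i j hi hj]; exact g1 i j hi hj) (by rw [b2, m1])
    hM.det_ne_zero hp1 (by norm_num) (by norm_num [lin]) mul_inv_mem_ringOne
  set σ₃ := reduceAll 2 1 0 N σ₂ with hσ₃
  set σ₄ := copyOp 2 13 N σ₃ with hσ₄
  set σ₅ := copyOp 3 14 N σ₄ with hσ₅
  set σ₆ := transposeOp 12 0 N σ₅ with hσ₆
  have e13 : ∀ i j, i < n → j < n → σ₄.arr 2 i j = σ₃.arr 13 i j :=
    copyOp_spec σ₃ hn fun i j hi hj => (u3.1 i j hi hj).1.trans_lt hDN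
  have e14 : ∀ i j, i < n → j < n → σ₅.arr 3 i j = σ₃.arr 14 i j := by
    have e : σ₄.arr 14 = σ₃.arr 14 := copyOp_arr_of_ne _ _ (by norm_num)
    have := copyOp_spec (a := 3) (b := 14) σ₄ hn fun i j hi hj => by
      rw [e]
      exact (u3.1 i j hi hj).2.1.trans_lt hDN
    rwa [e] at this
  have z5 : σ₅.arr 0 = σ₁.arr 0 := by
    rw [hσ₅, copyOp_arr_of_ne _ _ (by norm_num), hσ₄, copyOp_arr_of_ne _ _ (by norm_num),
      f3 0 (by norm_num), hσ₂, copyOp_arr_of_ne _ _ (by norm_num)]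
  have c6 : ∀ i j, i < n → j < n → σ₆.arr 12 i j = σ₁.arr 0 j i := by
    have := transposeOp_spec (a := 12) (b := 0) σ₅ hn fun i j hi hj => by
      rw [z5]
      exact (g1 i j hi hj).trans_lt (by omega)
    rwa [z5] at this
  have b6 : (block n 12 σ₆).map toFrac = toFrac (poleProd ^ d) • M.transpose := by
    have : block n 12 σ₆ = (block n 0 σ₁).transpose := by
      ext1 i j
      exact c6 i j i.2 j.2
    rw [this, Matrix.transpose_map, m1, Matrix.transpose_smul]
  have r6 : ∀ v, v ≠ 4 → v ≠ 6 → v ≠ 7 → σ₆.reg v = s.idx v := fun v h4 h6 h7 =>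
    (r3 v h4 h6 h7).trans (by rw [r2])
  obtain ⟨r7, f7, u7⟩ := holdsMultiplier_reduceAll (N := N) (d := d) (p := 1) (α := 0) (β := 1)
    (R := ringTwo) (M := M.transpose) (σ := σ₆) hN
    (by rw [r6 0 (by norm_num) (by norm_num) (by norm_num), h0])
    (by rw [r6 1 (by norm_num) (by norm_num) (by norm_num), h1])
    (by rw [r6 5 (by norm_num) (by norm_num) (by norm_num), h5])
    (fun i j hi hj => by rw [c6 i j hi hj]; exact g1 j i hj hi) b6
    (by rw [Matrix.det_transpose]; exact hM.det_ne_zero) hp2 (by norm_num) (by norm_num [lin])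
    mul_inv_mem_ringTwo
  set σ₇ := reduceAll 1 0 1 N σ₆ with hσ₇
  set σ₈ := transposeOp 4 13 N σ₇ with hσ₈
  have hfin : mainOp N (inputPoly M s) = transposeOp 5 14 N σ₈ := rfl
  rw [hfin]
  have e4 : ∀ i j, i < n → j < n → σ₈.arr 4 i j = σ₇.arr 13 j i :=
    transposeOp_spec σ₇ hn fun i j hi hj => (u7.1 i j hi hj).1.trans_lt hDN
  have e5 : ∀ i j, i < n → j < n → (transposeOp 5 14 N σ₈).arr 5 i j = σ₇.arr 14 j i := by
    have e : σ₈.arr 14 = σ₇.arr 14 := transposeOp_arr_of_ne _ _ (by norm_num)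
    have := transposeOp_spec (a := 5) (b := 14) σ₈ hn fun i j hi hj => by
      rw [e]
      exact (u7.1 i j hi hj).2.1.trans_lt hDN
    rwa [e] at this
  have q2 : (transposeOp 5 14 N σ₈).arr 2 = σ₄.arr 2 := by
    rw [transposeOp_arr_of_ne _ _ (by norm_num), hσ₈, transposeOp_arr_of_ne _ _ (by norm_num),
      f7 2 (by norm_num), hσ₆, transposeOp_arr_of_ne _ _ (by norm_num), hσ₅,
      copyOp_arr_of_ne _ _ (by norm_num)]
  have q3 : (transposeOp 5 14 N σ₈).arr 3 = σ₅.arr 3 := by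
    rw [transposeOp_arr_of_ne _ _ (by norm_num), hσ₈, transposeOp_arr_of_ne _ _ (by norm_num),
      f7 3 (by norm_num), hσ₆, transposeOp_arr_of_ne _ _ (by norm_num)]
  have q4 : (transposeOp 5 14 N σ₈).arr 4 = σ₈.arr 4 := transposeOp_arr_of_ne _ _ (by norm_num)
  have rfin : ∀ v, v ≠ 4 → v ≠ 6 → v ≠ 7 → (transposeOp 5 14 N σ₈).reg v = s.idx v :=
    fun v h4 h6 h7 => (r7 v h4 h6 h7).trans (r6 v h4 h6 h7)
  refine ⟨rfin 2 (by norm_num) (by norm_num) (by norm_num),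
    rfin 3 (by norm_num) (by norm_num) (by norm_num), ?_, ?_⟩
  · rw [q2, q3]
    exact_mod_cast u3.congr e13 e14
  · rw [q4]
    exact_mod_cast u7.congr (fun i j hi hj => e4 j i hj hi)
      fun i j hi hj => e5 j i hj hi

/-! ### Reading off the result -/

theorem readPoly_eq {N a e i j : ℕ} {s : State ℂ} {σ : PolyState} (h : Rep N s σ) (ha : a < 100)
    (he : e < N) (hd : (σ.arr a i j).natDegree ≤ e) : readPoly s a e i j = σ.arr a i j := by
  rw [(σ.arr a i j).as_sum_range_C_mul_X_pow' (Nat.lt_succ_of_le hd)]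
  refine Finset.sum_congr rfl fun k hk => ?_
  rw [h.coeff a ha i j k (by rw [Finset.mem_range] at hk; omega)]

theorem stores_of_rep {n N r x y e : ℕ} {s : State ℂ} {σ : PolyState}
    {U : Matrix (Fin n) (Fin n) (RatFunc ℂ)} (h : Rep N s σ) (hx : x < 100) (hy : y < 100)
    (hr : s.idx r = e) (he : e < N)
    (hd : ∀ i j, i < n → j < n → (σ.arr x i j).natDegree ≤ e ∧ (σ.arr y i j).natDegree ≤ e ∧
      σ.arr y i j ≠ 0)
    (hU : ∀ i j : Fin n, U i j = toFrac (σ.arr x i j) / toFrac (σ.arr y i j)) :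
    Stores s r x y U := by
  intro i j
  obtain ⟨d1, d2, d3⟩ := hd i j i.2 j.2
  rw [hr, readPoly_eq h hx he d1, readPoly_eq h hy he d2]
  exact ⟨d3, hU i j⟩

end ClutchingReduction

end

open FieldProgram ClutchingReduction in
/-- One program, whose number of steps is bounded by one polynomial in `n` and `d_w(M)`, finds for
every `M ∈ GL_n(ℂ[w, w⁻¹, (w-1)⁻¹, (w-2)⁻¹])` the multipliers `U₁` (left in register `2` and
arrays `2`, `3`) and `U₂` (left in register `3` and arrays `4`, `5`). -/
theorem lemma4p3 :
    ∃ (P : Cmd) (f : MvPolynomial (Fin 2) ℕ), ∀ (n : ℕ) (M : GL (Fin n) ringS),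
      ∃ (t : ℕ) (s : State ℂ),
        Exec P (inputState (toRat M)) t s ∧
        t ≤ MvPolynomial.eval ![n, matDegree (toRat M)] f ∧
        s.idx 2 ≤ MvPolynomial.eval ![n, matDegree (toRat M)] f ∧
        s.idx 3 ≤ MvPolynomial.eval ![n, matDegree (toRat M)] f ∧
        ∃ (U₁ : GL (Fin n) ringOne) (U₂ : GL (Fin n) ringTwo) (L : GL (Fin n) ringLaurent),
          Stores s 2 2 3 (toRat U₁) ∧
          Stores s 3 4 5 (toRat U₂) ∧
          toRat U₂ * toRat M * toRat U₁ = toRat L := by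
  obtain ⟨c, l, T, -, hc⟩ := realizable_mainOp
  let B : MvPolynomial (Fin 2) ℕ :=
    MvPolynomial.X 0 * (4 * MvPolynomial.X 1) + 4 * MvPolynomial.X 1
  refine ⟨.seq initCmd c, 3 * MvPolynomial.X 0 + 4 +
    T.eval₂ MvPolynomial.C (B + MvPolynomial.X 0 + 2) + B, fun n M => ?_⟩
  have hM := inGL_toRat M
  set W := toRat M
  have hB : MvPolynomial.eval ![n, matDegree W] B = degBound n (matDegree W) := by simp [B, degBound]
  have hT : MvPolynomial.eval ![n, matDegree W]
      (T.eval₂ MvPolynomial.C (B + MvPolynomial.X 0 + 2)) =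
        T.eval (degBound n (matDegree W) + n + 2) := by
    rw [Polynomial.hom_eval₂, map_add, map_add, hB]
    have : (MvPolynomial.eval ![n, matDegree W]).comp MvPolynomial.C = RingHom.id ℕ := by
      ext
      simp
    rw [this]
    simp [Polynomial.eval₂_id]
  obtain ⟨t₀, s₀, x0, ht0, hrep, i0, i1, i2, i3, i5⟩ := exec_initCmd W
  obtain ⟨t₁, s₁, x1, ht1, hrep1, -⟩ := hc _ _ _ hrep
  obtain ⟨k2, k3, ⟨d1, V₁, v1, w1, e1⟩, ⟨d2, V₂, v2, w2, e2⟩⟩ :=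
    mainOp_spec hM rfl i0 i1 i5
  have j2 : s₁.idx 2 = degBound n (matDegree W) := by rw [hrep1.reg 2 (by norm_num), k2, i2]
  have j3 : s₁.idx 3 = degBound n (matDegree W) := by rw [hrep1.reg 3 (by norm_num), k3, i3]
  have hf : MvPolynomial.eval ![n, matDegree W] (3 * MvPolynomial.X 0 + 4 +
      T.eval₂ MvPolynomial.C (B + MvPolynomial.X 0 + 2) + B) =
      3 * n + 4 + T.eval (degBound n (matDegree W) + n + 2) + degBound n (matDegree W) := by
    rw [map_add, map_add, hT, hB]
    simp
  have v2' := v2.transpose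
  have w2' : InGL (regularAt 1) (V₂.transpose * W) := by
    have := w2.transpose
    rwa [Matrix.transpose_mul, Matrix.transpose_transpose] at this
  have hS : InGL ringS (V₂.transpose * W * V₁) :=
    ((v2'.mono ringTwo_le_ringS).mul hM).mul (v1.mono ringOne_le_ringS)
  have h1 : InGL (regularAt 1) (V₂.transpose * W * V₁) := w2'.mul (v1.mono ringOne_le_regularAt)
  have h2 : InGL (regularAt 2) (V₂.transpose * W * V₁) := by
    rw [Matrix.mul_assoc]
    exact (v2'.mono ringTwo_le_regularAt).mul w1
  obtain ⟨U₁, hU₁⟩ := v1.exists_toRat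
  obtain ⟨U₂, hU₂⟩ := v2'.exists_toRat
  obtain ⟨L, hL⟩ := (hS.laurent h1 h2).exists_toRat
  refine ⟨_, s₁, .seq x0 x1, by rw [hf]; omega, by rw [hf]; omega, by rw [hf]; omega,
    U₁, U₂, L, ?_, ?_, ?_⟩
  · rw [hU₁]
    exact stores_of_rep hrep1 (by norm_num) (by norm_num) j2 (by omega) d1 e1
  · rw [hU₂]
    exact stores_of_rep hrep1 (by norm_num) (by norm_num) j3 (by omega)
      (fun i j hi hj => d2 j i hj hi) fun i j => e2 j i
  · rw [hU₁, hU₂, hL]
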